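/- Let $(M,F,d\mathfrak m)$ be a compact FMMM: $M$ is a compact connected smooth manifold of dimension $n\ge 1$, with or without boundary, $F:TM\to[0,\infty)$ is a reversible Finsler metric ($F$ is $C^\infty$ off the zero section, $F(x,cy)=|c|F(x,y)$ for all $c\in\mathbb R$, and the Hessian of $\tfrac12F^2(x,\cdot)$ is positive definite at every $y\neq0$), and $d\mathfrak m$ is a measure with positive smooth densities in charts. Let $F^*(\eta)=\sup_{y\ne0}\eta(y)/F(y)$ be the dual metric on $T^*M$, let $\mathscr X$ be the completion of $C_0^\infty(M)$ (smooth functions with compact support in the interior of $M$) for the norm $\|u\|_{L^2}+\|F^*(du)\|_{L^2}$, and set $$E(u)=\frac{\int_M F^*(du)^2\,d\mathfrak m}{\int_M u^2\,d\mathfrak m},\qquad \mathcal S=\{u\in\mathscr X:\|u\|_{L^2}=1\},\qquad \mathfrak p:\mathcal S\to\mathbb P(\mathscr X)=\mathcal S/\{\pm1\}.$$ Let $\mathscr C^1$ (resp. $\mathscr C^2$) be the family of closed (resp. compact) subsets of $\mathcal S$, and let $\mathscr D^\alpha=\{A\in\mathscr C^\alpha: A=-A\}$, $\alpha=1,2$.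 For $A\in\mathscr C^\alpha$ let $\mathrm{Dim}_{LS}(A)\in\mathbb N\cup\{\infty\}$ be the least $k$ such that $\mathfrak p(A)$ is covered by $k$ closed subsets of $\mathbb P(\mathscr X)$ each contractible in $\mathbb P(\mathscr X)$. For $A\in\mathscr D^\alpha$ let $\mathrm{Dim}_K(A)\in\mathbb N\cup\{\infty\}$ be the Krasnoselskii genus, the least $m$ such that there is an odd continuous map $A\to\mathbb R^m\setminus\{0\}$. (In both cases the value is $\infty$ if there is no such number.) For a family $\mathscr C$ of subsets of $\mathcal S$ and $\mathrm{Dim}:\mathscr C\to\mathbb N\cup\{\infty\}$, the $(\mathscr C,\mathrm{Dim})$-spectrum consists of $$\lambda_k=\sup\bigl\{\lambda\in[0,\infty]:\ \sup\{\mathrm{Dim}(A): A\in\mathscr C,\ A\subset E^{-1}[0,\lambda]\}<k\bigr\},\qquad k\ge1$$ (with $\sup\emptyset=0$). The pair $(\mathscr C,\mathrm{Dim})$ is a dimension pair if $\mathscr C$ contains $\emptyset$ and $V\cap\mathcal S$ for every $k$-dimensional linear subspace $V\subset\mathscr X$, $k\ge1$, and is stable under odd homeomorphisms $h:\mathcal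 S\to\mathcal S$; and if $\mathrm{Dim}(A)=0$ exactly for $A=\emptyset$, $\mathrm{Dim}$ is monotone under inclusion, $\mathrm{Dim}(V\cap\mathcal S)\ge k$ for every $k$-dimensional $V$, $k\ge 1$, and $\mathrm{Dim}(h(A))=\mathrm{Dim}(A)$ for all $A\in\mathscr C$ and all such $h$. A dimension pair (assigned to every compact FMMM) is faithful if for every compact Riemannian manifold $(M,g)$, regarded as the FMMM $(M,\sqrt g,d\mathrm{vol}_g)$, one has $\lambda_k=\lambda_k^\Delta$ for all $k\ge1$, where $\lambda^\Delta_1\le\lambda^\Delta_2\le\cdots$ are the eigenvalues of the Beltrami–Laplacian ($-\Delta u=\lambda u$ weakly, $u\in\mathscr X$; Dirichlet condition if $\partial M\ne\emptyset$), counted with multiplicity. **Theorem.** For every compact FMMM and every $\alpha\in\{1,2\}$: 1. $\mathrm{Dim}_{LS}(A)=\mathrm{Dim}_K(A)$ for every $A\in\mathscr D^\alpha$; 2. the $k$-th eigenvalues of $(\mathscr C^\alpha,\mathrm{Dim}_{LS})$ and of $(\mathscr D^\alpha,\mathrm{Dim}_K)$ coincide, $\lambda_k^{LS,\alpha}=\lambda_k^{K,\alpha}$,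 for every $k\ge1$. Moreover, for each $\alpha\in\{1,2\}$, $(\mathscr D^\alpha,\mathrm{Dim}_K)$ is a faithful dimension pair. -/

import Mathlib

open MeasureTheory Set Topology
open scoped Manifold ContDiff ENNReal NNReal

universe u

noncomputable section

namespace FinslerSpectrum

/-! ### Finsler metrics -/

/-- The fundamental tensor `g_y(u, v) = ½ ∂²/∂s∂t F²(y + s u + t v)` at `s = t = 0` of a function
`F` on a real vector space. -/
def fundamentalTensor {V : Type*} [AddCommGroup V] [Module ℝ V] (F : V → ℝ) (y u v : V) : ℝ :=
  (1 / 2) * deriv (fun s : ℝ => deriv (fun t : ℝ => F (y + s • u + t • v) ^ 2) 0) 0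

/-- A reversible Finsler metric on an `n`-dimensional smooth manifold `M` whose (smooth) boundary
may be empty. -/
structure FinslerMetric (n : ℕ) [NeZero n] (M : Type*) [TopologicalSpace M]
    [ChartedSpace (EuclideanHalfSpace n) M] [IsManifold (𝓡∂ n) ∞ M] where
  toFun : (x : M) → TangentSpace (𝓡∂ n) x → ℝ
  nonneg : ∀ x y, 0 ≤ toFun x y
  smooth : ContMDiffOn (𝓡∂ n).tangent 𝓘(ℝ, ℝ) ∞
    (fun p : TangentBundle (𝓡∂ n) M => toFun p.proj p.snd) {p | p.snd ≠ 0}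
  homogeneous : ∀ (x : M) (c : ℝ) (y : TangentSpace (𝓡∂ n) x), toFun x (c • y) = |c| * toFun x y
  posDef : ∀ (x : M) (y v : TangentSpace (𝓡∂ n) x), y ≠ 0 → v ≠ 0 →
    0 < fundamentalTensor (toFun x) y v v

section Finsler

variable {n : ℕ} [NeZero n] {M : Type*} [TopologicalSpace M]
    [ChartedSpace (EuclideanHalfSpace n) M] [IsManifold (𝓡∂ n) ∞ M]

/-- The co-Finsler (dual) metric `F*(η) = sup_{y ≠ 0} η(y) / F(y)`. -/
def FinslerMetric.dual (F : FinslerMetric n M) (x : M) (η : TangentSpace (𝓡∂ n) x →L[ℝ] ℝ) : ℝ :=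
  ⨆ y : {y : TangentSpace (𝓡∂ n) x // y ≠ 0}, η y.1 / F.toFun x y.1

/-- The differential of a real function, as a covector. -/
def differential (n : ℕ) [NeZero n] {M : Type*} [TopologicalSpace M]
    [ChartedSpace (EuclideanHalfSpace n) M] (u : M → ℝ) (x : M) : TangentSpace (𝓡∂ n) x →L[ℝ] ℝ :=
  mfderiv (𝓡∂ n) 𝓘(ℝ, ℝ) u x

theorem FinslerMetric.pos (F : FinslerMetric n M) (x : M) (y : TangentSpace (𝓡∂ n) x)
    (hy : y ≠ 0) : 0 < F.toFun x y := by
  have h := F.posDef x y y hy hy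
  refine lt_of_le_of_ne (F.nonneg x y) fun h0 => ?_
  have h1 : ∀ s t : ℝ, F.toFun x (y + s • y + t • y) = 0 := by
    intro s t
    have : y + s • y + t • y = (1 + s + t) • y := by simp [add_smul]
    rw [this, F.homogeneous, ← h0, mul_zero]
  simp [fundamentalTensor, h1] at h

end Finsler

/-! ### Measures -/

section Measures

variable {n : ℕ} [NeZero n] {M : Type*} [TopologicalSpace M]
    [ChartedSpace (EuclideanHalfSpace n) M] [MeasurableSpace M]

/-- In the chart around `x₀` the measure `m` is `σ dx¹ ⋯ dxⁿ`. -/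
def HasChartDensity (m : Measure M) (x₀ : M) (σ : EuclideanSpace ℝ (Fin n) → ℝ) : Prop :=
  (m.restrict (extChartAt (𝓡∂ n) x₀).source).map (extChartAt (𝓡∂ n) x₀) =
    (volume.restrict (extChartAt (𝓡∂ n) x₀).target).withDensity fun z => ENNReal.ofReal (σ z)

/-- A smooth measure: it has a positive smooth density in the charts. -/
def IsSmoothMeasure (n : ℕ) [NeZero n] {M : Type*} [TopologicalSpace M]
    [ChartedSpace (EuclideanHalfSpace n) M] [MeasurableSpace M] (m : Measure M) : Prop :=
  ∀ x₀ : M, ∃ σ : EuclideanSpace ℝ (Fin n) → ℝ,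
    ContDiffOn ℝ ∞ σ (extChartAt (𝓡∂ n) x₀).target ∧
    (∀ z ∈ (extChartAt (𝓡∂ n) x₀).target, 0 < σ z) ∧ HasChartDensity m x₀ σ

end Measures

/-! ### Compact Finsler metric measure manifolds -/

/-- A compact Finsler metric measure manifold: a compact connected smooth manifold, with or without
boundary, with a reversible Finsler metric and a smooth measure. -/
structure CompactFMMM : Type (u + 1) where
  n : ℕ
  [neZero : NeZero n]
  M : Type u
  [topology : TopologicalSpace M]
  [charted : ChartedSpace (EuclideanHalfSpace n) M]
  [manifold : IsManifold (𝓡∂ n) ∞ M]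
  [t2 : T2Space M]
  [compact : CompactSpace M]
  [connected : ConnectedSpace M]
  [measurable : MeasurableSpace M]
  [borel : BorelSpace M]
  F : FinslerMetric n M
  m : Measure M
  smooth_measure : IsSmoothMeasure n m

attribute [instance] CompactFMMM.neZero CompactFMMM.topology CompactFMMM.charted
  CompactFMMM.manifold CompactFMMM.t2 CompactFMMM.compact CompactFMMM.connected
  CompactFMMM.measurable CompactFMMM.borel

variable (𝓜 : CompactFMMM.{u})

/-- The submodule of smooth functions with (compact) support in the interior of `M`. -/
def CompactFMMM.testSubmodule : Submodule ℝ (𝓜.M → ℝ) where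
  carrier := {u | ContMDiff (𝓡∂ 𝓜.n) 𝓘(ℝ, ℝ) ∞ u ∧ tsupport u ⊆ (𝓡∂ 𝓜.n).interior 𝓜.M}
  zero_mem' := ⟨contMDiff_const, by simp [tsupport]⟩
  add_mem' := fun {u v} hu hv => ⟨hu.1.add hv.1,
    (tsupport_add u v).trans (union_subset hu.2 hv.2)⟩
  smul_mem' := fun c u hu => ⟨by
      have h : ContMDiff (𝓡∂ 𝓜.n) 𝓘(ℝ, ℝ) ∞ (fun _ : 𝓜.M => c) := contMDiff_const
      exact h.smul hu.1,
    (closure_mono (Function.support_const_smul_subset c u)).trans hu.2⟩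

/-- The space `C₀^∞(M)`. -/
def CompactFMMM.TestFunction : Type u := 𝓜.testSubmodule

instance : AddCommGroup 𝓜.TestFunction := inferInstanceAs (AddCommGroup 𝓜.testSubmodule)
instance : Module ℝ 𝓜.TestFunction := inferInstanceAs (Module ℝ 𝓜.testSubmodule)
instance : CoeFun 𝓜.TestFunction (fun _ => 𝓜.M → ℝ) := ⟨fun u => u.1⟩

/-- The function `x ↦ F*(du_x)`. -/
def CompactFMMM.gradAbs (u : 𝓜.M → ℝ) (x : 𝓜.M) : ℝ := 𝓜.F.dual x (differential 𝓜.n u x)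

/-- `‖u‖_{L²}` for a test function. -/
def CompactFMMM.testL2 (u : 𝓜.TestFunction) : ℝ := √(∫ x, u x ^ 2 ∂𝓜.m)

/-- `‖F*(du)‖_{L²}` for a test function. -/
def CompactFMMM.testGrad (u : 𝓜.TestFunction) : ℝ := √(∫ x, 𝓜.gradAbs u x ^ 2 ∂𝓜.m)

/-! #### The two functionals are seminorms on `C₀^∞(M)` -/

section Aux

variable {n : ℕ} [NeZero n] {M : Type*} [TopologicalSpace M]
    [ChartedSpace (EuclideanHalfSpace n) M] [IsManifold (𝓡∂ n) ∞ M]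

/-- The tangent vector at `x` with coordinates `v` in the trivialization around `x₀`. -/
def frameVec (x₀ x : M) (v : EuclideanSpace ℝ (Fin n)) : TangentSpace (𝓡∂ n) x :=
  (trivializationAt (EuclideanSpace ℝ (Fin n)) (TangentSpace (𝓡∂ n)) x₀).symmL ℝ x v

theorem frameVec_ne {x₀ x : M} (hx : x ∈ (chartAt (EuclideanHalfSpace n) x₀).source) {v : EuclideanSpace ℝ (Fin n)}
    (hv : v ≠ 0) : frameVec x₀ x v ≠ 0 := by
  intro h
  have h1 := (trivializationAt (EuclideanSpace ℝ (Fin n)) (TangentSpace (𝓡∂ n)) x₀).continuousLinearMapAt_symmL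
    (R := ℝ) (b := x) (by simpa using hx) v
  rw [show (trivializationAt (EuclideanSpace ℝ (Fin n)) (TangentSpace (𝓡∂ n)) x₀).symmL ℝ x v = 0 from h, map_zero] at h1
  exact hv h1.symm

theorem frameVec_surj {x₀ x : M} (hx : x ∈ (chartAt (EuclideanHalfSpace n) x₀).source)
    (y : TangentSpace (𝓡∂ n) x) : ∃ v : EuclideanSpace ℝ (Fin n), frameVec x₀ x v = y :=
  ⟨_, (trivializationAt (EuclideanSpace ℝ (Fin n)) (TangentSpace (𝓡∂ n)) x₀).symmL_continuousLinearMapAt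
    (R := ℝ) (b := x) (by simpa using hx) y⟩

theorem frameVec_smul (x₀ x : M) (c : ℝ) (v : EuclideanSpace ℝ (Fin n)) :
    frameVec x₀ x (c • v) = c • frameVec x₀ x v := by
  simp only [frameVec]
  exact map_smul _ _ _

theorem range_dual (F : FinslerMetric n M) {x₀ x : M}
    (hx : x ∈ (chartAt (EuclideanHalfSpace n) x₀).source) (η : TangentSpace (𝓡∂ n) x →L[ℝ] ℝ) :
    range (fun y : {y : TangentSpace (𝓡∂ n) x // y ≠ 0} => η y.1 / F.toFun x y.1) =
      (fun v : Metric.sphere (0 : EuclideanSpace ℝ (Fin n)) 1 => η (frameVec x₀ x v) / F.toFun x (frameVec x₀ x v)) ''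
        univ := by
  ext r
  simp only [mem_range, image_univ, Subtype.exists]
  constructor
  · rintro ⟨y, hy, rfl⟩
    obtain ⟨v, rfl⟩ := frameVec_surj hx y
    have hv : v ≠ 0 := by
      rintro rfl
      apply hy
      simpa using frameVec_smul x₀ x 0 (0 : EuclideanSpace ℝ (Fin n))
    have hn : 0 < ‖v‖ := norm_pos_iff.2 hv
    refine ⟨‖v‖⁻¹ • v, by simp [norm_smul, hn.ne'], ?_⟩
    rw [frameVec_smul, F.homogeneous, map_smul, abs_of_pos (inv_pos.2 hn), smul_eq_mul,
      mul_div_mul_left _ _ (inv_pos.2 hn).ne']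
  · rintro ⟨v, hv, rfl⟩
    have : v ≠ 0 := by
      rintro rfl
      simp at hv
    exact ⟨_, frameVec_ne hx this, rfl⟩

theorem continuousOn_frame (x₀ : M) :
    Continuous fun p : (chartAt (EuclideanHalfSpace n) x₀).source × EuclideanSpace ℝ (Fin n) =>
      (⟨p.1.1, frameVec x₀ p.1.1 p.2⟩ : TangentBundle (𝓡∂ n) M) := by
  set T := trivializationAt (EuclideanSpace ℝ (Fin n)) (TangentSpace (𝓡∂ n) : M → Type _) x₀ with hT
  have h1 : ContinuousOn T.toOpenPartialHomeomorph.symm T.target := T.continuousOn_invFun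
  have h2 : Continuous fun p : (chartAt (EuclideanHalfSpace n) x₀).source × EuclideanSpace ℝ (Fin n) =>
      ((p.1.1, p.2) : M × EuclideanSpace ℝ (Fin n)) := by fun_prop
  have h3 : ∀ p : (chartAt (EuclideanHalfSpace n) x₀).source × EuclideanSpace ℝ (Fin n),
      ((p.1.1, p.2) : M × EuclideanSpace ℝ (Fin n)) ∈ T.target := by
    intro p
    rw [T.mem_target]
    exact (TangentBundle.trivializationAt_baseSet (I := 𝓡∂ n) x₀).symm ▸ p.1.2
  refine (h1.comp_continuous h2 h3).congr fun p => ?_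
  have hb : p.1.1 ∈ T.baseSet := (h3 p |> T.mem_target.1)
  rw [frameVec, T.symmL_apply]
  · exact (T.mk_symm hb p.2).symm
  · exact hb

theorem continuous_differential {u : M → ℝ} (hu : ContMDiff (𝓡∂ n) 𝓘(ℝ, ℝ) ∞ u) :
    Continuous fun p : TangentBundle (𝓡∂ n) M => differential n u p.proj p.snd := by
  have h := (hu.continuous_tangentMap (by simp))
  have h2 := (tangentBundleModelSpaceHomeomorph 𝓘(ℝ, ℝ)).continuous.comp h
  exact continuous_snd.comp h2

theorem continuous_dual (F : FinslerMetric n M) {u : M → ℝ}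
    (hu : ContMDiff (𝓡∂ n) 𝓘(ℝ, ℝ) ∞ u) :
    Continuous fun x => F.dual x (differential n u x) := by
  rw [continuous_iff_continuousAt]
  intro x₀
  set U := (chartAt (EuclideanHalfSpace n) x₀).source with hU
  have hUo : IsOpen U := (chartAt (EuclideanHalfSpace n) x₀).open_source
  have hx₀ : x₀ ∈ U := mem_chart_source _ x₀
  suffices h : Continuous fun x : U => F.dual x.1 (differential n u x.1) from
    (continuousOn_iff_continuous_domRestrict.2 h).continuousAt (hUo.mem_nhds hx₀)
  have hb : Continuous fun p : U × Metric.sphere (0 : EuclideanSpace ℝ (Fin n)) 1 =>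
      (⟨p.1.1, frameVec x₀ p.1.1 p.2.1⟩ : TangentBundle (𝓡∂ n) M) :=
    (continuousOn_frame x₀).comp (g := fun p : U × EuclideanSpace ℝ (Fin n) =>
      (⟨p.1.1, frameVec x₀ p.1.1 p.2⟩ : TangentBundle (𝓡∂ n) M))
      (f := fun p : U × Metric.sphere (0 : EuclideanSpace ℝ (Fin n)) 1 => (p.1, p.2.1)) (by fun_prop)
  have hne : ∀ p : U × Metric.sphere (0 : EuclideanSpace ℝ (Fin n)) 1, frameVec x₀ p.1.1 p.2.1 ≠ 0 := by
    intro p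
    refine frameVec_ne p.1.2 ?_
    intro h0
    have := p.2.2
    rw [h0] at this
    simp at this
  have hF := F.smooth.continuousOn.comp_continuous hb (fun p => hne p)
  have hd := (continuous_differential hu).comp hb
  have hq : Continuous fun p : U × Metric.sphere (0 : EuclideanSpace ℝ (Fin n)) 1 =>
      differential n u p.1.1 (frameVec x₀ p.1.1 p.2.1) / F.toFun p.1.1 (frameVec x₀ p.1.1 p.2.1) :=
    hd.div hF fun p => (F.pos _ _ (hne p)).ne'
  have hs := isCompact_univ.continuous_sSup (f := fun (x : U) (v : Metric.sphere (0 : EuclideanSpace ℝ (Fin n)) 1) =>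
    differential n u x.1 (frameVec x₀ x.1 v.1) / F.toFun x.1 (frameVec x₀ x.1 v.1)) hq
  refine hs.congr fun x => ?_
  rw [← range_dual F x.2]
  rfl

theorem bddAbove_dual (F : FinslerMetric n M) (x : M) (η : TangentSpace (𝓡∂ n) x →L[ℝ] ℝ) :
    BddAbove (range fun y : {y : TangentSpace (𝓡∂ n) x // y ≠ 0} => η y.1 / F.toFun x y.1) := by
  have hx : x ∈ (chartAt (EuclideanHalfSpace n) x).source := mem_chart_source _ x
  rw [range_dual F hx]
  refine (isCompact_univ.image ?_).bddAbove
  have hb : Continuous fun v : Metric.sphere (0 : EuclideanSpace ℝ (Fin n)) 1 =>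
      (⟨x, frameVec x x v.1⟩ : TangentBundle (𝓡∂ n) M) :=
    (continuousOn_frame x).comp (f := fun v : Metric.sphere (0 : EuclideanSpace ℝ (Fin n)) 1 =>
      ((⟨x, hx⟩, v.1) : (chartAt (EuclideanHalfSpace n) x).source × EuclideanSpace ℝ (Fin n))) (by fun_prop)
  have hne : ∀ v : Metric.sphere (0 : EuclideanSpace ℝ (Fin n)) 1, frameVec x x v.1 ≠ 0 := by
    intro v
    refine frameVec_ne hx ?_
    intro h0
    have := v.2
    rw [h0] at this
    simp at this
  have hF := F.smooth.continuousOn.comp_continuous hb (fun p => hne p)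
  have h1 : Continuous fun v : EuclideanSpace ℝ (Fin n) => η (frameVec x x v) :=
    η.continuous.comp ((trivializationAt (EuclideanSpace ℝ (Fin n)) (TangentSpace (𝓡∂ n)) x).symmL ℝ x).continuous
  exact (h1.comp continuous_subtype_val).div hF fun p => (F.pos _ _ (hne p)).ne'

theorem dual_add_le (F : FinslerMetric n M) (x : M) (η ζ : TangentSpace (𝓡∂ n) x →L[ℝ] ℝ) :
    F.dual x (η + ζ) ≤ F.dual x η + F.dual x ζ := by
  have hx : x ∈ (chartAt (EuclideanHalfSpace n) x).source := mem_chart_source _ x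
  have : Nonempty {y : TangentSpace (𝓡∂ n) x // y ≠ 0} :=
    ⟨⟨frameVec x x (EuclideanSpace.single 0 1), frameVec_ne hx (by simp)⟩⟩
  refine ciSup_le fun y => ?_
  rw [add_apply, add_div]
  exact add_le_add (le_ciSup (bddAbove_dual F x η) y) (le_ciSup (bddAbove_dual F x ζ) y)

theorem dual_neg (F : FinslerMetric n M) (x : M) (η : TangentSpace (𝓡∂ n) x →L[ℝ] ℝ) :
    F.dual x (-η) = F.dual x η := by
  let e : {y : TangentSpace (𝓡∂ n) x // y ≠ 0} ≃ {y : TangentSpace (𝓡∂ n) x // y ≠ 0} :=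
    ⟨fun y => ⟨-y.1, neg_ne_zero.2 y.2⟩, fun y => ⟨-y.1, neg_ne_zero.2 y.2⟩,
      fun y => by simp, fun y => by simp⟩
  refine Equiv.iSup_congr e fun y => ?_
  have h := F.homogeneous x (-1) y.1
  simp only [neg_smul, one_smul, abs_neg, abs_one, one_mul] at h
  simp [e, h]

theorem dual_smul (F : FinslerMetric n M) (x : M) (c : ℝ) (η : TangentSpace (𝓡∂ n) x →L[ℝ] ℝ) :
    F.dual x (c • η) = |c| * F.dual x η := by
  have key : ∀ d : ℝ, 0 ≤ d → F.dual x (d • η) = d * F.dual x η := by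
    intro d hd
    rw [FinslerMetric.dual, FinslerMetric.dual, Real.mul_iSup_of_nonneg hd]
    simp [mul_div_assoc]
  rcases le_total 0 c with hc | hc
  · rw [key c hc, abs_of_nonneg hc]
  · have h1 := dual_neg F x (c • η)
    have h2 : (-c) • η = -(c • η) := neg_smul c η
    rw [abs_of_nonpos hc, ← key _ (neg_nonneg.2 hc), h2, h1]

theorem dual_nonneg (F : FinslerMetric n M) (x : M) (η : TangentSpace (𝓡∂ n) x →L[ℝ] ℝ) :
    0 ≤ F.dual x η := by
  have h := dual_add_le F x η (-η)
  have h0 := dual_smul F x 0 η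
  rw [dual_neg F x η, add_neg_cancel] at h
  simp at h0
  linarith

end Aux

section Aux2

variable {n : ℕ} [NeZero n] {M : Type*} [TopologicalSpace M]
    [ChartedSpace (EuclideanHalfSpace n) M]

theorem differential_add {u v : M → ℝ} (hu : ContMDiff (𝓡∂ n) 𝓘(ℝ, ℝ) ∞ u)
    (hv : ContMDiff (𝓡∂ n) 𝓘(ℝ, ℝ) ∞ v) (x : M) :
    differential n (u + v) x = differential n u x + differential n v x :=
  mfderiv_add (hu.mdifferentiableAt (by simp)) (hv.mdifferentiableAt (by simp))

theorem differential_smul {u : M → ℝ} (hu : ContMDiff (𝓡∂ n) 𝓘(ℝ, ℝ) ∞ u) (c : ℝ) (x : M) :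
    differential n (c • u) x = c • differential n u x :=
  const_smul_mfderiv (hu.mdifferentiableAt (by simp)) c

/-- A smooth measure on a compact manifold is finite. -/
theorem IsSmoothMeasure.isFiniteMeasure [CompactSpace M] [MeasurableSpace M] [BorelSpace M]
    {m : Measure M} (hm : IsSmoothMeasure n m) : IsFiniteMeasure m := by
  have hloc : IsLocallyFiniteMeasure m := by
    refine ⟨fun x₀ => ?_⟩
    obtain ⟨σ, hσ, -, hd⟩ := hm x₀
    set φ := extChartAt (𝓡∂ n) x₀ with hφ
    have hz : φ x₀ ∈ φ.target := mem_extChartAt_target x₀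
    have hc : ContinuousWithinAt σ φ.target (φ x₀) := hσ.continuousOn _ hz
    have hev : ∀ᶠ z in 𝓝[φ.target] (φ x₀), σ z < σ (φ x₀) + 1 :=
      hc.eventually (gt_mem_nhds (by linarith))
    rw [eventually_nhdsWithin_iff, Metric.eventually_nhds_iff_ball] at hev
    obtain ⟨r, hr, hball⟩ := hev
    have hcont : ContinuousOn φ φ.source := continuousOn_extChartAt x₀
    have hso : IsOpen φ.source := isOpen_extChartAt_source x₀
    have hxs : x₀ ∈ φ.source := mem_extChartAt_source x₀
    refine ⟨φ.source ∩ φ ⁻¹' Metric.ball (φ x₀) r,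
      (hcont.isOpen_inter_preimage hso Metric.isOpen_ball).mem_nhds
        ⟨hxs, Metric.mem_ball_self hr⟩, ?_⟩
    have hae : AEMeasurable φ (m.restrict φ.source) := hcont.aemeasurable hso.measurableSet
    have e1 : m (φ.source ∩ φ ⁻¹' Metric.ball (φ x₀) r) ≤
        (m.restrict φ.source).map φ (Metric.ball (φ x₀) r) := by
      rw [Measure.map_apply_of_aemeasurable hae Metric.isOpen_ball.measurableSet, inter_comm]
      exact Measure.le_restrict_apply _ _
    have hd' : (m.restrict φ.source).map φ =
      (volume.restrict φ.target).withDensity fun z => ENNReal.ofReal (σ z) := hd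
    refine e1.trans_lt ?_
    have hT : MeasurableSet φ.target := by
      rw [hφ, extChartAt_target]
      exact ((chartAt _ x₀).open_target.preimage (𝓡∂ n).continuous_symm).measurableSet.inter
        (𝓡∂ n).isClosed_range.measurableSet
    rw [hd', withDensity_apply _ Metric.isOpen_ball.measurableSet,
      Measure.restrict_restrict Metric.isOpen_ball.measurableSet]
    calc ∫⁻ z in Metric.ball (φ x₀) r ∩ φ.target, ENNReal.ofReal (σ z)
        ≤ ∫⁻ z in Metric.ball (φ x₀) r ∩ φ.target, ENNReal.ofReal (σ (φ x₀) + 1) :=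
          setLIntegral_mono' (Metric.isOpen_ball.measurableSet.inter hT)
            fun z hz => ENNReal.ofReal_le_ofReal (hball z hz.1 hz.2).le
      _ = ENNReal.ofReal (σ (φ x₀) + 1) * volume (Metric.ball (φ x₀) r ∩ φ.target) := by simp
      _ < ⊤ := ENNReal.mul_lt_top ENNReal.ofReal_lt_top
          ((measure_mono inter_subset_left).trans_lt measure_ball_lt_top)
  exact ⟨isCompact_univ.measure_lt_top⟩

end Aux2

theorem sqrt_integral_sq {α : Type*} [MeasurableSpace α] {μ : Measure α} {f : α → ℝ}
    (hf : MemLp f 2 μ) : √(∫ x, f x ^ 2 ∂μ) = (eLpNorm f 2 μ).toReal := by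
  rw [hf.eLpNorm_eq_integral_rpow_norm (by simp) (by simp),
    ENNReal.toReal_ofReal (by positivity), Real.sqrt_eq_rpow]
  simp

theorem sqrt_integral_sq_add_le {α : Type*} [MeasurableSpace α] {μ : Measure α} {f g : α → ℝ}
    (hf : MemLp f 2 μ) (hg : MemLp g 2 μ) :
    √(∫ x, (f x + g x) ^ 2 ∂μ) ≤ √(∫ x, f x ^ 2 ∂μ) + √(∫ x, g x ^ 2 ∂μ) := by
  have h := sqrt_integral_sq (hf.add hg)
  simp only [Pi.add_apply] at h
  rw [h, sqrt_integral_sq hf, sqrt_integral_sq hg,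
    ← ENNReal.toReal_add hf.eLpNorm_ne_top hg.eLpNorm_ne_top]
  exact ENNReal.toReal_mono (ENNReal.add_ne_top.2 ⟨hf.eLpNorm_ne_top, hg.eLpNorm_ne_top⟩)
    (eLpNorm_add_le hf.1 hg.1 (by simp))

instance : IsFiniteMeasure 𝓜.m := 𝓜.smooth_measure.isFiniteMeasure

theorem CompactFMMM.memLp_of_continuous {f : 𝓜.M → ℝ} (hf : Continuous f) : MemLp f 2 𝓜.m := by
  obtain ⟨C, hC⟩ := isCompact_univ.exists_bound_of_continuousOn hf.continuousOn
  exact MemLp.of_bound (hf.measurable.aestronglyMeasurable) C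
    (Filter.Eventually.of_forall fun x => hC x (mem_univ x))

variable {𝓜} in
theorem CompactFMMM.TestFunction.contMDiff (u : 𝓜.TestFunction) :
    ContMDiff (𝓡∂ 𝓜.n) 𝓘(ℝ, ℝ) ∞ (u : 𝓜.M → ℝ) :=
  (show u.1 ∈ 𝓜.testSubmodule from u.2).1

theorem CompactFMMM.memLp_gradAbs (u : 𝓜.TestFunction) : MemLp (𝓜.gradAbs u) 2 𝓜.m :=
  𝓜.memLp_of_continuous (continuous_dual 𝓜.F u.contMDiff)

theorem CompactFMMM.testL2_add (u v : 𝓜.TestFunction) :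
    𝓜.testL2 (u + v) ≤ 𝓜.testL2 u + 𝓜.testL2 v :=
  sqrt_integral_sq_add_le (𝓜.memLp_of_continuous u.contMDiff.continuous)
    (𝓜.memLp_of_continuous v.contMDiff.continuous)

theorem CompactFMMM.testL2_smul (c : ℝ) (u : 𝓜.TestFunction) :
    𝓜.testL2 (c • u) = |c| * 𝓜.testL2 u := by
  have h : ∀ x, (c • u) x = c * u x := fun x => rfl
  simp only [testL2, h, mul_pow, integral_const_mul, Real.sqrt_mul (sq_nonneg c),
    Real.sqrt_sq_eq_abs]

theorem CompactFMMM.gradAbs_add (u v : 𝓜.TestFunction) (x : 𝓜.M) :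
    𝓜.gradAbs (u + v : 𝓜.TestFunction) x ≤ 𝓜.gradAbs u x + 𝓜.gradAbs v x := by
  have h := differential_add u.contMDiff v.contMDiff x
  have h2 := dual_add_le 𝓜.F x (differential 𝓜.n u x) (differential 𝓜.n v x)
  rw [← h] at h2
  exact h2

theorem CompactFMMM.gradAbs_smul (c : ℝ) (u : 𝓜.TestFunction) (x : 𝓜.M) :
    𝓜.gradAbs (c • u : 𝓜.TestFunction) x = |c| * 𝓜.gradAbs u x := by
  have h := differential_smul u.contMDiff c x
  have h2 := dual_smul 𝓜.F x c (differential 𝓜.n u x)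
  rw [← h] at h2
  exact h2

theorem CompactFMMM.testGrad_add (u v : 𝓜.TestFunction) :
    𝓜.testGrad (u + v) ≤ 𝓜.testGrad u + 𝓜.testGrad v := by
  refine le_trans (Real.sqrt_le_sqrt (integral_mono (𝓜.memLp_gradAbs (u + v)).integrable_sq
    ((𝓜.memLp_gradAbs u).add (𝓜.memLp_gradAbs v)).integrable_sq fun x => ?_))
    (sqrt_integral_sq_add_le (𝓜.memLp_gradAbs u) (𝓜.memLp_gradAbs v))
  exact pow_le_pow_left₀ (dual_nonneg _ _ _) (𝓜.gradAbs_add u v x) 2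

theorem CompactFMMM.testGrad_smul (c : ℝ) (u : 𝓜.TestFunction) :
    𝓜.testGrad (c • u) = |c| * 𝓜.testGrad u := by
  simp only [testGrad, gradAbs_smul, mul_pow, integral_const_mul, Real.sqrt_mul (sq_nonneg |c|),
    Real.sqrt_sq (abs_nonneg c)]

/-! ### The Sobolev space, the energy and the sphere -/

/-- `C₀^∞(M)` with the norm `‖u‖ = ‖u‖_{L²} + ‖F*(du)‖_{L²}`. -/
instance : SeminormedAddCommGroup 𝓜.TestFunction :=
  AddGroupSeminorm.toSeminormedAddCommGroup
    { toFun := fun u => 𝓜.testL2 u + 𝓜.testGrad u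
      map_zero' := by
        have h1 := 𝓜.testL2_smul 0 0
        have h2 := 𝓜.testGrad_smul 0 0
        simp only [zero_smul, abs_zero, zero_mul] at h1 h2
        rw [h1, h2, add_zero]
      add_le' := fun u v => by
        linarith [𝓜.testL2_add u v, 𝓜.testGrad_add u v]
      neg' := fun u => by
        have h1 := 𝓜.testL2_smul (-1) u
        have h2 := 𝓜.testGrad_smul (-1) u
        simp only [neg_smul, one_smul, abs_neg, abs_one, one_mul] at h1 h2
        rw [h1, h2] }

theorem CompactFMMM.norm_testFunction (u : 𝓜.TestFunction) :
    ‖u‖ = 𝓜.testL2 u + 𝓜.testGrad u := rfl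

instance : NormedSpace ℝ 𝓜.TestFunction where
  norm_smul_le c u := by
    rw [𝓜.norm_testFunction, 𝓜.norm_testFunction, 𝓜.testL2_smul, 𝓜.testGrad_smul, ← mul_add,
      Real.norm_eq_abs]

/-- The Sobolev space `𝒳`, the completion of `C₀^∞(M)`. -/
abbrev CompactFMMM.Sobolev : Type u := UniformSpace.Completion 𝓜.TestFunction

/-- The extension by continuity of `‖u‖_{L²}` to `𝒳`. -/
def CompactFMMM.normL2 : 𝓜.Sobolev → ℝ := UniformSpace.Completion.extension 𝓜.testL2

/-- The extension by continuity of `‖F*(du)‖_{L²}` to `𝒳`. -/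
def CompactFMMM.normGrad : 𝓜.Sobolev → ℝ := UniformSpace.Completion.extension 𝓜.testGrad

theorem uniformContinuous_of_seminorm {V : Type*} [SeminormedAddCommGroup V] {p : V → ℝ}
    (hadd : ∀ u v, p (u + v) ≤ p u + p v) (hle : ∀ u, p u ≤ ‖u‖) : UniformContinuous p := by
  refine (LipschitzWith.of_le_add fun u v => ?_ : LipschitzWith 1 p).uniformContinuous
  have h := hadd v (u - v)
  rw [add_sub_cancel] at h
  rw [dist_eq_norm]
  linarith [hle (u - v)]

theorem CompactFMMM.uniformContinuous_testL2 : UniformContinuous 𝓜.testL2 :=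
  uniformContinuous_of_seminorm 𝓜.testL2_add fun _ =>
    le_add_of_nonneg_right (Real.sqrt_nonneg _)

theorem CompactFMMM.uniformContinuous_testGrad : UniformContinuous 𝓜.testGrad :=
  uniformContinuous_of_seminorm 𝓜.testGrad_add fun _ =>
    le_add_of_nonneg_left (Real.sqrt_nonneg _)

theorem CompactFMMM.normL2_coe (u : 𝓜.TestFunction) : 𝓜.normL2 (u : 𝓜.Sobolev) = 𝓜.testL2 u :=
  UniformSpace.Completion.extension_coe 𝓜.uniformContinuous_testL2 u

theorem CompactFMMM.normGrad_coe (u : 𝓜.TestFunction) :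
    𝓜.normGrad (u : 𝓜.Sobolev) = 𝓜.testGrad u :=
  UniformSpace.Completion.extension_coe 𝓜.uniformContinuous_testGrad u

theorem CompactFMMM.normL2_neg (u : 𝓜.Sobolev) : 𝓜.normL2 (-u) = 𝓜.normL2 u := by
  have hc : Continuous 𝓜.normL2 := UniformSpace.Completion.continuous_extension
  induction u using UniformSpace.Completion.induction_on with
  | hp => exact isClosed_eq (hc.comp continuous_neg) hc
  | ih u =>
    have h := 𝓜.testL2_smul (-1) u
    simp only [neg_smul, one_smul, abs_neg, abs_one, one_mul] at h
    rw [← UniformSpace.Completion.coe_neg, 𝓜.normL2_coe, 𝓜.normL2_coe, h]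

/-- The canonical energy functional (Rayleigh quotient)
`E(u) = ‖F*(du)‖²_{L²} / ‖u‖²_{L²}`. -/
def CompactFMMM.energy (u : 𝓜.Sobolev) : ℝ := 𝓜.normGrad u ^ 2 / 𝓜.normL2 u ^ 2

/-- The set `𝒮` of all `u ∈ 𝒳` with `‖u‖_{L²} = 1`. -/
def CompactFMMM.sphere : Set 𝓜.Sobolev := {u | 𝓜.normL2 u = 1}

/-- The space `𝒮`, with the topology of `𝒳`. -/
abbrev CompactFMMM.Sphere : Type u := 𝓜.sphere

instance : InvolutiveNeg 𝓜.Sphere where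
  neg u := ⟨-u.1, (𝓜.normL2_neg u.1).trans u.2⟩
  neg_neg u := Subtype.ext (neg_neg u.1)

/-- The equivalence relation `u ∼ v ↔ u = v ∨ u = -v`. -/
def antipodal (Y : Type*) [InvolutiveNeg Y] : Setoid Y where
  r u v := u = v ∨ u = -v
  iseqv :=
    { refl := fun u => Or.inl rfl
      symm := by
        rintro u v (rfl | rfl)
        · exact Or.inl rfl
        · exact Or.inr (neg_neg v).symm
      trans := by
        rintro u v w (rfl | rfl) (rfl | rfl)
        · exact Or.inl rfl
        · exact Or.inr rfl
        · exact Or.inr rfl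
        · exact Or.inl (neg_neg w) }

/-- The projective space `ℙ(𝒳) = 𝒮 / ℤ₂`, with the quotient topology. -/
abbrev CompactFMMM.Projective : Type u := Quotient (antipodal 𝓜.Sphere)

/-- The projection `𝒮 → ℙ(𝒳)`. -/
def CompactFMMM.proj (u : 𝓜.Sphere) : 𝓜.Projective := Quotient.mk (antipodal 𝓜.Sphere) u

/-! ### Dimension pairs and their spectra -/

/-- The intersection of a linear subspace of `𝒳` with `𝒮`. -/
def CompactFMMM.subspaceSphere (V : Submodule ℝ 𝓜.Sobolev) : Set 𝓜.Sphere :=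
  {u | (u : 𝓜.Sobolev) ∈ V}

/-- An antipode preserving homeomorphism of `𝒮`. -/
def IsAPH {𝓜 : CompactFMMM.{u}} (h : 𝓜.Sphere ≃ₜ 𝓜.Sphere) : Prop := ∀ u, h (-u) = -h u

/-- An optional family of subsets of `𝒮`. -/
structure IsOptionalFamily (C : Set (Set 𝓜.Sphere)) : Prop where
  empty_mem : ∅ ∈ C
  subspace_mem : ∀ k : ℕ, 1 ≤ k → ∀ V : Submodule ℝ 𝓜.Sobolev, Module.finrank ℝ V = k →
    𝓜.subspaceSphere V ∈ C
  image_mem : ∀ h : 𝓜.Sphere ≃ₜ 𝓜.Sphere, IsAPH h → ∀ A ∈ C, h '' A ∈ C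

/-- A dimension-like function on the family `C`; only its values on members of `C` matter. -/
structure IsDimensionLike (C : Set (Set 𝓜.Sphere)) (dim : Set 𝓜.Sphere → ℕ∞) : Prop where
  eq_zero_iff : ∀ A ∈ C, dim A = 0 ↔ A = ∅
  mono : ∀ A₁ ∈ C, ∀ A₂ ∈ C, A₁ ⊆ A₂ → dim A₁ ≤ dim A₂
  le_subspace : ∀ k : ℕ, 1 ≤ k → ∀ V : Submodule ℝ 𝓜.Sobolev, Module.finrank ℝ V = k →
    (k : ℕ∞) ≤ dim (𝓜.subspaceSphere V)
  image_eq : ∀ h : 𝓜.Sphere ≃ₜ 𝓜.Sphere, IsAPH h → ∀ A ∈ C, dim (h '' A) = dim A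

/-- A dimension pair. -/
structure IsDimensionPair (C : Set (Set 𝓜.Sphere)) (dim : Set 𝓜.Sphere → ℕ∞) : Prop where
  optional : IsOptionalFamily 𝓜 C
  dimensionLike : IsDimensionLike 𝓜 C dim

/-- `Dim E⁻¹[0, c]`, the supremum of `Dim A` over the `A ∈ C` with `A ⊆ E⁻¹[0, c]`. -/
def sublevelDim (C : Set (Set 𝓜.Sphere)) (dim : Set 𝓜.Sphere → ℕ∞) (c : ℝ≥0∞) : ℕ∞ :=
  ⨆ (A : Set 𝓜.Sphere) (_ : A ∈ C ∧ ∀ u ∈ A, ENNReal.ofReal (𝓜.energy u) ≤ c), dim A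

/-- The `k`-th eigenvalue (`k ≥ 1`) of the pair `(C, dim)`, the supremum of the
`c ∈ [0, ∞]` with `Dim E⁻¹[0, c] < k`. -/
def eigenvalue (C : Set (Set 𝓜.Sphere)) (dim : Set 𝓜.Sphere → ℕ∞) (k : ℕ) : ℝ≥0∞ :=
  sSup {c | sublevelDim 𝓜 C dim c < k}

/-! ### The Lusternik-Schnirelmann and the Krasnoselskii dimension pairs -/

/-- `A` is contractible in `Y`: the inclusion of `A` is homotopic to a constant map. -/
def IsContractibleIn {Y : Type*} [TopologicalSpace Y] (A : Set Y) : Prop :=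
  ContinuousMap.Nullhomotopic (⟨Subtype.val, continuous_subtype_val⟩ : C(A, Y))

/-- The Lusternik-Schnirelmann category of `A` relative to `Y`: the least `k` such that `A` is
covered by `k` closed subsets of `Y` that are contractible in `Y`. -/
def lsCategory {Y : Type*} [TopologicalSpace Y] (A : Set Y) : ℕ∞ :=
  ⨅ (k : ℕ) (_ : ∃ B : Fin k → Set Y,
    (∀ j, IsClosed (B j) ∧ IsContractibleIn (B j)) ∧ A ⊆ ⋃ j, B j), (k : ℕ∞)

/-- The Krasnoselskii genus of a symmetric set `A`: the least `m` such that there is an odd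
continuous map from `A` to `ℝᵐ ∖ {0}`. -/
def krasnoselskiiGenus {Y : Type*} [TopologicalSpace Y] [Neg Y] (A : Set Y) : ℕ∞ :=
  ⨅ (m : ℕ) (_ : ∃ h : Y → EuclideanSpace ℝ (Fin m),
    ContinuousOn h A ∧ ∀ u ∈ A, h u ≠ 0 ∧ h (-u) = -h u), (m : ℕ∞)

/-- The Lusternik-Schnirelmann dimension. -/
def dimLS (A : Set 𝓜.Sphere) : ℕ∞ := lsCategory (𝓜.proj '' A)

/-- The Krasnoselskii dimension. -/
def dimK (A : Set 𝓜.Sphere) : ℕ∞ := krasnoselskiiGenus A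

/-- The index `α ∈ {1, 2}` of the families of closed and of compact sets. -/
inductive FamilyIndex
  | one
  | two

/-- The families `𝒞¹` (closed subsets of `𝒮`) and `𝒞²` (compact subsets of `𝒮`). -/
def familyC : FamilyIndex → Set (Set 𝓜.Sphere)
  | .one => {A | IsClosed A}
  | .two => {A | IsCompact A}

/-- The families `𝒟¹`, `𝒟²` of the symmetric members of `𝒞¹`, `𝒞²`. -/
def familyD (α : FamilyIndex) : Set (Set 𝓜.Sphere) :=
  {A | A ∈ familyC 𝓜 α ∧ ∀ u, u ∈ A ↔ -u ∈ A}

/-! ### Riemannian manifolds and faithful pairs -/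

/-- The type of smooth Riemannian metrics on the underlying manifold. -/
abbrev CompactFMMM.RiemannianMetric : Type u :=
  Bundle.ContMDiffRiemannianMetric (𝓡∂ 𝓜.n) ∞ (EuclideanSpace ℝ (Fin 𝓜.n))
    (TangentSpace (𝓡∂ 𝓜.n) : 𝓜.M → Type _)

/-- The coordinate vector field `∂/∂xⁱ` of the chart around `x₀`, at the point with
coordinates `z`. -/
def CompactFMMM.coordVec (x₀ : 𝓜.M) (z : EuclideanSpace ℝ (Fin 𝓜.n)) (i : Fin 𝓜.n) :
    TangentSpace (𝓡∂ 𝓜.n) ((extChartAt (𝓡∂ 𝓜.n) x₀).symm z) :=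
  mfderivWithin 𝓘(ℝ, EuclideanSpace ℝ (Fin 𝓜.n)) (𝓡∂ 𝓜.n) (extChartAt (𝓡∂ 𝓜.n) x₀).symm
    (range (𝓡∂ 𝓜.n)) z (EuclideanSpace.single i (1 : ℝ) : EuclideanSpace ℝ (Fin 𝓜.n))

/-- The density `√(det g_ij)` of the Riemannian measure in the chart around `x₀`. -/
def CompactFMMM.riemannianDensity (g : 𝓜.RiemannianMetric) (x₀ : 𝓜.M)
    (z : EuclideanSpace ℝ (Fin 𝓜.n)) : ℝ :=
  √(Matrix.det (Matrix.of fun i j =>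
    g.inner ((extChartAt (𝓡∂ 𝓜.n) x₀).symm z) (𝓜.coordVec x₀ z i) (𝓜.coordVec x₀ z j)))

/-- The triple `(M, F, m)` is the Riemannian manifold `(M, √g, dvol_g)`. -/
structure IsRiemannian (g : 𝓜.RiemannianMetric) : Prop where
  metric_eq : ∀ (x : 𝓜.M) (y : TangentSpace (𝓡∂ 𝓜.n) x), 𝓜.F.toFun x y = √(g.inner x y y)
  measure_eq : ∀ x₀ : 𝓜.M, HasChartDensity 𝓜.m x₀ (𝓜.riemannianDensity g x₀)

/-- `∫ u v dm`, by polarization of `‖·‖²_{L²}`. -/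
def CompactFMMM.formL2 (u v : 𝓜.Sobolev) : ℝ :=
  (𝓜.normL2 (u + v) ^ 2 - 𝓜.normL2 (u - v) ^ 2) / 4

/-- By polarization of `‖F*(du)‖²_{L²}`; for a Riemannian metric `F = √g` this is
`∫ ⟨∇u, dv⟩ dm = ∫ g(∇u, ∇v) dm`. -/
def CompactFMMM.formGrad (u v : 𝓜.Sobolev) : ℝ :=
  (𝓜.normGrad (u + v) ^ 2 - 𝓜.normGrad (u - v) ^ 2) / 4

/-- On a Riemannian manifold: `u` is an eigenfunction of the Beltrami-Laplacian (with Dirichlet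
condition if `∂M ≠ ∅`), that is, `u ≠ 0` and `-Δu = c u` in the weak sense. -/
def IsLaplaceEigenfunction (c : ℝ) (u : 𝓜.Sobolev) : Prop :=
  u ≠ 0 ∧ ∀ v : 𝓜.Sobolev, 𝓜.formGrad u v = c * 𝓜.formL2 u v

/-- On a Riemannian manifold: the `k`-th eigenvalue (`k ≥ 1`) of the Beltrami-Laplacian, counted
with multiplicity, that is, the least `c` such that there are `k` linearly independent
eigenfunctions with eigenvalues `≤ c`. -/
def laplaceEigenvalue (k : ℕ) : ℝ≥0∞ :=
  sInf {c | ∃ (u : Fin k → 𝓜.Sobolev) (μ : Fin k → ℝ), LinearIndependent ℝ u ∧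
    ∀ i, IsLaplaceEigenfunction 𝓜 (μ i) (u i) ∧ ENNReal.ofReal (μ i) ≤ c}

/-- A rule that assigns to every compact FMMM a family of subsets of `𝒮` and a function on it is a
faithful dimension pair if it always gives a dimension pair and if on every compact Riemannian
manifold with its canonical measure the eigenvalues of the pair are those of the
Beltrami-Laplacian. -/
structure IsFaithful (C : ∀ 𝓜 : CompactFMMM.{u}, Set (Set 𝓜.Sphere))
    (dim : ∀ 𝓜 : CompactFMMM.{u}, Set 𝓜.Sphere → ℕ∞) : Prop where
  dimensionPair : ∀ 𝓜 : CompactFMMM.{u}, IsDimensionPair 𝓜 (C 𝓜) (dim 𝓜)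
  eigenvalue_eq : ∀ (𝓜 : CompactFMMM.{u}) (g : 𝓜.RiemannianMetric), IsRiemannian 𝓜 g →
    ∀ k : ℕ, 1 ≤ k → eigenvalue 𝓜 (C 𝓜) (dim 𝓜) k = laplaceEigenvalue 𝓜 k

end FinslerSpectrum

end

/-!
The sphere `𝒮` carries the free involution `u ↦ -u` with quotient `ℙ(𝒳)`. If `𝒮` is contractible,
then for a closed symmetric set `A` a covering of its image in `ℙ(𝒳)` by `k` closed contractible
sets exists if and only if there is an odd continuous map `A → ℝᵏ ∖ {0}`
(`lsCategory_image_eq_krasnoselskiiGenus`). In one direction, the double covering is trivial over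
a set that is contractible in `ℙ(𝒳)`, which gives an odd function without zeros on its preimage,
and these functions extend by Tietze's theorem to the components of an odd map. In the other
direction, the image of the set where a given component has the largest absolute value lifts to
`𝒮` and can be contracted there. So the two dimensions agree on symmetric sets. Since a set and
its symmetrization have the same image in `ℙ(𝒳)` and the energy is even, the two spectra agree as
well (`sublevelDim_dimLS_eq`).

The contractibility of `𝒮` is proved with the multiplication by a smooth function `φ ≥ 0` that has a
single zero, of high order (`exists_multiplier`). On `𝒳` this operator is injective without negative
eigenvalues, hence `u` can be moved to `φ u` along a segment that avoids the origin, and it is not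
surjective, so that `φ u` can be moved along a segment to a fixed element outside of its range. That
the argument works in `𝒳`, where the sphere is defined by the weaker `L²` norm, rests on the
closability of the gradient: `𝒳` embeds into `L²` (`eq_zero_of_normL2_eq_zero`).

The genus of the sphere of a `k`-dimensional subspace is at least `k` by the Borsuk–Ulam theorem
(`borsuk_ulam`), which is proved algebraically. By approximation it suffices to find a common real
zero on the sphere of `n` odd polynomials in `n + 1` variables, and a perturbation by powers of odd
degree `d` puts them, together with the equation of the sphere, into a triangular form in which the
even part of the quotient algebra has the odd dimension `dⁿ`. A commutative real algebra of odd
dimension has a real point (`exists_algHom_real_of_odd_finrank`), and a real point of the even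
polynomials is the evaluation at a pair of antipodal points.

On a Riemannian manifold the form `∫ F*(du)² dm` is quadratic (`normGrad_parallelogram`), and the
genus is compared with the multiplicities as in the min-max principle (`eigenvalue_dimK_eq`). The
span of `k` independent eigenfunctions with eigenvalues `≤ c` has a sphere of genus `≥ k` on which
the energy is `≤ c` (`rayleigh_le_of_eigenvectors`). Conversely, if `e₁, …, e_m` span the
eigenfunctions with eigenvalues `≤ c`, then the energy is `> c` on their orthogonal complement,
since it attains its minimum there at an eigenfunction (`lt_rayleigh_of_orthogonal`). Hence
`u ↦ (∫ u e_i dm)_i` is odd and has no zeros on a set of energy `≤ c`, whose genus is therefore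
`≤ m`. The minimum is attained because the `L²` norm is controlled, up to a small multiple of the
norm of `𝒳`, by finitely many continuous functionals (`exists_functionals`).
-/


noncomputable section

namespace FinslerSpectrum

/-! ### Commuting operators on real spaces of odd dimension -/

theorem exists_isRoot_of_monic_of_odd_natDegree {p : Polynomial ℝ} (hp : p.Monic)
    (h : Odd p.natDegree) : ∃ x, p.IsRoot x := by
  have hpos : 0 < p.natDegree := h.pos
  have h1 : Filter.Tendsto (fun x => p.eval x) Filter.atTop Filter.atTop :=
    p.tendsto_atTop_of_leadingCoeff_nonneg (Polynomial.natDegree_pos_iff_degree_pos.1 hpos)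
      (by rw [hp.leadingCoeff]; exact zero_le_one)
  set q : Polynomial ℝ := -(p.comp (-Polynomial.X)) with hq
  have hqd : q.natDegree = p.natDegree := by
    rw [hq, Polynomial.natDegree_neg, Polynomial.natDegree_comp]; simp
  have h2 : Filter.Tendsto (fun x => q.eval x) Filter.atTop Filter.atTop := by
    refine q.tendsto_atTop_of_leadingCoeff_nonneg
      (Polynomial.natDegree_pos_iff_degree_pos.1 (hqd ▸ hpos)) ?_
    rw [hq, Polynomial.leadingCoeff_neg, Polynomial.leadingCoeff_comp (by simp)]
    simp [hp.leadingCoeff, h.neg_one_pow]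
  obtain ⟨a, ha⟩ := (h1.eventually_ge_atTop 0).exists
  obtain ⟨b, hb⟩ := (h2.eventually_ge_atTop 0).exists
  have hb' : p.eval (-b) ≤ 0 := by
    simpa [hq, Polynomial.eval_comp] using hb
  obtain ⟨x, hx⟩ := mem_range_of_exists_le_of_exists_ge p.continuous ⟨_, hb'⟩ ⟨_, ha⟩
  exact ⟨x, hx⟩

/-- A commuting family of operators on a real vector space of odd dimension has a common
eigenvector: if some operator is not a scalar and `c` is a real eigenvalue of it, then the kernel
and the range of `T i - c` are proper invariant subspaces, and one of them has odd dimension. -/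
theorem exists_common_eigenvector_of_odd_finrank {ι : Type*} (n : ℕ) :
    ∀ {V : Type u} [AddCommGroup V] [Module ℝ V] [FiniteDimensional ℝ V] (T : ι → Module.End ℝ V),
      (∀ i j, Commute (T i) (T j)) → Module.finrank ℝ V = n → Odd n →
      ∃ v : V, v ≠ 0 ∧ ∀ i, ∃ c : ℝ, T i v = c • v := by
  induction n using Nat.strong_induction_on with
  | _ n ih =>
  intro V _ _ _ T hT hn hodd
  have key : ∀ W : Submodule ℝ V, (∀ i, ∀ w ∈ W, T i w ∈ W) → Module.finrank ℝ W < n →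
      Odd (Module.finrank ℝ W) → ∃ v : V, v ≠ 0 ∧ ∀ i, ∃ c : ℝ, T i v = c • v := by
    intro W hW hlt ho
    obtain ⟨v, hv, h⟩ := ih _ hlt (fun i => (T i).restrict (hW i)) (fun i j => by
      ext w
      have := congrArg (fun S : Module.End ℝ V => S w) (hT i j).eq
      simpa using this) rfl ho
    refine ⟨v, by simpa using hv, fun i => ?_⟩
    obtain ⟨c, hc⟩ := h i
    exact ⟨c, by simpa using congrArg Subtype.val hc⟩
  by_cases hs : ∀ i, ∃ c : ℝ, ∀ v, T i v = c • v
  · have : Nontrivial V := Module.nontrivial_of_finrank_pos (R := ℝ) (hn ▸ hodd.pos)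
    obtain ⟨v, hv⟩ := exists_ne (0 : V)
    exact ⟨v, hv, fun i => (hs i).imp fun c hc => hc v⟩
  push Not at hs
  obtain ⟨i, hi⟩ := hs
  obtain ⟨c, hc⟩ := exists_isRoot_of_monic_of_odd_natDegree (T i).charpoly_monic
    (by rw [(T i).charpoly_natDegree, hn]; exact hodd)
  have hev : (T i).HasEigenvalue c := (Module.End.hasEigenvalue_iff_isRoot_charpoly _ _).2 hc
  set S : Module.End ℝ V := T i - c • 1 with hS
  have hcomm : ∀ j, Commute (T j) S := fun j =>
    (hT j i).sub_right ((Commute.one_right _).smul_right c)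
  have hker0 : 0 < Module.finrank ℝ (LinearMap.ker S) := by
    obtain ⟨v, hv⟩ := hev.exists_hasEigenvector
    have hvm : v ∈ LinearMap.ker S := by
      simp [hS, hv.apply_eq_smul]
    have : Nontrivial (LinearMap.ker S) :=
      ⟨⟨⟨v, hvm⟩, 0, fun h => hv.2 (by simpa using congrArg Subtype.val h)⟩⟩
    exact Module.finrank_pos
  have hran0 : 0 < Module.finrank ℝ (LinearMap.range S) := by
    obtain ⟨v, hv⟩ := hi c
    have : Nontrivial (LinearMap.range S) :=
      ⟨⟨⟨S v, v, rfl⟩, 0, fun h => hv (by simpa [hS, sub_eq_zero] using congrArg Subtype.val h)⟩⟩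
    exact Module.finrank_pos
  have hsum := LinearMap.finrank_range_add_finrank_ker S
  rcases Nat.even_or_odd (Module.finrank ℝ (LinearMap.ker S)) with he | ho
  · refine key (LinearMap.range S) ?_ (by omega) ?_
    · rintro j _ ⟨w, rfl⟩
      exact ⟨T j w, (congrArg (fun R : Module.End ℝ V => R w) (hcomm j).eq).symm⟩
    · have : Odd (Module.finrank ℝ (LinearMap.range S) + Module.finrank ℝ (LinearMap.ker S)) := by
        rw [hsum, hn]; exact hodd
      rwa [Nat.odd_add, iff_true_right he] at this
  · refine key (LinearMap.ker S) ?_ (by omega) ho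
    intro j w hw
    have := congrArg (fun R : Module.End ℝ V => R w) (hcomm j).eq
    simp only [Module.End.mul_apply] at this
    rw [LinearMap.mem_ker, ← this, LinearMap.mem_ker.1 hw, map_zero]

/-- A commutative real algebra of odd finite dimension has a real point. -/
theorem exists_algHom_real_of_odd_finrank {B : Type u} [CommRing B] [Algebra ℝ B]
    [FiniteDimensional ℝ B] (h : Odd (Module.finrank ℝ B)) : Nonempty (B →ₐ[ℝ] ℝ) := by
  obtain ⟨v, hv, hc⟩ := exists_common_eigenvector_of_odd_finrank _
    (fun b : B => LinearMap.mulLeft ℝ b) (fun a b => by ext x; simp [mul_left_comm]) rfl h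
  choose c hc using hc
  simp only [LinearMap.mulLeft_apply] at hc
  have huniq : ∀ {a b : ℝ}, a • v = b • v → a = b := fun h => smul_left_injective ℝ hv h
  refine ⟨AlgHom.mk ⟨⟨⟨c, ?_⟩, ?_⟩, ?_, ?_⟩ ?_⟩
  · apply huniq; rw [← hc, one_mul, one_smul]
  · intro a b; apply huniq; change c (a * b) • v = (c a * c b) • v
    rw [← hc, mul_assoc, hc b, mul_smul_comm, hc, smul_smul, mul_comm]
  · apply huniq; change c 0 • v = (0 : ℝ) • v; rw [← hc, zero_mul, zero_smul]
  · intro a b; apply huniq; change c (a + b) • v = (c a + c b) • v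
    rw [← hc, add_mul, hc, hc, add_smul]
  · intro r; apply huniq; change c (algebraMap ℝ B r) • v = r • v
    rw [← hc, Algebra.smul_def]

/-! ### Triangular systems of polynomials -/

section Triangular

open MvPolynomial

variable {σ : Type u}

/-- The polynomials all of whose monomials have weighted degree `< N`. -/
def weightLT (w : σ → ℕ) (N : ℕ) : Submodule ℝ (MvPolynomial σ ℝ) where
  carrier := {f | ∀ c, coeff c f ≠ 0 → Finsupp.weight w c < N}
  zero_mem' := fun c hc => absurd (coeff_zero c) hc
  add_mem' := fun {f g} hf hg c hc => by
    by_cases h : coeff c f = 0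
    · exact hg c fun h' => hc (by rw [coeff_add, h, h', add_zero])
    · exact hf c h
  smul_mem' := fun r f hf c hc => hf c fun h => hc (by rw [coeff_smul, h, smul_zero])

theorem weightLT_mono (w : σ → ℕ) {M N : ℕ} (h : M ≤ N) : weightLT w M ≤ weightLT w N :=
  fun _ hf c hc => (hf c hc).trans_le h

theorem monomial_mem_weightLT (w : σ → ℕ) {N : ℕ} (c : σ →₀ ℕ) (r : ℝ)
    (h : Finsupp.weight w c < N) : monomial c r ∈ weightLT w N := by
  classical
  intro d hd
  rw [coeff_monomial] at hd
  split_ifs at hd with h'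
  · exact h' ▸ h
  · exact absurd rfl hd

theorem mul_mem_weightLT {w : σ → ℕ} {a b : ℕ} {f g : MvPolynomial σ ℝ}
    (hf : f ∈ weightLT w (a + 1)) (hg : g ∈ weightLT w b) : f * g ∈ weightLT w (a + b) := by
  classical
  intro c hc
  rw [coeff_mul] at hc
  obtain ⟨x, hx, hne⟩ := Finset.exists_ne_zero_of_sum_ne_zero hc
  rw [← Finset.HasAntidiagonal.mem_antidiagonal.1 hx, map_add]
  have h1 := hf x.1 (left_ne_zero_of_mul hne)
  have h2 := hg x.2 (right_ne_zero_of_mul hne)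
  omega

/-- `f` is the monomial with exponent `c` plus terms of smaller weighted degree. -/
def HasLead (w : σ → ℕ) (f : MvPolynomial σ ℝ) (c : σ →₀ ℕ) : Prop :=
  f - monomial c 1 ∈ weightLT w (Finsupp.weight w c)

theorem hasLead_monomial (w : σ → ℕ) (c : σ →₀ ℕ) : HasLead w (monomial c (1 : ℝ)) c := by
  rw [HasLead, sub_self]; exact zero_mem _

theorem HasLead.mul {w : σ → ℕ} {f g : MvPolynomial σ ℝ} {c d : σ →₀ ℕ} (hf : HasLead w f c)
    (hg : HasLead w g d) : HasLead w (f * g) (c + d) := by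
  have h1 : f * g - monomial (c + d) 1 = monomial c 1 * (g - monomial d 1)
      + (monomial d 1 * (f - monomial c 1) + (f - monomial c 1) * (g - monomial d 1)) := by
    have : (monomial (c + d) 1 : MvPolynomial σ ℝ) = monomial c 1 * monomial d 1 := by
      rw [monomial_mul, one_mul]
    rw [this]; ring
  rw [HasLead, h1, map_add]
  refine add_mem (mul_mem_weightLT (monomial_mem_weightLT w _ _ (Nat.lt_succ_self _)) hg)
    (add_mem ?_ ?_)
  · rw [add_comm (Finsupp.weight w c)]
    exact mul_mem_weightLT (monomial_mem_weightLT w _ _ (Nat.lt_succ_self _)) hf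
  · exact mul_mem_weightLT (weightLT_mono w (Nat.le_succ _) hf) hg

theorem HasLead.pow {w : σ → ℕ} {f : MvPolynomial σ ℝ} {c : σ →₀ ℕ} (hf : HasLead w f c)
    (k : ℕ) : HasLead w (f ^ k) (k • c) := by
  induction k with
  | zero => rw [pow_zero, zero_smul]; exact hasLead_monomial w 0
  | succ k ih => rw [pow_succ, succ_nsmul]; exact ih.mul hf

theorem HasLead.prod {w : σ → ℕ} {ι : Type*} (s : Finset ι) {f : ι → MvPolynomial σ ℝ}
    {c : ι → σ →₀ ℕ} (hf : ∀ i, HasLead w (f i) (c i)) :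
    HasLead w (∏ i ∈ s, f i) (∑ i ∈ s, c i) := by
  classical
  induction s using Finset.induction_on with
  | empty => exact hasLead_monomial w 0
  | insert i s hi ih => rw [Finset.prod_insert hi, Finset.sum_insert hi]; exact (hf i).mul ih

theorem exists_mem_weightLT (w : σ → ℕ) (f : MvPolynomial σ ℝ) : ∃ N, f ∈ weightLT w N := by
  refine ⟨f.support.sup (Finsupp.weight w) + 1, fun c hc => ?_⟩
  exact Nat.lt_succ_of_le (Finset.le_sup (f := Finsupp.weight w) (mem_support_iff.2 hc))

theorem eq_zero_of_mem_weightLT_zero {f : MvPolynomial σ ℝ} (hf : f ∈ weightLT w 0) : f = 0 := by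
  ext c
  by_contra hc
  exact absurd (hf c hc) (Nat.not_lt_zero _)

/-- The parity of the total degree of a monomial. -/
def parity (c : σ →₀ ℕ) : ZMod 2 := Finsupp.weight (fun _ => (1 : ZMod 2)) c

/-- The polynomials all of whose monomials have total degree of parity `k`. -/
def parityPart (σ : Type u) (k : ZMod 2) : Submodule ℝ (MvPolynomial σ ℝ) :=
  weightedHomogeneousSubmodule ℝ (fun _ => (1 : ZMod 2)) k

theorem mem_parityPart {k : ZMod 2} {f : MvPolynomial σ ℝ} :
    f ∈ parityPart σ k ↔ ∀ c, coeff c f ≠ 0 → parity c = k :=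
  ⟨fun h _ hc => h hc, fun h _ hc => h _ hc⟩

theorem mul_mem_parityPart {k l : ZMod 2} {f g : MvPolynomial σ ℝ} (hf : f ∈ parityPart σ k)
    (hg : g ∈ parityPart σ l) : f * g ∈ parityPart σ (k + l) :=
  IsWeightedHomogeneous.mul hf hg

theorem prod_mem_parityPart {ι : Type*} (s : Finset ι) {k : ι → ZMod 2}
    {f : ι → MvPolynomial σ ℝ} (hf : ∀ i, f i ∈ parityPart σ (k i)) :
    ∏ i ∈ s, f i ∈ parityPart σ (∑ i ∈ s, k i) :=
  IsWeightedHomogeneous.prod s f k fun i _ => hf i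

theorem monomial_mem_parityPart (c : σ →₀ ℕ) (r : ℝ) : monomial c r ∈ parityPart σ (parity c) :=
  isWeightedHomogeneous_monomial _ _ _ rfl

theorem X_mem_parityPart (i : σ) : (X i : MvPolynomial σ ℝ) ∈ parityPart σ 1 :=
  isWeightedHomogeneous_X ℝ _ i

theorem pow_mem_parityPart {k : ZMod 2} {f : MvPolynomial σ ℝ} (hf : f ∈ parityPart σ k) (m : ℕ) :
    f ^ m ∈ parityPart σ (m • k) :=
  IsWeightedHomogeneous.pow hf m

/-- A system of polynomials `P i = X i ^ D i + (terms of smaller weighted degree)`, where all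
monomials of `P i` have the parity of `D i`. -/
structure IsTriangular (w D : σ → ℕ) (P : σ → MvPolynomial σ ℝ) : Prop where
  pos : ∀ i, 0 < D i
  lead : ∀ i, HasLead w (P i) (Finsupp.single i (D i))
  parity : ∀ i, P i ∈ parityPart σ (D i : ZMod 2)

variable [Fintype σ] {w D : σ → ℕ} {P : σ → MvPolynomial σ ℝ}

/-- The product `X ^ a * P ^ b` with `c = a + D b` and `a < D`. -/
def triangularProd (D : σ → ℕ) (P : σ → MvPolynomial σ ℝ) (c : σ →₀ ℕ) : MvPolynomial σ ℝ :=
  (∏ i, X i ^ (c i % D i)) * ∏ i, P i ^ (c i / D i)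

theorem parity_eq_sum (c : σ →₀ ℕ) : parity c = ∑ i, (c i : ZMod 2) := by
  rw [parity, Finsupp.weight_apply, Finsupp.sum_fintype _ _ (by simp)]
  simp

theorem IsTriangular.hasLead_prod (h : IsTriangular w D P) (c : σ →₀ ℕ) :
    HasLead w (triangularProd D P c) c := by
  have h1 : c = (∑ i, (c i % D i) • Finsupp.single i 1)
      + ∑ i, (c i / D i) • Finsupp.single i (D i) := by
    classical
    ext j
    rw [Finsupp.add_apply, Finsupp.finsetSum_apply, Finsupp.finsetSum_apply]
    simp [Finsupp.single_apply]
    rw [mul_comm]; exact (Nat.mod_add_div _ _).symm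
  nth_rw 2 [h1]
  exact (HasLead.prod _ fun i => (hasLead_monomial w _).pow _).mul
    (HasLead.prod _ fun i => (h.lead i).pow _)

theorem IsTriangular.prod_mem_parityPart (h : IsTriangular w D P) (c : σ →₀ ℕ) :
    triangularProd D P c ∈ parityPart σ (FinslerSpectrum.parity c) := by
  have h1 : FinslerSpectrum.parity c =
      (∑ i, (c i % D i) • (1 : ZMod 2)) + ∑ i, (c i / D i) • (D i : ZMod 2) := by
    rw [parity_eq_sum, ← Finset.sum_add_distrib]
    refine Finset.sum_congr rfl fun i _ => ?_
    nth_rw 1 [← Nat.mod_add_div (c i) (D i)]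
    push_cast
    simp [mul_comm]
  rw [h1]
  exact mul_mem_parityPart
    (FinslerSpectrum.prod_mem_parityPart _ fun i => pow_mem_parityPart (X_mem_parityPart i) _)
    (FinslerSpectrum.prod_mem_parityPart _ fun i => pow_mem_parityPart (h.parity i) _)

/-- The linear map that sends the monomial `X ^ c` to `triangularProd D P c`. -/
def triangularMap (D : σ → ℕ) (P : σ → MvPolynomial σ ℝ) :
    MvPolynomial σ ℝ →ₗ[ℝ] MvPolynomial σ ℝ :=
  (basisMonomials σ ℝ).constr ℝ (triangularProd D P)

theorem triangularMap_monomial (D : σ → ℕ) (P : σ → MvPolynomial σ ℝ) (c : σ →₀ ℕ) (r : ℝ) :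
    triangularMap D P (monomial c r) = r • triangularProd D P c := by
  have : (monomial c r : MvPolynomial σ ℝ) = r • basisMonomials σ ℝ c := by
    simp [smul_monomial]
  rw [this, map_smul, triangularMap, Module.Basis.constr_basis]

/-- `triangularMap` is the identity up to terms of smaller weighted degree. -/
theorem IsTriangular.map_sub_mem (h : IsTriangular w D P) {N : ℕ} {f : MvPolynomial σ ℝ}
    (hf : f ∈ weightLT w (N + 1)) : triangularMap D P f - f ∈ weightLT w N := by
  have h1 : triangularMap D P f - f = ∑ c ∈ f.support,
      coeff c f • (triangularProd D P c - monomial c 1) := by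
    nth_rw 1 2 [f.as_sum]
    rw [map_sum, ← Finset.sum_sub_distrib]
    refine Finset.sum_congr rfl fun c _ => ?_
    rw [triangularMap_monomial, smul_sub, smul_monomial, smul_eq_mul, mul_one]
  rw [h1]
  refine sum_mem fun c hc => Submodule.smul_mem _ _ ?_
  exact weightLT_mono w (Nat.lt_succ_iff.1 (hf c (mem_support_iff.1 hc))) (h.hasLead_prod c)

theorem IsTriangular.map_mem_parityPart (h : IsTriangular w D P) {k : ZMod 2}
    {f : MvPolynomial σ ℝ} (hf : f ∈ parityPart σ k) : triangularMap D P f ∈ parityPart σ k := by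
  rw [f.as_sum, map_sum]
  refine sum_mem fun c hc => ?_
  rw [triangularMap_monomial, ← mem_parityPart.1 hf c (mem_support_iff.1 hc)]
  exact Submodule.smul_mem _ _ (h.prod_mem_parityPart c)

theorem IsTriangular.map_injective (h : IsTriangular w D P) :
    Function.Injective (triangularMap D P) := by
  rw [← LinearMap.ker_eq_bot, eq_bot_iff]
  intro f hf
  have key : ∀ N, f ∈ weightLT w N → f = 0 := by
    intro N
    induction N with
    | zero => exact eq_zero_of_mem_weightLT_zero
    | succ N ih =>
      intro hN
      have := h.map_sub_mem hN
      rw [LinearMap.mem_ker.1 hf, zero_sub] at this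
      exact ih (by simpa using neg_mem this)
  obtain ⟨N, hN⟩ := exists_mem_weightLT w f
  exact key N hN

theorem IsTriangular.exists_map_eq (h : IsTriangular w D P) {k : ZMod 2} {f : MvPolynomial σ ℝ}
    (hf : f ∈ parityPart σ k) : ∃ g ∈ parityPart σ k, triangularMap D P g = f := by
  have key : ∀ N (f : MvPolynomial σ ℝ), f ∈ weightLT w N → f ∈ parityPart σ k →
      ∃ g ∈ parityPart σ k, triangularMap D P g = f := by
    intro N
    induction N with
    | zero =>
      intro f hf _
      exact ⟨0, zero_mem _, by rw [map_zero, eq_zero_of_mem_weightLT_zero hf]⟩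
    | succ N ih =>
      intro f hf hk
      obtain ⟨g, hg, hgf⟩ := ih _ (h.map_sub_mem hf) (sub_mem (h.map_mem_parityPart hk) hk)
      exact ⟨f - g, sub_mem hk hg, by rw [map_sub, hgf, sub_sub_cancel]⟩
  obtain ⟨N, hN⟩ := exists_mem_weightLT w f
  exact key N f hN hf

theorem IsTriangular.map_surjective (h : IsTriangular w D P) :
    Function.Surjective (triangularMap D P) := by
  rw [← LinearMap.range_eq_top, eq_top_iff]
  intro f _
  rw [f.as_sum]
  refine sum_mem fun c _ => ?_
  obtain ⟨g, -, hg⟩ := h.exists_map_eq (monomial_mem_parityPart c (coeff c f))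
  exact ⟨g, hg⟩

theorem IsTriangular.map_bijective (h : IsTriangular w D P) :
    Function.Bijective (triangularMap D P) :=
  ⟨h.map_injective, h.map_surjective⟩

/-- The products `X ^ a * P ^ b` with `a < D` are a basis of the polynomial ring. -/
def IsTriangular.basis (h : IsTriangular w D P) :
    Module.Basis (σ →₀ ℕ) ℝ (MvPolynomial σ ℝ) :=
  (basisMonomials σ ℝ).map (LinearEquiv.ofBijective (triangularMap D P) h.map_bijective)

theorem IsTriangular.basis_apply (h : IsTriangular w D P) (c : σ →₀ ℕ) :
    h.basis c = triangularProd D P c := by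
  rw [basis, Module.Basis.map_apply, LinearEquiv.ofBijective_apply, coe_basisMonomials,
    triangularMap_monomial, one_smul]

theorem IsTriangular.parity_of_repr_ne_zero (h : IsTriangular w D P) {k : ZMod 2}
    {f : MvPolynomial σ ℝ} (hf : f ∈ parityPart σ k) {c : σ →₀ ℕ} (hc : h.basis.repr f c ≠ 0) :
    FinslerSpectrum.parity c = k := by
  obtain ⟨g, hg, rfl⟩ := h.exists_map_eq hf
  refine mem_parityPart.1 hg c fun h0 => hc ?_
  have : h.basis.repr (triangularMap D P g) = (basisMonomials σ ℝ).repr g := by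
    rw [basis, Module.Basis.map_repr, LinearEquiv.trans_apply]
    congr 1
    exact (LinearEquiv.symm_apply_eq _).2 rfl
  rw [this]
  exact h0

end Triangular

/-! ### Common real zeros of odd polynomials on the sphere -/

section RealZeros

open MvPolynomial

variable {σ : Type u}

/-- The algebra of even polynomials. -/
def evenSubalgebra (σ : Type u) : Subalgebra ℝ (MvPolynomial σ ℝ) where
  carrier := parityPart σ 0
  mul_mem' := fun {f g} hf hg => by simpa using mul_mem_parityPart hf hg
  add_mem' := fun {f g} hf hg => add_mem hf hg
  algebraMap_mem' := fun r => by
    simpa [parity] using monomial_mem_parityPart (0 : σ →₀ ℕ) r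

theorem mul_mem_even_of_odd {f g : MvPolynomial σ ℝ} (hf : f ∈ parityPart σ 1)
    (hg : g ∈ parityPart σ 1) : f * g ∈ evenSubalgebra σ := by
  have h := mul_mem_parityPart hf hg
  rwa [show (1 : ZMod 2) + 1 = 0 from rfl] at h

/-- The product of two odd polynomials, as an even polynomial. -/
def evenMul (f g : parityPart σ 1) : evenSubalgebra σ :=
  ⟨f * g, mul_mem_even_of_odd f.2 g.2⟩

/-- A variable as an odd polynomial. -/
def oddX (i : σ) : parityPart σ 1 := ⟨X i, X_mem_parityPart i⟩

/-- A monomial of odd degree as an odd polynomial. -/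
def oddMonomial (c : σ →₀ ℕ) (hc : parity c = 1) : parityPart σ 1 :=
  ⟨monomial c 1, by rw [← hc]; exact monomial_mem_parityPart c 1⟩

/-- A real point `χ` of the algebra of even polynomials is the evaluation at a point `y`, where
`y i = χ (X i * X k) / s` with `s ^ 2 = χ (X k ^ 2)`. -/
theorem eval_odd_eq [Fintype σ] (χ : evenSubalgebra σ →ₐ[ℝ] ℝ) (k : σ) {s : ℝ} (hs : s ≠ 0)
    (hk : χ (evenMul (oddX k) (oddX k)) = s ^ 2) (f : parityPart σ 1) :
    eval (fun i => χ (evenMul (oddX i) (oddX k)) / s) f.1 = χ (evenMul f (oddX k)) / s := by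
  have key : ∀ (c : σ →₀ ℕ) (hc : parity c = 1),
      eval (fun i => χ (evenMul (oddX i) (oddX k)) / s) (monomial c (1 : ℝ)) =
        χ (evenMul (oddMonomial c hc) (oddX k)) / s := by
    intro c hc
    obtain ⟨m, hm⟩ : Odd (∑ i, c i) := by
      rw [← ZMod.natCast_eq_one_iff_odd, ← hc, parity_eq_sum]
      push_cast; rfl
    have h1 : ∏ i, (evenMul (oddX i) (oddX k)) ^ c i =
        evenMul (oddMonomial c hc) (oddX k) *
          (evenMul (oddX k) (oddX k)) ^ m := by
      apply Subtype.ext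
      simp only [evenMul, oddX, oddMonomial, SubmonoidClass.coe_finsetProd, SubmonoidClass.coe_pow,
        Subalgebra.coe_mul, mul_pow, Finset.prod_mul_distrib, Finset.prod_pow_eq_pow_sum, hm]
      rw [monomial_eq, C_1, one_mul, Finsupp.prod_fintype _ _ (by simp)]
      ring
    rw [eval_monomial, one_mul, Finsupp.prod_fintype _ _ (by simp)]
    simp only [div_pow, Finset.prod_div_distrib, Finset.prod_pow_eq_pow_sum, hm]
    rw [← Finset.prod_congr rfl fun i _ => map_pow χ (evenMul (oddX i) (oddX k)) (c i), ← map_prod,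
      h1, map_mul, map_pow, hk]
    field_simp
    ring
  have h2 : evenMul f (oddX k) = ∑ c ∈ f.1.support.attach, coeff c.1 f.1 •
      evenMul (oddMonomial c.1 (mem_parityPart.1 f.2 c.1 (mem_support_iff.1 c.2))) (oddX k) := by
    apply Subtype.ext
    rw [AddSubmonoidClass.coe_finsetSum]
    simp only [evenMul, oddX, oddMonomial, Subalgebra.coe_smul, ← smul_mul_assoc, ← Finset.sum_mul,
      smul_monomial, smul_eq_mul, mul_one]
    congr 1
    nth_rw 1 [f.1.as_sum]
    exact (Finset.sum_attach f.1.support fun c => monomial c (coeff c f.1)).symm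
  rw [h2, map_sum, Finset.sum_div]
  nth_rw 1 [f.1.as_sum]
  rw [map_sum, ← Finset.sum_attach]
  refine Finset.sum_congr rfl fun c _ => ?_
  rw [map_smul, smul_eq_mul, mul_div_assoc,
    ← key _ (mem_parityPart.1 f.2 c.1 (mem_support_iff.1 c.2)), ← mul_one (coeff c.1 f.1),
      ← smul_eq_mul,
    ← smul_monomial, smul_eval, smul_eq_mul, mul_one]

variable [Fintype σ] {w D : σ → ℕ} {P : σ → MvPolynomial σ ℝ}

theorem triangularProd_mul (h : IsTriangular w D P) (c : σ →₀ ℕ) (b : σ → ℕ) :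
    triangularProd D P c * ∏ i, P i ^ b i =
      triangularProd D P (c + Finsupp.equivFunOnFinite.symm fun i => D i * b i) := by
  simp only [triangularProd, Finsupp.add_apply, Finsupp.equivFunOnFinite_symm_apply_apply,
    Nat.add_mul_mod_self_left, mul_assoc, ← Finset.prod_mul_distrib, ← pow_add,
    Nat.add_mul_div_left _ _ (h.pos _)]

/-- The ideal generated by a triangular system: its members are the combinations of the products
`X ^ a * P ^ b` with `b ≠ 0`. -/
def IsTriangular.ideal (h : IsTriangular w D P) : Ideal (MvPolynomial σ ℝ) where
  carrier := {f | ∀ c : σ →₀ ℕ, (∀ i, c i < D i) → h.basis.repr f c = 0}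
  zero_mem' := fun c _ => by simp
  add_mem' := fun {f g} hf hg c hc => by simp [hf c hc, hg c hc]
  smul_mem' := fun g f hf d hd => by
    have h1 : g • f = ∑ c ∈ (h.basis.repr f).support,
        h.basis.repr f c • (g * triangularProd D P c) := by
      nth_rw 1 [← h.basis.linearCombination_repr f]
      rw [Finsupp.linearCombination_apply, Finsupp.sum, Finset.smul_sum]
      refine Finset.sum_congr rfl fun c _ => ?_
      rw [h.basis_apply, smul_eq_mul, mul_smul_comm]
    rw [h1, map_sum, Finsupp.finsetSum_apply]
    refine Finset.sum_eq_zero fun c hc => ?_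
    rw [map_smul, Finsupp.smul_apply, smul_eq_mul]
    by_cases hcD : ∀ i, c i < D i
    · rw [hf c hcD, zero_mul]
    push Not at hcD
    obtain ⟨i, hi⟩ := hcD
    convert! mul_zero _
    set q : MvPolynomial σ ℝ := g * ∏ i, X i ^ (c i % D i) with hq
    have h2 : g * triangularProd D P c = ∑ c' ∈ (h.basis.repr q).support, h.basis.repr q c' •
        h.basis (c' + Finsupp.equivFunOnFinite.symm fun i => D i * (c i / D i)) := by
      rw [triangularProd, ← mul_assoc, ← hq]
      nth_rw 1 [← h.basis.linearCombination_repr q]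
      rw [Finsupp.linearCombination_apply, Finsupp.sum, Finset.sum_mul]
      refine Finset.sum_congr rfl fun c' _ => ?_
      rw [h.basis_apply, h.basis_apply, smul_mul_assoc, triangularProd_mul h]
    rw [h2, map_sum, Finsupp.finsetSum_apply]
    refine Finset.sum_eq_zero fun c' _ => ?_
    rw [map_smul, Finsupp.smul_apply, Module.Basis.repr_self, Finsupp.single_apply, if_neg,
      smul_zero]
    intro he
    have h3 := hd i
    rw [← he, Finsupp.add_apply, Finsupp.equivFunOnFinite_symm_apply_apply] at h3
    have h4 : 0 < c i / D i := Nat.div_pos hi (h.pos i)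
    nlinarith [h.pos i]

theorem IsTriangular.mem_ideal (h : IsTriangular w D P) (i : σ) : P i ∈ h.ideal := by
  classical
  intro c hc
  have h1 : h.basis (Finsupp.single i (D i)) = P i := by
    rw [h.basis_apply, triangularProd, Finset.prod_eq_one, Finset.prod_eq_single i]
    · simp [Nat.div_self (h.pos i)]
    · intro j _ hj; simp [hj.symm]
    · simp
    · intro j _
      by_cases hj : i = j
      · subst hj; simp
      · simp [hj]
  rw [← h1, Module.Basis.repr_self, Finsupp.single_apply, if_neg]
  rintro rfl
  simpa using hc i

/-- The exponents of the monomials that are a basis of the even part of the quotient by a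
triangular system. -/
abbrev EvenExponent (D : σ → ℕ) : Type u := {c : σ →₀ ℕ // (∀ i, c i < D i) ∧ parity c = 0}

/-- A triangular system with an odd number of even basis monomials has a real point, in the sense
of the algebra of even polynomials. -/
theorem IsTriangular.exists_algHom (h : IsTriangular w D P) [Finite (EvenExponent D)]
    (hodd : Odd (Nat.card (EvenExponent D))) :
    ∃ χ : evenSubalgebra σ →ₐ[ℝ] ℝ, ∀ f : evenSubalgebra σ, f.1 ∈ h.ideal → χ f = 0 := by
  have := Fintype.ofFinite (EvenExponent D)
  set I : Ideal (evenSubalgebra σ) := Ideal.comap (evenSubalgebra σ).val h.ideal with hI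
  let L : evenSubalgebra σ →ₗ[ℝ] (EvenExponent D → ℝ) :=
    { toFun := fun f c => h.basis.repr f.1 c.1
      map_add' := fun f g => by ext c; simp
      map_smul' := fun r f => by ext c; simp }
  have hker : LinearMap.ker L = I.restrictScalars ℝ := by
    ext f
    rw [LinearMap.mem_ker, Submodule.restrictScalars_mem, hI, Ideal.mem_comap]
    constructor
    · intro hf c hc
      by_contra hne
      exact hne (congrFun hf ⟨c, hc, h.parity_of_repr_ne_zero f.2 hne⟩)
    · intro hf
      ext c
      exact hf c.1 c.2.1
  have hsurj : Function.Surjective L := by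
    intro v
    have hev : ∀ c : EvenExponent D, h.basis c.1 ∈ evenSubalgebra σ := fun c => by
      rw [h.basis_apply]
      have := h.prod_mem_parityPart c.1
      rw [c.2.2] at this
      exact this
    refine ⟨∑ c, v c • (⟨h.basis c.1, hev c⟩ : evenSubalgebra σ), ?_⟩
    classical
    ext d
    change h.basis.repr (Subtype.val (∑ c, v c • (⟨h.basis c.1, hev c⟩ :
      evenSubalgebra σ))) d.1 = v d
    rw [AddSubmonoidClass.coe_finsetSum, map_sum, Finsupp.finsetSum_apply, Finset.sum_eq_single d]
    · rw [Subalgebra.coe_smul, map_smul]; simp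
    · intro c _ hcd
      rw [Subalgebra.coe_smul, map_smul, Finsupp.smul_apply,
        Module.Basis.repr_self, Finsupp.single_apply, if_neg (fun h' => hcd (Subtype.ext h')),
        smul_zero]
    · simp
  let e : (evenSubalgebra σ ⧸ I) ≃ₗ[ℝ] (EvenExponent D → ℝ) :=
    (Submodule.Quotient.restrictScalarsEquiv ℝ I).symm.trans
      ((Submodule.quotEquivOfEq _ _ hker.symm).trans (L.quotKerEquivOfSurjective hsurj))
  have : FiniteDimensional ℝ (evenSubalgebra σ ⧸ I) := Module.Finite.equiv e.symm
  obtain ⟨χ⟩ := exists_algHom_real_of_odd_finrank (B := evenSubalgebra σ ⧸ I) (by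
    rw [e.finrank_eq, Module.finrank_fintype_fun_eq_card, ← Nat.card_eq_fintype_card]
    exact hodd)
  refine ⟨χ.comp (Ideal.Quotient.mkₐ ℝ I), fun f hf => ?_⟩
  rw [AlgHom.comp_apply, Ideal.Quotient.mkₐ_eq_mk,
    Ideal.Quotient.eq_zero_iff_mem.2 (show f ∈ I from hf),
    map_zero]

/-- If one exponent is `2` and the others are all equal to the odd number `d`, the even basis
monomials are determined by the other exponents, and there are `d ^ n` of them. -/
def evenExponentEquiv (n d : ℕ) :
    EvenExponent (Fin.cons 2 fun _ => d : Fin (n + 1) → ℕ) ≃ (Fin n → Fin d) where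
  toFun c i := ⟨c.1 i.succ, by simpa using c.2.1 i.succ⟩
  invFun a := ⟨Finsupp.equivFunOnFinite.symm (Fin.cons ((∑ i, (a i : ℕ)) % 2) fun i => a i), by
    refine ⟨fun i => ?_, ?_⟩
    · refine Fin.cases ?_ (fun i => ?_) i
      · simpa using Nat.mod_lt _ two_pos
      · simp
    · rw [parity_eq_sum, Fin.sum_univ_succ]
      simp only [Finsupp.equivFunOnFinite_symm_apply_apply, Fin.cons_zero, Fin.cons_succ,
        ZMod.natCast_mod]
      push_cast
      exact CharTwo.add_self_eq_zero _⟩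
  left_inv c := by
    apply Subtype.ext
    ext i
    refine Fin.cases ?_ (fun i => ?_) i
    · have h1 := c.2.2
      have h2 : c.1 0 < 2 := c.2.1 0
      rw [parity_eq_sum, Fin.sum_univ_succ, add_eq_zero_iff_eq_neg, CharTwo.neg_eq,
        ← Nat.cast_sum, ZMod.natCast_eq_natCast_iff'] at h1
      simp only [Finsupp.equivFunOnFinite_symm_apply_apply, Fin.cons_zero]
      omega
    · simp
  right_inv a := by ext i; simp

theorem card_evenExponent (n d : ℕ) :
    Nat.card (EvenExponent (Fin.cons 2 fun _ => d : Fin (n + 1) → ℕ)) = d ^ n := by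
  rw [Nat.card_congr (evenExponentEquiv n d)]; simp

/-- A triangular system of odd polynomials and the equation of the sphere have a common real
zero. -/
theorem IsTriangular.exists_zero {n d : ℕ} (hd : Odd d) {w : Fin (n + 1) → ℕ}
    {P : Fin (n + 1) → MvPolynomial (Fin (n + 1)) ℝ}
    (h : IsTriangular w (Fin.cons 2 fun _ => d) P) (h0 : P 0 = ∑ i, X i * X i - 1) :
    ∃ y : Fin (n + 1) → ℝ, ∑ i, y i ^ 2 = 1 ∧ ∀ i : Fin n, eval y (P i.succ) = 0 := by
  have : Finite (EvenExponent (Fin.cons 2 fun _ => d : Fin (n + 1) → ℕ)) :=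
    Finite.of_equiv _ (evenExponentEquiv n d).symm
  obtain ⟨χ, hχ⟩ := h.exists_algHom (by rw [card_evenExponent]; exact hd.pow)
  have hsum : ∑ i, χ (evenMul (oddX i) (oddX i)) = 1 := by
    have h1 := hχ (∑ i, evenMul (oddX i) (oddX i) - 1) (by
      convert! h.mem_ideal 0
      rw [h0]
      simp [evenMul, oddX])
    rw [map_sub, map_one, map_sum] at h1
    linarith
  obtain ⟨k, -, hk⟩ : ∃ k ∈ Finset.univ, 0 < χ (evenMul (oddX k) (oddX k)) :=
    Finset.exists_lt_of_sum_lt (f := fun _ => (0 : ℝ)) (by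
      rw [hsum, Finset.sum_const_zero]; exact one_pos)
  set s := √(χ (evenMul (oddX k) (oddX k))) with hs
  have hs0 : s ≠ 0 := (Real.sqrt_pos.2 hk).ne'
  have hs2 : χ (evenMul (oddX k) (oddX k)) = s ^ 2 := (Real.sq_sqrt hk.le).symm
  refine ⟨fun i => χ (evenMul (oddX i) (oddX k)) / s, ?_, fun i => ?_⟩
  · have h2 : ∀ i, χ (evenMul (oddX i) (oddX k)) ^ 2 = χ (evenMul (oddX i) (oddX i)) * s ^ 2 := by
      intro i
      rw [← hs2, ← map_pow, ← map_mul]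
      congr 1
      apply Subtype.ext
      simp only [evenMul, oddX, SubmonoidClass.coe_pow, Subalgebra.coe_mul]
      ring
    simp only [div_pow, h2, mul_div_cancel_right₀ _ (pow_ne_zero 2 hs0), hsum]
  · have hpar : P i.succ ∈ parityPart (Fin (n + 1)) 1 := by
      have := h.parity i.succ
      rwa [Fin.cons_succ, (ZMod.natCast_eq_one_iff_odd).2 hd] at this
    rw [eval_odd_eq χ k hs0 hs2 ⟨_, hpar⟩, hχ, zero_div]
    exact Ideal.mul_mem_right _ _ (h.mem_ideal i.succ)

end RealZeros

/-! ### The Borsuk-Ulam theorem -/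

section BorsukUlam

open MvPolynomial

theorem exists_odd_part {σ : Type u} [Fintype σ] (p : MvPolynomial σ ℝ) :
    ∃ q ∈ parityPart σ 1, ∀ y, eval y q = (eval y p - eval (-y) p) / 2 := by
  induction p using MvPolynomial.induction_on' with
  | monomial c r =>
    have hneg : ∀ y : σ → ℝ, eval (-y) (monomial c r) =
        (-1) ^ (∑ i, c i) * eval y (monomial c r) := by
      intro y
      simp only [eval_monomial, Finsupp.prod_fintype _ _ fun i => pow_zero _, Pi.neg_apply]
      simp_rw [neg_pow (y _), Finset.prod_mul_distrib, Finset.prod_pow_eq_pow_sum]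
      ring
    rcases Nat.even_or_odd (∑ i, c i) with h | h
    · refine ⟨0, zero_mem _, fun y => ?_⟩
      rw [hneg, h.neg_one_pow]; simp
    · refine ⟨monomial c r, ?_, fun y => ?_⟩
      · have h1 : parity c = 1 := by
          rw [parity_eq_sum, ← Nat.cast_sum, ZMod.natCast_eq_one_iff_odd]; exact h
        rw [← h1]; exact monomial_mem_parityPart c r
      · rw [hneg, h.neg_one_pow]; ring
  | add p q hp hq =>
    obtain ⟨p', hp', hp''⟩ := hp
    obtain ⟨q', hq', hq''⟩ := hq
    refine ⟨p' + q', add_mem hp' hq', fun y => ?_⟩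
    simp only [map_add, hp'', hq'']
    ring

theorem exists_polynomial_near {σ : Type u} {K : Set (σ → ℝ)} (hK : IsCompact K)
    {f : (σ → ℝ) → ℝ} (hf : ContinuousOn f K) {ε : ℝ} (hε : 0 < ε) :
    ∃ p : MvPolynomial σ ℝ, ∀ y ∈ K, |eval y p - f y| < ε := by
  have : CompactSpace K := isCompact_iff_compactSpace.1 hK
  let x : σ → C(K, ℝ) := fun i => ⟨fun y => y.1 i, (continuous_apply i).comp continuous_subtype_val⟩
  have hev : ∀ (p : MvPolynomial σ ℝ) (y : K), aeval x p y = eval y.1 p := by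
    intro p y
    induction p using MvPolynomial.induction_on with
    | C r => simp
    | add p q hp hq => simp [hp, hq]
    | mul_X p i hp => simp [hp, x]
  obtain ⟨⟨g, p, rfl⟩, hg⟩ :=
    ContinuousMap.exists_mem_subalgebra_near_continuousMap_of_separatesPoints
      (AlgHom.range (aeval x : MvPolynomial σ ℝ →ₐ[ℝ] C(K, ℝ))) (by
        intro y z hyz
        obtain ⟨i, hi⟩ := Function.ne_iff.1 fun h => hyz (Subtype.ext h)
        exact ⟨x i, ⟨x i, ⟨X i, by simp⟩, rfl⟩, hi⟩)
      ⟨_, continuousOn_iff_continuous_domRestrict.1 hf⟩ ε hε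
  refine ⟨p, fun y hy => ?_⟩
  have h1 := (ContinuousMap.norm_lt_iff _ hε).1 hg ⟨y, hy⟩
  simpa [← hev p ⟨y, hy⟩, Real.norm_eq_abs] using h1

/-- **Borsuk-Ulam theorem**: an odd continuous map from the unit sphere of `ℝⁿ⁺¹` to `ℝⁿ` has a
zero. By approximation the components of the map may be taken to be odd polynomials `p i`; adding
a small multiple of a large odd power of the `i`-th variable makes the system triangular. -/
theorem borsuk_ulam {n : ℕ} {f : (Fin (n + 1) → ℝ) → Fin n → ℝ}
    (hf : ContinuousOn f {y | ∑ i, y i ^ 2 = 1})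
    (hodd : ∀ y, ∑ i, y i ^ 2 = 1 → f (-y) = -f y) : ∃ y, ∑ i, y i ^ 2 = 1 ∧ f y = 0 := by
  by_contra! hne
  set S : Set (Fin (n + 1) → ℝ) := {y | ∑ i, y i ^ 2 = 1} with hS
  have hle : ∀ y ∈ S, ∀ i, |y i| ≤ 1 := by
    intro y hy i
    rw [← sq_le_one_iff_abs_le_one, ← show ∑ i, y i ^ 2 = 1 from hy]
    exact Finset.single_le_sum (f := fun i => y i ^ 2) (fun _ _ => sq_nonneg _) (Finset.mem_univ i)
  have hSc : IsCompact S := by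
    refine Metric.isCompact_of_isClosed_isBounded
      (isClosed_eq (by fun_prop) continuous_const) ?_
    refine isBounded_iff_forall_norm_le.2 ⟨1, fun y hy => ?_⟩
    exact (pi_norm_le_iff_of_nonneg zero_le_one).2 fun i => hle y hy i
  have hSne : S.Nonempty := ⟨Pi.single 0 1, by simp [hS, Pi.single_apply]⟩
  obtain ⟨y₀, hy₀, hmin⟩ := hSc.exists_isMinOn hSne hf.norm
  set δ := ‖f y₀‖ with hδ
  have hδ0 : 0 < δ := norm_pos_iff.2 (hne y₀ hy₀)
  have happ : ∀ i : Fin n, ∃ q ∈ parityPart (Fin (n + 1)) 1, ∀ y ∈ S,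
      |eval y q - f y i| < δ / 4 := by
    intro i
    obtain ⟨p, hp⟩ := exists_polynomial_near hSc
      (show ContinuousOn (fun y => f y i) S from (continuous_apply i).comp_continuousOn hf)
      (by positivity : 0 < δ / 4)
    obtain ⟨q, hq, hqp⟩ := exists_odd_part p
    refine ⟨q, hq, fun y hy => ?_⟩
    have h1 := hp y hy
    have h2 := hp (-y) (by simpa [hS] using hy)
    rw [hodd y hy, Pi.neg_apply] at h2
    rw [hqp]
    rw [abs_lt] at *
    constructor <;> linarith
  choose q hq hqf using happ
  choose N hN using fun i => exists_mem_weightLT (Fin.cons 2 fun _ => 1 : Fin (n + 1) → ℕ) (q i)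
  set d := 2 * (∑ i, N i) + 1 with hd
  have hdodd : Odd d := ⟨_, rfl⟩
  set w : Fin (n + 1) → ℕ := Fin.cons 2 fun _ => 1 with hw
  -- The weight `2` of the variable `X 0` makes `X 0 ^ 2` the leading term of the equation of the
  -- sphere.
  let P : Fin (n + 1) → MvPolynomial (Fin (n + 1)) ℝ :=
    Fin.cons (∑ i, X i * X i - 1) fun i => X i.succ ^ d + (δ / 4)⁻¹ • q i
  have htri : IsTriangular w (Fin.cons 2 fun _ => d) P := by
    refine ⟨fun i => ?_, fun i => ?_, fun i => ?_⟩
    · refine Fin.cases ?_ (fun i => ?_) i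
      · simp
      · simp [hd]
    · refine Fin.cases ?_ (fun i => ?_) i
      · have h1 : P 0 - monomial (Finsupp.single 0 2) 1 =
            ∑ i : Fin n, monomial (Finsupp.single i.succ 2) (1 : ℝ) - monomial 0 1 := by
          simp only [P, Fin.cons_zero, Fin.sum_univ_succ, ← pow_two, X_pow_eq_monomial]
          rw [show (1 : MvPolynomial (Fin (n + 1)) ℝ) = monomial 0 1 from rfl]
          ring
        simp only [HasLead, Fin.cons_zero]
        rw [h1]
        refine sub_mem (sum_mem fun i _ => monomial_mem_weightLT _ _ _ ?_)
          (monomial_mem_weightLT _ _ _ ?_)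
        · simp [Finsupp.weight_apply, hw]
        · simp [Finsupp.weight_apply, hw]
      · simp only [HasLead, Fin.cons_succ, P, X_pow_eq_monomial, add_sub_cancel_left]
        refine Submodule.smul_mem _ _ (weightLT_mono w ?_ (hN i))
        have h1 : Finsupp.weight w (Finsupp.single i.succ d) = d := by
          simp [Finsupp.weight_apply, hw]
        have h2 : N i ≤ ∑ i, N i :=
          Finset.single_le_sum (fun _ _ => Nat.zero_le _) (Finset.mem_univ i)
        rw [h1]; omega
    · refine Fin.cases ?_ (fun i => ?_) i
      · simp only [P, Fin.cons_zero]
        have h1 : ((2 : ℕ) : ZMod 2) = 0 := rfl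
        rw [h1]
        exact sub_mem (sum_mem fun i _ => mul_mem_even_of_odd (X_mem_parityPart i)
          (X_mem_parityPart i)) (one_mem (evenSubalgebra _))
      · simp only [P, Fin.cons_succ]
        rw [ZMod.natCast_eq_one_iff_odd.2 hdodd]
        refine add_mem ?_ (Submodule.smul_mem _ _ (hq i))
        have := pow_mem_parityPart (X_mem_parityPart (σ := Fin (n + 1)) i.succ) d
        rwa [nsmul_one, ZMod.natCast_eq_one_iff_odd.2 hdodd] at this
  obtain ⟨y, hy, hz⟩ := htri.exists_zero hdodd rfl
  have hlt : ‖f y‖ < δ := by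
    rw [pi_norm_lt_iff hδ0]
    intro i
    have h1 := hz i
    simp only [P, Fin.cons_succ, map_add, map_pow, eval_X, smul_eval] at h1
    have h2 : eval y (q i) = -(δ / 4 * y i.succ ^ d) := by
      field_simp at h1 ⊢
      linarith
    have h3 : |eval y (q i)| ≤ δ / 4 := by
      rw [h2, abs_neg, abs_mul, abs_pow, abs_of_pos (by positivity : 0 < δ / 4)]
      exact mul_le_of_le_one_right (by positivity) (pow_le_one₀ (abs_nonneg _) (hle y hy _))
    have h4 := hqf i y hy
    rw [Real.norm_eq_abs]
    rw [abs_lt] at *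
    rw [abs_le] at h3
    constructor <;> linarith
  exact absurd (hmin hy) (not_le.2 hlt)

end BorsukUlam

/-! ### Genus and category of free involutions -/

section Involution

variable {Y : Type u} [InvolutiveNeg Y]

/-- The action of `ℤˣ = {1, -1}` by an involution. -/
abbrev unitsAction (Y : Type u) [InvolutiveNeg Y] : MulAction ℤˣ Y where
  smul g y := if g = 1 then y else -y
  one_smul y := by change (if (1 : ℤˣ) = 1 then y else -y) = y; simp
  mul_smul g h y := by
    change (if g * h = 1 then y else -y) =
      if g = 1 then (if h = 1 then y else -y) else -(if h = 1 then y else -y)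
    rcases Int.units_eq_one_or g with rfl | rfl <;> rcases Int.units_eq_one_or h with rfl | rfl <;>
      simp

theorem quotient_mk_eq_iff {u v : Y} :
    (Quotient.mk (antipodal Y) u = Quotient.mk (antipodal Y) v) ↔ u = v ∨ u = -v :=
  Quotient.eq (r := antipodal Y)

theorem quotient_mk_neg (u : Y) : Quotient.mk (antipodal Y) (-u) = Quotient.mk (antipodal Y) u :=
  quotient_mk_eq_iff.2 (Or.inr rfl)

variable [MetricSpace Y]

theorem isQuotientMap_mk : IsQuotientMap (Quotient.mk (antipodal Y)) := isQuotientMap_quot_mk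

variable [ContinuousNeg Y]

/-- The quotient by a free involution is a covering. -/
theorem isCoveringMap_mk (hfree : ∀ u : Y, -u ≠ u) : IsCoveringMap (Quotient.mk (antipodal Y)) := by
  let := unitsAction Y
  have hs : ∀ (g : ℤˣ) (y : Y), g • y = if g = 1 then y else -y := fun _ _ => rfl
  have hq : IsQuotientCoveringMap (Quotient.mk (antipodal Y)) ℤˣ :=
    { isQuotientMap_mk with
      continuous_const_smul := fun g => by
        simp only [hs]
        split_ifs
        · exact continuous_id
        · exact continuous_neg
      apply_eq_iff_mem_orbit := by
        intro u v
        rw [quotient_mk_eq_iff, MulAction.mem_orbit_iff]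
        constructor
        · rintro (rfl | rfl)
          · exact ⟨1, one_smul _ _⟩
          · exact ⟨-1, by rw [hs, if_neg (by decide)]⟩
        · rintro ⟨g, rfl⟩
          rw [hs]
          split_ifs
          · exact Or.inl rfl
          · exact Or.inr rfl
      disjoint := by
        intro e
        obtain ⟨V, W, hV, hW, heV, heW, hVW⟩ := t2_separation (hfree e)
        refine ⟨W ∩ Neg.neg ⁻¹' V, (hW.inter (hV.preimage continuous_neg)).mem_nhds ⟨heW, heV⟩, ?_⟩
        rintro g ⟨_, ⟨u, hu, rfl⟩, hgu⟩
        by_contra hg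
        simp only [hs, if_neg hg] at hgu
        exact Set.disjoint_left.1 hVW hu.2 hgu.1 }
  exact hq.isCoveringMap

/-- The double covering is trivial over a set that is contractible in the base: a homotopy of
its inclusion to a constant lifts to a homotopy that commutes with the involution. -/
theorem exists_odd_of_isContractibleIn (hfree : ∀ u : Y, -u ≠ u)
    {B : Set (Quotient (antipodal Y))} (hB : IsClosed B) (hc : IsContractibleIn B) :
    ∃ g : Y → ℝ, Continuous g ∧ (∀ u, g (-u) = -g u) ∧
      ∀ u, Quotient.mk (antipodal Y) u ∈ B → g u ≠ 0 := by
  have hcov := isCoveringMap_mk hfree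
  have hmk : Continuous (Quotient.mk (antipodal Y)) := continuous_quotient_mk'
  set C : Set Y := Quotient.mk (antipodal Y) ⁻¹' B with hC
  have hCc : IsClosed C := hB.preimage hmk
  have hCneg : ∀ u : C, -u.1 ∈ C := fun u => by
    change Quotient.mk (antipodal Y) (-u.1) ∈ B
    rw [quotient_mk_neg]; exact u.2
  obtain ⟨q, ⟨H⟩⟩ := hc
  obtain ⟨v, rfl⟩ := Quotient.exists_rep q
  let pr : C(C, B) := ⟨fun u => ⟨_, u.2⟩, by fun_prop⟩
  let H' : C(unitInterval × C, Quotient (antipodal Y)) :=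
    ⟨fun x => H (x.1, pr x.2), by fun_prop⟩
  have H0 : ∀ u : C, H' (0, u) =
      Quotient.mk (antipodal Y) ((⟨_, continuous_subtype_val⟩ : C(C, Y)) u) :=
    fun u => H.apply_zero (pr u)
  set L := hcov.liftHomotopy H' ⟨_, continuous_subtype_val⟩ H0 with hL
  have hL0 : ∀ u : C, L (0, u) = u := hcov.liftHomotopy_zero H' ⟨_, continuous_subtype_val⟩ H0
  have hLp : ∀ x, Quotient.mk (antipodal Y) (L x) = H' x :=
    congrFun (hcov.liftHomotopy_lifts H' ⟨_, continuous_subtype_val⟩ H0)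
  let ν : C(C, C) := ⟨fun u => ⟨-u.1, hCneg u⟩, by fun_prop⟩
  have hprν : ∀ u, pr (ν u) = pr u := fun u => Subtype.ext (quotient_mk_neg u.1)
  have hodd : ∀ u : C, -L (1, ν u) = L (1, u) := by
    let L' : C(unitInterval × C, Y) := ⟨fun x => -L (x.1, ν x.2), by fun_prop⟩
    have h : L' = L := by
      rw [hL, hcov.eq_liftHomotopy_iff']
      refine ⟨funext fun x => ?_, fun u => ?_⟩
      · change Quotient.mk (antipodal Y) (-L (x.1, ν x.2)) = _
        rw [quotient_mk_neg, hLp]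
        change H (x.1, pr (ν x.2)) = H (x.1, pr x.2)
        rw [hprν]
      · change -L (0, ν u) = u.1
        rw [hL0]
        exact neg_neg u.1
    exact fun u => congrArg (fun G : C(unitInterval × C, Y) => G (1, u)) h
  have hend : ∀ u : C, L (1, u) = v ∨ L (1, u) = -v := fun u => by
    rw [← quotient_mk_eq_iff, hLp]
    exact H.apply_one (pr u)
  -- the lift ends in `{v, -v}`, and `φ` separates these two points oddly
  let φ : Y → ℝ := fun y => dist y (-v) - dist y v
  have hφ1 : φ v = dist v (-v) := by simp [φ]
  have hφ2 : φ (-v) = -dist v (-v) := by simp [φ, dist_comm]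
  have hv : dist v (-v) ≠ 0 := by rw [dist_ne_zero]; exact (hfree v).symm
  obtain ⟨g, hg⟩ := ContinuousMap.exists_restrict_eq hCc
    (⟨fun u => φ (L (1, u)), by fun_prop⟩ : C(C, ℝ))
  have hgC : ∀ u : C, g u.1 = φ (L (1, u)) := fun u =>
    congrArg (fun G : C(C, ℝ) => G u) hg
  refine ⟨fun u => (g u - g (-u)) / 2, by fun_prop, fun u => ?_, fun u hu => ?_⟩
  · simp only [neg_neg]; ring
  · have h1 := hgC ⟨u, hu⟩
    have h2 : g (-u) = φ (L (1, ν ⟨u, hu⟩)) := hgC (ν ⟨u, hu⟩)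
    have h3 : L (1, ν ⟨u, hu⟩) = -L (1, ⟨u, hu⟩) := by
      rw [← hodd ⟨u, hu⟩, neg_neg]
    simp only [h1, h2, h3]
    rcases hend ⟨u, hu⟩ with h | h
    · rw [h, hφ1, hφ2]; simpa using hv
    · rw [h, neg_neg, hφ1, hφ2]
      intro h0; apply hv; linarith

theorem isClosedMap_mk : IsClosedMap (Quotient.mk (antipodal Y)) := by
  intro K hK
  rw [← isQuotientMap_mk.isClosed_preimage]
  have : Quotient.mk (antipodal Y) ⁻¹' (Quotient.mk (antipodal Y) '' K) = K ∪ Neg.neg ⁻¹' K := by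
    ext u
    simp only [mem_preimage, mem_image, quotient_mk_eq_iff, mem_union]
    constructor
    · rintro ⟨x, hx, rfl | rfl⟩
      · exact Or.inl hx
      · exact Or.inr hx
    · rintro (h | h)
      · exact ⟨u, h, Or.inl rfl⟩
      · exact ⟨-u, h, Or.inr rfl⟩
  rw [this]
  exact hK.union (hK.preimage continuous_neg)

/-- If `h` is a continuous odd function without zeros on a closed symmetric set `K`, the image
of `K` in the quotient lifts to the part of `K` where `h` is positive. -/
theorem isContractibleIn_image [ContractibleSpace Y] {K : Set Y} (hK : IsClosed K)
    (hsymm : ∀ u ∈ K, -u ∈ K) {h : Y → ℝ} (hc : ContinuousOn h K)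
    (hodd : ∀ u ∈ K, h u ≠ 0 ∧ h (-u) = -h u) :
    IsContractibleIn (Quotient.mk (antipodal Y) '' K) := by
  set K' : Set Y := {u ∈ K | 0 ≤ h u} with hK'
  have hK'c : IsClosed K' := hK.isClosed_le continuousOn_const hc
  have hex : ∀ q : Quotient.mk (antipodal Y) '' K, ∃ u ∈ K', Quotient.mk (antipodal Y) u = q.1 := by
    rintro ⟨_, u, hu, rfl⟩
    rcases le_total 0 (h u) with h0 | h0
    · exact ⟨u, ⟨hu, h0⟩, rfl⟩
    · exact ⟨-u, ⟨hsymm u hu, by rw [(hodd u hu).2]; linarith⟩, quotient_mk_neg u⟩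
  choose s hs hsq using hex
  have huniq : ∀ u ∈ K', ∀ v ∈ K', Quotient.mk (antipodal Y) u = Quotient.mk (antipodal Y) v →
      u = v := by
    intro u hu v hv huv
    rcases quotient_mk_eq_iff.1 huv with h1 | rfl
    · exact h1
    · have h1 := hu.2
      rw [(hodd v hv.1).2] at h1
      exact absurd (le_antisymm (by linarith) hv.2) (hodd v hv.1).1
  have hscont : Continuous s := by
    rw [continuous_iff_isClosed]
    intro C hC
    have : s ⁻¹' C = Subtype.val ⁻¹' (Quotient.mk (antipodal Y) '' (C ∩ K')) := by
      ext q
      constructor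
      · intro hq
        exact ⟨s q, ⟨hq, hs q⟩, hsq q⟩
      · rintro ⟨u, ⟨huC, huK⟩, hu⟩
        have h2 : s q = u := huniq _ (hs q) _ huK (by rw [hsq, hu])
        change s q ∈ C
        rw [h2]; exact huC
    rw [this]
    exact (isClosedMap_mk _ (hC.inter hK'c)).preimage continuous_subtype_val
  let p : C(Y, Quotient (antipodal Y)) := ⟨Quotient.mk (antipodal Y), continuous_quotient_mk'⟩
  have h1 := ((id_nullhomotopic Y).comp_left ⟨s, hscont⟩).comp_right p
  have h2 : p.comp ((ContinuousMap.id Y).comp ⟨s, hscont⟩) =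
      (⟨Subtype.val, continuous_subtype_val⟩ :
        C(Quotient.mk (antipodal Y) '' K, Quotient (antipodal Y))) := by
    ext q; exact hsq q
  rw [IsContractibleIn, ← h2]
  exact h1

/-- In a contractible space with a free involution the genus of a closed symmetric set is the
category of its image in the quotient. -/
theorem lsCategory_image_eq_krasnoselskiiGenus [ContractibleSpace Y] (hfree : ∀ u : Y, -u ≠ u)
    {A : Set Y} (hA : IsClosed A) (hsymm : ∀ u ∈ A, -u ∈ A) :
    lsCategory (Quotient.mk (antipodal Y) '' A) = krasnoselskiiGenus A := by
  apply le_antisymm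
  · refine le_iInf₂ fun m hm => ?_
    obtain ⟨h, hc, hodd⟩ := hm
    refine iInf₂_le m ?_
    have hci : ∀ i, ContinuousOn (fun u => h u i) A := fun i =>
      (EuclideanSpace.proj i : EuclideanSpace ℝ (Fin m) →L[ℝ] ℝ).continuous.comp_continuousOn hc
    -- on `K i` the `i`-th component is the largest, so it has no zeros there
    set K : Fin m → Set Y := fun i => {u ∈ A | ∀ j, |h u j| ≤ |h u i|} with hKdef
    have hK : ∀ i, IsClosed (K i) := by
      intro i
      have : K i = ⋂ j, {u ∈ A | |h u j| ≤ |h u i|} := by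
        have : Nonempty (Fin m) := ⟨i⟩
        ext u
        simp only [hKdef, mem_ofPred_eq, mem_iInter]
        exact ⟨fun h j => ⟨h.1, h.2 j⟩, fun h => ⟨(h i).1, fun j => (h j).2⟩⟩
      rw [this]
      exact isClosed_iInter fun j => hA.isClosed_le (hci j).abs (hci i).abs
    refine ⟨fun i => Quotient.mk (antipodal Y) '' K i, fun i => ⟨isClosedMap_mk _ (hK i),
      isContractibleIn_image (hK i) (fun u hu => ⟨hsymm u hu.1, fun j => ?_⟩)
        ((hci i).mono fun u hu => hu.1) fun u hu => ⟨fun h0 => (hodd u hu.1).1 ?_, ?_⟩⟩, ?_⟩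
    · rw [(hodd u hu.1).2]
      simpa using hu.2 j
    · ext j
      have := hu.2 j
      rw [h0, abs_zero] at this
      simpa using abs_nonpos_iff.1 this
    · rw [(hodd u hu.1).2]; rfl
    · rintro _ ⟨u, hu, rfl⟩
      have hne : Nonempty (Fin m) := by
        by_contra hemp
        rw [not_nonempty_iff] at hemp
        exact (hodd u hu).1 (Subsingleton.elim _ _)
      obtain ⟨i, hi⟩ := Finite.exists_max fun i => |h u i|
      exact mem_iUnion.2 ⟨i, u, ⟨hu, hi⟩, rfl⟩
  · refine le_iInf₂ fun k hk => ?_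
    obtain ⟨B, hB, hAB⟩ := hk
    refine iInf₂_le k ?_
    choose g hgc hgodd hg0 using fun j => exists_odd_of_isContractibleIn hfree (hB j).1 (hB j).2
    refine ⟨fun u => WithLp.toLp 2 fun j => g j u, ?_, fun u hu => ⟨fun h0 => ?_, ?_⟩⟩
    · exact ((PiLp.continuous_toLp 2 _).comp (continuous_pi hgc)).continuousOn
    · obtain ⟨j, hj⟩ := mem_iUnion.1 (hAB ⟨u, hu, rfl⟩)
      exact hg0 j u hj (by simpa using congrArg (fun x : EuclideanSpace ℝ (Fin k) => x j) h0)
    · ext j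
      simpa using hgodd j u

end Involution

/-! ### Inequalities for functions on a Euclidean space -/

theorem sq_integral_mul_le {α : Type*} [MeasurableSpace α] {μ : Measure α} {f g : α → ℝ}
    (hf : MemLp f 2 μ) (hg : MemLp g 2 μ) :
    (∫ x, f x * g x ∂μ) ^ 2 ≤ (∫ x, f x ^ 2 ∂μ) * ∫ x, g x ^ 2 ∂μ := by
  have hfg : Integrable (fun x => f x * g x) μ := hf.integrable_mul hg
  have h1 : ∀ t : ℝ, 0 ≤ (∫ x, g x ^ 2 ∂μ) * (t * t) + (2 * ∫ x, f x * g x ∂μ) * t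
      + ∫ x, f x ^ 2 ∂μ := by
    intro t
    have h2 : ∫ x, (t * g x + f x) ^ 2 ∂μ = (∫ x, g x ^ 2 ∂μ) * (t * t)
        + (2 * ∫ x, f x * g x ∂μ) * t + ∫ x, f x ^ 2 ∂μ := by
      have h3 : ∀ x, (t * g x + f x) ^ 2 = (t * t) * g x ^ 2 + (2 * t) * (f x * g x) + f x ^ 2 :=
        fun x => by ring
      have h4 : Integrable (fun x => (t * t) * g x ^ 2 + (2 * t) * (f x * g x)) μ :=
        (hg.integrable_sq.const_mul _).add (hfg.const_mul _)
      simp only [h3]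
      rw [integral_add h4 hf.integrable_sq,
        integral_add (hg.integrable_sq.const_mul _) (hfg.const_mul _), integral_const_mul,
        integral_const_mul]
      ring
    rw [← h2]
    exact integral_nonneg fun x => sq_nonneg _
  have h4 := discrim_le_zero h1
  rw [discrim] at h4
  nlinarith

theorem sq_integral_le {α : Type*} [MeasurableSpace α] {μ : Measure α} [IsFiniteMeasure μ]
    {f : α → ℝ} (hf : MemLp f 2 μ) : (∫ x, f x ∂μ) ^ 2 ≤ μ.real univ * ∫ x, f x ^ 2 ∂μ := by
  have h := sq_integral_mul_le (memLp_const (1 : ℝ) (μ := μ)) hf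
  simpa using h

theorem memLp_two_restrict {E : Type*} [NormedAddCommGroup E] [NormedSpace ℝ E]
    [FiniteDimensional ℝ E] [MeasurableSpace E] [BorelSpace E] {μ : Measure E}
    [IsLocallyFiniteMeasure μ] {f : E → ℝ} (hf : Continuous f) {B : Set E}
    (hB : Bornology.IsBounded B) : MemLp f 2 (μ.restrict B) := by
  have hc : IsCompact (closure B) := hB.isCompact_closure
  refine MemLp.mono_measure (Measure.restrict_mono_set μ subset_closure) ?_
  obtain ⟨C, hC⟩ := hc.exists_bound_of_continuousOn hf.continuousOn
  have : IsFiniteMeasure (μ.restrict (closure B)) := ⟨by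
    rw [Measure.restrict_apply_univ]; exact hc.measure_lt_top⟩
  exact MemLp.of_bound hf.measurable.aestronglyMeasurable C
    ((ae_restrict_iff' isClosed_closure.measurableSet).2 (Filter.Eventually.of_forall hC))

section Rellich

variable {n : ℕ} {f : EuclideanSpace ℝ (Fin n) → ℝ}

/-- The increment of a `C¹` function is bounded by the mean of the derivative over the segment. -/
theorem sq_increment_le (hf : ContDiff ℝ 1 f) (x h : EuclideanSpace ℝ (Fin n)) :
    ENNReal.ofReal ((f (x + h) - f x) ^ 2) ≤
      ∫⁻ t in Ioc (0 : ℝ) 1, ENNReal.ofReal (‖h‖ ^ 2 * ‖fderiv ℝ f (x + t • h)‖ ^ 2) := by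
  have hc : Continuous (fderiv ℝ f) := hf.continuous_fderiv one_ne_zero
  have hc1 : Continuous fun t : ℝ => fderiv ℝ f (x + t • h) h := by fun_prop
  have hc2 : Continuous fun t : ℝ => ‖h‖ ^ 2 * ‖fderiv ℝ f (x + t • h)‖ ^ 2 := by fun_prop
  have h1 : ∫ t in (0 : ℝ)..1, fderiv ℝ f (x + t • h) h = f (x + h) - f x := by
    have h2 := intervalIntegral.integral_eq_sub_of_hasDerivAt (f := fun t : ℝ => f (x + t • h))
      (f' := fun t => fderiv ℝ f (x + t • h) h) (a := 0) (b := 1) (fun t _ => by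
        have h3 : HasDerivAt (fun t : ℝ => x + t • h) h t := by
          simpa using ((hasDerivAt_id t).smul_const h).const_add x
        exact ((hf.differentiable one_ne_zero) (x + t • h)).hasFDerivAt.comp_hasDerivAt t h3)
      (hc1.intervalIntegrable _ _)
    simpa using h2
  rw [← h1, intervalIntegral.integral_of_le zero_le_one]
  have h4 := sq_integral_le (memLp_two_restrict (μ := volume) hc1 (Metric.isBounded_Ioc (0 : ℝ) 1))
  have hi : IntegrableOn (fun t : ℝ => ‖h‖ ^ 2 * ‖fderiv ℝ f (x + t • h)‖ ^ 2) (Ioc 0 1) :=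
    (hc2.integrableOn_Icc).mono_set Ioc_subset_Icc_self
  rw [← ofReal_integral_eq_lintegral_ofReal hi (Filter.Eventually.of_forall fun t => by positivity)]
  refine ENNReal.ofReal_le_ofReal (h4.trans ?_)
  simp only [measureReal_restrict_apply_univ, Real.volume_real_Ioc, sub_zero,
    max_eq_left zero_le_one,
    one_mul]
  refine integral_mono_of_nonneg (Filter.Eventually.of_forall fun t => sq_nonneg _) hi
    (Filter.Eventually.of_forall fun t => ?_)
  have h5 := (fderiv ℝ f (x + t • h)).le_opNorm h
  rw [Real.norm_eq_abs] at h5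
  calc (fderiv ℝ f (x + t • h) h) ^ 2 = |fderiv ℝ f (x + t • h) h| ^ 2 := (sq_abs _).symm
    _ ≤ (‖fderiv ℝ f (x + t • h)‖ * ‖h‖) ^ 2 := pow_le_pow_left₀ (abs_nonneg _) h5 2
    _ = ‖h‖ ^ 2 * ‖fderiv ℝ f (x + t • h)‖ ^ 2 := by ring

theorem lintegral_sq_increment_le (hf : ContDiff ℝ 1 f) (h : EuclideanSpace ℝ (Fin n)) :
    ∫⁻ x, ENNReal.ofReal ((f (x + h) - f x) ^ 2) ≤
      ENNReal.ofReal (‖h‖ ^ 2) * ∫⁻ x, ENNReal.ofReal (‖fderiv ℝ f x‖ ^ 2) := by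
  have hc : Continuous (fderiv ℝ f) := hf.continuous_fderiv one_ne_zero
  calc ∫⁻ x, ENNReal.ofReal ((f (x + h) - f x) ^ 2)
      ≤ ∫⁻ x, ∫⁻ t in Ioc (0 : ℝ) 1, ENNReal.ofReal (‖h‖ ^ 2 * ‖fderiv ℝ f (x + t • h)‖ ^ 2) :=
        lintegral_mono fun x => sq_increment_le hf x h
    _ = ∫⁻ t in Ioc (0 : ℝ) 1, ∫⁻ x, ENNReal.ofReal (‖h‖ ^ 2 * ‖fderiv ℝ f (x + t • h)‖ ^ 2) := by
        refine lintegral_lintegral_swap (Measurable.aemeasurable ?_)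
        refine (Continuous.measurable ?_).ennreal_ofReal
        fun_prop
    _ = ∫⁻ t in Ioc (0 : ℝ) 1, ∫⁻ x, ENNReal.ofReal (‖h‖ ^ 2 * ‖fderiv ℝ f x‖ ^ 2) := by
        refine lintegral_congr fun t => ?_
        exact lintegral_add_right_eq_self
          (fun x => ENNReal.ofReal (‖h‖ ^ 2 * ‖fderiv ℝ f x‖ ^ 2)) (t • h)
    _ = ENNReal.ofReal (‖h‖ ^ 2) * ∫⁻ x, ENNReal.ofReal (‖fderiv ℝ f x‖ ^ 2) := by
        simp only [ENNReal.ofReal_mul (sq_nonneg ‖h‖)]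
        rw [lintegral_const, Measure.restrict_apply_univ, Real.volume_Ioc,
          lintegral_const_mul _ (by fun_prop)]
        simp

/-- Near the centre of a ball `B` the function differs from its mean over `B` by a mean of
increments. -/
theorem sq_sub_average_le (hf : Continuous f) {r : ℝ} (hr : 0 < r)
    {x z : EuclideanSpace ℝ (Fin n)} (hx : x ∈ Metric.ball z r) :
    ENNReal.ofReal ((f x - (volume.real (Metric.ball z r))⁻¹ * ∫ y in Metric.ball z r, f y) ^ 2) ≤
      ENNReal.ofReal (volume.real (Metric.ball z r))⁻¹ *
        ∫⁻ h in Metric.ball 0 (2 * r), ENNReal.ofReal ((f (x + h) - f x) ^ 2) := by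
  set B := Metric.ball z r with hB
  have hBb : Bornology.IsBounded B := Metric.isBounded_ball
  have hv : 0 < volume.real B := by
    rw [measureReal_def]
    exact ENNReal.toReal_pos (Metric.measure_ball_pos _ _ hr).ne' measure_ball_lt_top.ne
  have : IsFiniteMeasure (volume.restrict B) :=
    ⟨by rw [Measure.restrict_apply_univ]; exact measure_ball_lt_top⟩
  have hL := memLp_two_restrict (μ := volume) (f := fun y => f x - f y) (by fun_prop) hBb
  have hi : IntegrableOn f B :=
    (memLp_two_restrict (μ := volume) hf hBb).integrable one_le_two
  have h1 : f x - (volume.real B)⁻¹ * ∫ y in B, f y =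
      (volume.real B)⁻¹ * ∫ y in B, (f x - f y) := by
    rw [integral_sub (integrable_const _) hi]
    simp only [integral_const, measureReal_restrict_apply_univ, smul_eq_mul]
    field_simp
  have h2 := sq_integral_le hL
  rw [measureReal_restrict_apply_univ] at h2
  have h3 : (f x - (volume.real B)⁻¹ * ∫ y in B, f y) ^ 2 ≤
      (volume.real B)⁻¹ * ∫ y in B, (f x - f y) ^ 2 := by
    rw [h1, mul_pow, pow_two (volume.real B)⁻¹, mul_assoc]
    refine mul_le_mul_of_nonneg_left ?_ (inv_nonneg.2 hv.le)
    rw [inv_mul_le_iff₀ hv]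
    exact h2
  refine (ENNReal.ofReal_le_ofReal h3).trans ?_
  rw [ENNReal.ofReal_mul (inv_nonneg.2 hv.le), ofReal_integral_eq_lintegral_ofReal hL.integrable_sq
    (Filter.Eventually.of_forall fun y => sq_nonneg _)]
  refine mul_le_mul_right ?_ _
  calc ∫⁻ y in B, ENNReal.ofReal ((f x - f y) ^ 2)
      ≤ ∫⁻ y in Metric.ball x (2 * r), ENNReal.ofReal ((f x - f y) ^ 2) := by
        refine lintegral_mono_set fun y hy => ?_
        rw [hB, Metric.mem_ball] at hy
        rw [Metric.mem_ball] at hx ⊢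
        have := dist_triangle_right y x z
        linarith
    _ = ∫⁻ h in Metric.ball 0 (2 * r), ENNReal.ofReal ((f (x + h) - f x) ^ 2) := by
        rw [← lintegral_indicator Metric.isOpen_ball.measurableSet,
          ← lintegral_indicator Metric.isOpen_ball.measurableSet,
          ← lintegral_add_left_eq_self _ x]
        refine lintegral_congr fun h => ?_
        by_cases hh : h ∈ Metric.ball (0 : EuclideanSpace ℝ (Fin n)) (2 * r)
        · rw [indicator_of_mem hh, indicator_of_mem (by simpa using hh), ← neg_sub, neg_sq]
        · rw [indicator_of_notMem hh, indicator_of_notMem (by simpa using hh)]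

/-- **Rellich's theorem**: on the functions with support in a compact set the `L²` norm is
bounded by a small multiple of the norm of the gradient and finitely many means over balls. -/
theorem exists_averages {K : Set (EuclideanSpace ℝ (Fin n))} (hK : IsCompact K) {ε : ℝ}
    (hε : 0 < ε) :
    ∃ (t : Finset (EuclideanSpace ℝ (Fin n))) (r C : ℝ), 0 ≤ C ∧
      ∀ f : EuclideanSpace ℝ (Fin n) → ℝ, ContDiff ℝ 1 f → tsupport f ⊆ K →
        ∫ x, f x ^ 2 ≤ ε * (∫ x, ‖fderiv ℝ f x‖ ^ 2) +
          C * ∑ z ∈ t, (∫ y in Metric.ball z r, f y) ^ 2 := by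
  set c : ℝ := 2 * (2 ^ n * 4) with hc
  set r : ℝ := √(ε / c) with hr
  have hc0 : 0 < c := by positivity
  have hr0 : 0 < r := Real.sqrt_pos.2 (by positivity)
  have hr2 : c * r ^ 2 = ε := by
    rw [hr, Real.sq_sqrt (by positivity)]; field_simp
  obtain ⟨t, -, ht⟩ := hK.elim_nhds_subcover (fun z => Metric.ball z r)
    fun z _ => Metric.ball_mem_nhds z hr0
  set V : ℝ := volume.real (Metric.ball (0 : EuclideanSpace ℝ (Fin n)) r) with hV
  have hball : ∀ z : EuclideanSpace ℝ (Fin n), volume.real (Metric.ball z r) = V := fun z => by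
    rw [hV, measureReal_def, measureReal_def, Measure.addHaar_ball_center]
  have hV0 : 0 < V := by
    rw [hV, measureReal_def]
    exact ENNReal.toReal_pos (Metric.measure_ball_pos _ _ hr0).ne' measure_ball_lt_top.ne
  have hV2 : volume (Metric.ball (0 : EuclideanSpace ℝ (Fin n)) (2 * r)) =
      ENNReal.ofReal (2 ^ n * V) := by
    rw [Measure.addHaar_ball_mul_of_pos _ _ two_pos, ENNReal.ofReal_mul (by positivity), hV,
      ofReal_measureReal measure_ball_lt_top.ne]
    simp
  refine ⟨t, r, 2 * volume.real K * (V⁻¹) ^ 2, by positivity, fun f hf hfK => ?_⟩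
  have hfc : HasCompactSupport f := HasCompactSupport.of_support_subset_isCompact hK
    ((subset_tsupport f).trans hfK)
  set D := ∫ x, ‖fderiv ℝ f x‖ ^ 2 with hD
  set S := ∑ z ∈ t, (∫ y in Metric.ball z r, f y) ^ 2 with hS
  have hcf : Continuous (fderiv ℝ f) := hf.continuous_fderiv one_ne_zero
  have hDi : ENNReal.ofReal D = ∫⁻ x, ENNReal.ofReal (‖fderiv ℝ f x‖ ^ 2) := by
    refine ofReal_integral_eq_lintegral_ofReal ?_ (Filter.Eventually.of_forall fun y => sq_nonneg _)
    refine Continuous.integrable_of_hasCompactSupport (by fun_prop) ?_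
    exact (hfc.fderiv ℝ).comp_left (g := fun L => ‖L‖ ^ 2) (by simp)
  have hfi : ENNReal.ofReal (∫ x, f x ^ 2) = ∫⁻ x, ENNReal.ofReal (f x ^ 2) := by
    refine ofReal_integral_eq_lintegral_ofReal ?_ (Filter.Eventually.of_forall fun y => sq_nonneg _)
    refine Continuous.integrable_of_hasCompactSupport (hf.continuous.pow 2) ?_
    exact hfc.comp_left (g := fun y => y ^ 2) (by simp)
  have hpt : ∀ x, ENNReal.ofReal (f x ^ 2) ≤
      ENNReal.ofReal (2 * V⁻¹) *
        (∫⁻ h in Metric.ball 0 (2 * r), ENNReal.ofReal ((f (x + h) - f x) ^ 2)) +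
      K.indicator (fun _ => ENNReal.ofReal (2 * (V⁻¹) ^ 2 * S)) x := by
    intro x
    by_cases hx : x ∈ K
    · rw [indicator_of_mem hx]
      obtain ⟨z, hz, hxz⟩ := mem_iUnion₂.1 (ht hx)
      have h1 := sq_sub_average_le hf.continuous hr0 hxz
      rw [hball] at h1
      set a := V⁻¹ * ∫ y in Metric.ball z r, f y with ha
      have h2 : a ^ 2 ≤ (V⁻¹) ^ 2 * S := by
        rw [ha, mul_pow]
        exact mul_le_mul_of_nonneg_left (Finset.single_le_sum
          (f := fun z => (∫ y in Metric.ball z r, f y) ^ 2) (fun _ _ => sq_nonneg _) hz)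
          (sq_nonneg _)
      calc ENNReal.ofReal (f x ^ 2)
          ≤ ENNReal.ofReal (2 * (f x - a) ^ 2 + 2 * (V⁻¹) ^ 2 * S) :=
            ENNReal.ofReal_le_ofReal (by nlinarith [sq_nonneg (f x - 2 * a)])
        _ = ENNReal.ofReal 2 * ENNReal.ofReal ((f x - a) ^ 2) +
            ENNReal.ofReal (2 * (V⁻¹) ^ 2 * S) := by
            rw [ENNReal.ofReal_add (by positivity) (by
              have : 0 ≤ S := Finset.sum_nonneg fun _ _ => sq_nonneg _
              positivity), ENNReal.ofReal_mul zero_le_two]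
        _ ≤ _ := by
            rw [ENNReal.ofReal_mul (p := 2) zero_le_two (q := V⁻¹),
              mul_assoc (ENNReal.ofReal 2)]
            exact add_le_add (mul_le_mul_right h1 _) le_rfl
    · have : f x = 0 := image_eq_zero_of_notMem_tsupport fun h => hx (hfK h)
      simp [this]
  have hS0 : 0 ≤ S := Finset.sum_nonneg fun _ _ => sq_nonneg _
  have hD0 : 0 ≤ D := integral_nonneg fun _ => sq_nonneg _
  have hmeas : Measurable fun x => ∫⁻ h in Metric.ball 0 (2 * r),
      ENNReal.ofReal ((f (x + h) - f x) ^ 2) := by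
    refine Measurable.lintegral_prod_right' (f := fun p :
      EuclideanSpace ℝ (Fin n) × EuclideanSpace ℝ (Fin n) =>
        ENNReal.ofReal ((f (p.1 + p.2) - f p.1) ^ 2)) ?_
    have := hf.continuous
    exact (Continuous.measurable (by fun_prop)).ennreal_ofReal
  have hinc : ∫⁻ x, ∫⁻ h in Metric.ball 0 (2 * r), ENNReal.ofReal ((f (x + h) - f x) ^ 2) ≤
      ENNReal.ofReal (2 ^ n * V * (4 * r ^ 2) * D) := by
    rw [lintegral_lintegral_swap (by
      have := hf.continuous
      exact (Continuous.measurable (by fun_prop)).ennreal_ofReal.aemeasurable)]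
    calc ∫⁻ h in Metric.ball 0 (2 * r), ∫⁻ x, ENNReal.ofReal ((f (x + h) - f x) ^ 2)
        ≤ ∫⁻ h in Metric.ball (0 : EuclideanSpace ℝ (Fin n)) (2 * r),
            ENNReal.ofReal (4 * r ^ 2) * ENNReal.ofReal D := by
          refine setLIntegral_mono' Metric.isOpen_ball.measurableSet fun h hh => ?_
          refine (lintegral_sq_increment_le hf h).trans ?_
          rw [hDi]
          gcongr
          have : ‖h‖ < 2 * r := by simpa using hh
          nlinarith [norm_nonneg h]
      _ = ENNReal.ofReal (2 ^ n * V * (4 * r ^ 2) * D) := by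
          rw [lintegral_const, Measure.restrict_apply_univ, hV2,
            ← ENNReal.ofReal_mul (by positivity),
            ← ENNReal.ofReal_mul (by positivity)]
          congr 1; ring
  have hfin : ENNReal.ofReal (∫ x, f x ^ 2) ≤
      ENNReal.ofReal (ε * D + 2 * volume.real K * (V⁻¹) ^ 2 * S) := by
    rw [hfi]
    refine (lintegral_mono hpt).trans ?_
    rw [lintegral_add_right _ (measurable_const.indicator hK.measurableSet),
      lintegral_const_mul _ hmeas, lintegral_indicator hK.measurableSet, lintegral_const,
      Measure.restrict_apply_univ, ← ofReal_measureReal hK.measure_lt_top.ne,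
      ← ENNReal.ofReal_mul (by positivity), ENNReal.ofReal_add (by positivity) (by positivity)]
    refine add_le_add ?_ (le_of_eq (by congr 1; ring))
    refine (mul_le_mul_right hinc _).trans ?_
    rw [← ENNReal.ofReal_mul (by positivity)]
    refine ENNReal.ofReal_le_ofReal (le_of_eq ?_)
    rw [← hr2, hc]
    field_simp
  exact (ENNReal.ofReal_le_ofReal_iff (by positivity)).1 hfin

/-- Closability of the directional derivative in `L²`: if `g` is small in `L²`, the derivative of
`f` is controlled by that of `f - g`. Only the smooth function `f` is differentiated twice. -/
theorem exists_integral_sq_fderiv_le {f : EuclideanSpace ℝ (Fin n) → ℝ} (hf : ContDiff ℝ ∞ f)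
    (hfc : HasCompactSupport f) (e : EuclideanSpace ℝ (Fin n)) :
    ∃ C : ℝ, ∀ g : EuclideanSpace ℝ (Fin n) → ℝ, ContDiff ℝ ∞ g → HasCompactSupport g →
      ∫ x, (fderiv ℝ f x e) ^ 2 ≤
        √(∫ x, (fderiv ℝ f x e) ^ 2) * √(∫ x, (fderiv ℝ f x e - fderiv ℝ g x e) ^ 2) +
          C * √(∫ x, g x ^ 2) := by
  have hdc : ∀ {g : EuclideanSpace ℝ (Fin n) → ℝ}, ContDiff ℝ ∞ g →
      ContDiff ℝ ∞ fun x => fderiv ℝ g x e := fun hg =>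
    (hg.fderiv_right (m := ∞) (by simp)).clm_apply contDiff_const
  have hds : ∀ {g : EuclideanSpace ℝ (Fin n) → ℝ}, HasCompactSupport g →
      HasCompactSupport fun x => fderiv ℝ g x e := fun hg =>
    (hg.fderiv ℝ).comp_left (g := fun L : EuclideanSpace ℝ (Fin n) →L[ℝ] ℝ => L e) (by simp)
  have hL : ∀ {g : EuclideanSpace ℝ (Fin n) → ℝ}, ContDiff ℝ ∞ g → HasCompactSupport g →
      MemLp g 2 volume := fun hg hgc => hg.continuous.memLp_of_hasCompactSupport hgc
  set f' := fun x => fderiv ℝ f x e with hf'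
  set f'' := fun x => fderiv ℝ f' x e with hf''
  refine ⟨√(∫ x, f'' x ^ 2), fun g hg hgc => ?_⟩
  set g' := fun x => fderiv ℝ g x e with hg'
  have hLf : MemLp f' 2 volume := hL (hdc hf) (hds hfc)
  have hLf2 : MemLp f'' 2 volume := hL (hdc (hdc hf)) (hds (hds hfc))
  have hLg := hL hg hgc
  have hLg' : MemLp g' 2 volume := hL (hdc hg) (hds hgc)
  have habs : ∀ {p q : EuclideanSpace ℝ (Fin n) → ℝ}, MemLp p 2 volume → MemLp q 2 volume →
      |∫ x, p x * q x| ≤ √(∫ x, p x ^ 2) * √(∫ x, q x ^ 2) := fun hp hq => by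
    rw [← Real.sqrt_mul (integral_nonneg fun _ => sq_nonneg _)]
    exact Real.abs_le_sqrt (sq_integral_mul_le hp hq)
  have hparts : ∫ x, f' x * g' x = -∫ x, f'' x * g x :=
    integral_mul_fderiv_eq_neg_fderiv_mul_of_integrable (hLf2.integrable_mul hLg)
      (hLf.integrable_mul hLg') (hLf.integrable_mul hLg)
      (fun x _ => (hdc hf).differentiable (by simp) x)
      (fun x _ => hg.differentiable (by simp) x)
  have hLd : MemLp (fun x => f' x - g' x) 2 volume := hLf.sub hLg'
  have hsplit : ∫ x, f' x ^ 2 = (∫ x, f' x * (f' x - g' x)) + ∫ x, f' x * g' x := by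
    have hi1 : Integrable fun x => f' x * (f' x - g' x) := hLf.integrable_mul hLd
    have hi2 : Integrable fun x => f' x * g' x := hLf.integrable_mul hLg'
    rw [← integral_add hi1 hi2]
    congr 1; ext x; ring
  have h1 := le_of_abs_le (habs hLf hLd)
  have h2 := neg_le_of_abs_le (habs hLf2 hLg)
  calc ∫ x, f' x ^ 2 = (∫ x, f' x * (f' x - g' x)) - ∫ x, f'' x * g x := by
        rw [hsplit, hparts, sub_eq_add_neg]
    _ ≤ _ := by linarith

end Rellich

/-! ### Functions in charts -/

section Chart

variable {n : ℕ} [NeZero n] {M : Type*} [TopologicalSpace M]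
    [ChartedSpace (EuclideanHalfSpace n) M]

/-- The function `v` in the coordinates of the chart around `x₀`, extended by zero. -/
def chartRep (x₀ : M) (v : M → ℝ) : EuclideanSpace ℝ (Fin n) → ℝ :=
  (extChartAt (𝓡∂ n) x₀).target.indicator (v ∘ (extChartAt (𝓡∂ n) x₀).symm)

theorem chartRep_apply (x₀ : M) (v : M → ℝ) {x : M} (hx : x ∈ (extChartAt (𝓡∂ n) x₀).source) :
    chartRep x₀ v (extChartAt (𝓡∂ n) x₀ x) = v x := by
  rw [chartRep, indicator_of_mem ((extChartAt (𝓡∂ n) x₀).map_source hx), Function.comp_apply,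
    (extChartAt (𝓡∂ n) x₀).left_inv hx]

theorem chartRep_add (x₀ : M) (v w : M → ℝ) :
    chartRep (n := n) x₀ (v + w) = chartRep x₀ v + chartRep x₀ w :=
  indicator_add' _ _ _

theorem chartRep_smul (x₀ : M) (c : ℝ) (v : M → ℝ) :
    chartRep (n := n) x₀ (c • v) = c • chartRep x₀ v :=
  indicator_const_smul _ c _

theorem support_chartRep_subset (x₀ : M) (v : M → ℝ) :
    Function.support (chartRep (n := n) x₀ v) ⊆ extChartAt (𝓡∂ n) x₀ '' tsupport v := by
  intro z hz
  have hzT : z ∈ (extChartAt (𝓡∂ n) x₀).target := by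
    by_contra h
    exact hz (indicator_of_notMem h _)
  refine ⟨(extChartAt (𝓡∂ n) x₀).symm z, subset_tsupport v fun h0 => hz ?_,
    (extChartAt (𝓡∂ n) x₀).right_inv hzT⟩
  rw [chartRep, indicator_of_mem hzT, Function.comp_apply, h0]

variable {x₀ : M} {v : M → ℝ}

theorem isCompact_image_extChartAt {K : Set M} (hK : IsCompact K)
    (hKs : K ⊆ (extChartAt (𝓡∂ n) x₀).source) : IsCompact (extChartAt (𝓡∂ n) x₀ '' K) :=
  hK.image_of_continuousOn ((continuousOn_extChartAt x₀).mono hKs)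

theorem target_mem_nhds_of_interior [IsManifold (𝓡∂ n) ∞ M] {x : M}
    (hx : x ∈ (extChartAt (𝓡∂ n) x₀).source)
    (hi : x ∈ (𝓡∂ n).interior M) :
    (extChartAt (𝓡∂ n) x₀).target ∈ 𝓝 (extChartAt (𝓡∂ n) x₀ x) := by
  rw [extChartAt_source] at hx
  exact mem_interior_iff_mem_nhds.1 (((𝓡∂ n).isInteriorPoint_iff_of_mem_atlas (n := ∞) (by simp)
    (chart_mem_atlas _ x₀) hx).1 hi)

theorem measurableSet_extChartAt_target (x₀ : M) :
    MeasurableSet (extChartAt (𝓡∂ n) x₀).target := by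
  rw [extChartAt_target]
  exact ((chartAt _ x₀).open_target.preimage (𝓡∂ n).continuous_symm).measurableSet.inter
    (𝓡∂ n).isClosed_range.measurableSet

variable [CompactSpace M]

theorem tsupport_chartRep_subset (hvs : tsupport v ⊆ (extChartAt (𝓡∂ n) x₀).source) :
    tsupport (chartRep (n := n) x₀ v) ⊆ extChartAt (𝓡∂ n) x₀ '' tsupport v :=
  closure_minimal (support_chartRep_subset x₀ v)
    (isCompact_image_extChartAt (isClosed_tsupport v).isCompact hvs).isClosed

theorem hasCompactSupport_chartRep (hvs : tsupport v ⊆ (extChartAt (𝓡∂ n) x₀).source) :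
    HasCompactSupport (chartRep (n := n) x₀ v) :=
  HasCompactSupport.of_support_subset_isCompact
    (isCompact_image_extChartAt (isClosed_tsupport v).isCompact hvs) (support_chartRep_subset x₀ v)

variable [IsManifold (𝓡∂ n) ∞ M]

theorem contDiff_chartRep (hv : ContMDiff (𝓡∂ n) 𝓘(ℝ, ℝ) ∞ v)
    (hvi : tsupport v ⊆ (𝓡∂ n).interior M)
    (hvs : tsupport v ⊆ (extChartAt (𝓡∂ n) x₀).source) :
    ContDiff ℝ ∞ (chartRep (n := n) x₀ v) := by
  rw [contDiff_iff_contDiffAt]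
  intro z
  by_cases hz : z ∈ extChartAt (𝓡∂ n) x₀ '' tsupport v
  · obtain ⟨x, hx, rfl⟩ := hz
    have hT := target_mem_nhds_of_interior (hvs hx) (hvi hx)
    have h1 : ContDiffOn ℝ ∞ (v ∘ (extChartAt (𝓡∂ n) x₀).symm) (extChartAt (𝓡∂ n) x₀).target :=
      contMDiffOn_iff_contDiffOn.1 (hv.comp_contMDiffOn (contMDiffOn_extChartAt_symm x₀))
    refine (h1.contDiffAt hT).congr_of_eventuallyEq ?_
    filter_upwards [hT] with z hz
    exact indicator_of_mem hz _
  · have hzn : z ∉ tsupport (chartRep (n := n) x₀ v) := fun h => hz (tsupport_chartRep_subset hvs h)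
    have h0 : chartRep (n := n) x₀ v =ᶠ[𝓝 z] fun _ => 0 := notMem_tsupport_iff_eventuallyEq.1 hzn
    exact contDiffAt_const.congr_of_eventuallyEq h0

/-- The differential in coordinates. -/
theorem fderiv_chartRep (hv : ContMDiff (𝓡∂ n) 𝓘(ℝ, ℝ) ∞ v)
    (hvi : tsupport v ⊆ (𝓡∂ n).interior M)
    (hvs : tsupport v ⊆ (extChartAt (𝓡∂ n) x₀).source) {x : M}
    (hx : x ∈ (extChartAt (𝓡∂ n) x₀).source) (w : EuclideanSpace ℝ (Fin n)) :
    fderiv ℝ (chartRep x₀ v) (extChartAt (𝓡∂ n) x₀ x) w = differential n v x (frameVec x₀ x w) := by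
  have hx' : x ∈ (chartAt (EuclideanHalfSpace n) x₀).source := by rwa [extChartAt_source] at hx
  by_cases hxt : x ∈ tsupport v
  · have hf := contDiff_chartRep hv hvi hvs
    have h1 : v =ᶠ[𝓝 x] chartRep (n := n) x₀ v ∘ extChartAt (𝓡∂ n) x₀ := by
      filter_upwards [extChartAt_source_mem_nhds' hx] with y hy
      exact (chartRep_apply x₀ v hy).symm
    have h2 : MDifferentiableAt 𝓘(ℝ, EuclideanSpace ℝ (Fin n)) 𝓘(ℝ, ℝ) (chartRep (n := n) x₀ v)
        (extChartAt (𝓡∂ n) x₀ x) :=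
      ((hf.differentiable (by simp)) _).mdifferentiableAt
    have h3 : MDifferentiableAt (𝓡∂ n) 𝓘(ℝ, EuclideanSpace ℝ (Fin n)) (extChartAt (𝓡∂ n) x₀) x :=
      mdifferentiableAt_extChartAt hx'
    have h4 : mfderiv (𝓡∂ n) 𝓘(ℝ, EuclideanSpace ℝ (Fin n)) (extChartAt (𝓡∂ n) x₀) x
        (frameVec x₀ x w) = w := by
      have : IsManifold (𝓡∂ n) 1 M := IsManifold.of_le (n := ∞) (by simp)
      rw [← TangentBundle.continuousLinearMapAt_trivializationAt hx']
      exact (trivializationAt (EuclideanSpace ℝ (Fin n)) (TangentSpace (𝓡∂ n))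
        x₀).continuousLinearMapAt_symmL (R := ℝ) (b := x) (by simpa using hx') w
    have h5 : mfderiv (𝓡∂ n) 𝓘(ℝ, ℝ) v x (frameVec x₀ x w) =
        mfderiv 𝓘(ℝ, EuclideanSpace ℝ (Fin n)) 𝓘(ℝ, ℝ) (chartRep (n := n) x₀ v)
          (extChartAt (𝓡∂ n) x₀ x) (mfderiv (𝓡∂ n) 𝓘(ℝ, EuclideanSpace ℝ (Fin n))
            (extChartAt (𝓡∂ n) x₀) x (frameVec x₀ x w)) := by
      rw [h1.mfderiv_eq, mfderiv_comp x h2 h3]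
      rfl
    refine Eq.trans ?_ h5.symm
    rw [h4, mfderiv_eq_fderiv]
    rfl
  · have h1 : v =ᶠ[𝓝 x] fun _ => 0 := notMem_tsupport_iff_eventuallyEq.1 hxt
    have hn : extChartAt (𝓡∂ n) x₀ x ∉ tsupport (chartRep (n := n) x₀ v) := fun h => by
      obtain ⟨y, hy, hyx⟩ := tsupport_chartRep_subset hvs h
      rw [(extChartAt (𝓡∂ n) x₀).injOn (hvs hy) hx hyx] at hy
      exact hxt hy
    have h2 : chartRep (n := n) x₀ v =ᶠ[𝓝 (extChartAt (𝓡∂ n) x₀ x)] fun _ => 0 :=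
      notMem_tsupport_iff_eventuallyEq.1 hn
    rw [h2.fderiv_eq, differential, h1.mfderiv_eq, mfderiv_const]
    simp only [fderiv_fun_const]
    rfl

end Chart

section DualBounds

variable {n : ℕ} [NeZero n] {M : Type*} [TopologicalSpace M]
    [ChartedSpace (EuclideanHalfSpace n) M] [IsManifold (𝓡∂ n) ∞ M]

/-- Over a compact part of a chart domain the dual metric is comparable to the Euclidean norm of
the coordinates. -/
theorem exists_dual_bounds (F : FinslerMetric n M) {x₀ : M} {K : Set M} (hK : IsCompact K)
    (hKs : K ⊆ (chartAt (EuclideanHalfSpace n) x₀).source) :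
    ∃ C : ℝ, 0 < C ∧ ∀ x ∈ K, ∀ (η : TangentSpace (𝓡∂ n) x →L[ℝ] ℝ)
      (L : EuclideanSpace ℝ (Fin n) →L[ℝ] ℝ), (∀ w, L w = η (frameVec x₀ x w)) →
      F.dual x η ≤ C * ‖L‖ ∧ ‖L‖ ≤ C * F.dual x η := by
  rcases K.eq_empty_or_nonempty with rfl | hKne
  · exact ⟨1, one_pos, fun x hx => absurd hx (notMem_empty x)⟩
  set S := Metric.sphere (0 : EuclideanSpace ℝ (Fin n)) 1 with hS
  have hSne : S.Nonempty := NormedSpace.sphere_nonempty.2 zero_le_one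
  have hne : ∀ w ∈ S, w ≠ 0 := fun w hw h0 => by
    rw [hS, h0] at hw; simp at hw
  have hcont : ContinuousOn (fun p : M × EuclideanSpace ℝ (Fin n) =>
      F.toFun p.1 (frameVec x₀ p.1 p.2)) (K ×ˢ S) := by
    rw [continuousOn_iff_continuous_domRestrict]
    have h1 : Continuous fun p : (K ×ˢ S : Set (M × EuclideanSpace ℝ (Fin n))) =>
        (⟨p.1.1, frameVec x₀ p.1.1 p.1.2⟩ : TangentBundle (𝓡∂ n) M) :=
      (continuousOn_frame x₀).comp (f := fun p : (K ×ˢ S : Set (M × EuclideanSpace ℝ (Fin n))) =>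
        ((⟨p.1.1, hKs p.2.1⟩, p.1.2) :
          (chartAt (EuclideanHalfSpace n) x₀).source × EuclideanSpace ℝ (Fin n))) (by fun_prop)
    exact F.smooth.continuousOn.comp_continuous h1
      fun p => frameVec_ne (hKs p.2.1) (hne _ p.2.2)
  have hKS : IsCompact (K ×ˢ S) := hK.prod (isCompact_sphere 0 1)
  obtain ⟨p, hp, hmin⟩ := hKS.exists_isMinOn (hKne.prod hSne) hcont
  obtain ⟨q, hq, hmax⟩ := hKS.exists_isMaxOn (hKne.prod hSne) hcont
  set a := F.toFun p.1 (frameVec x₀ p.1 p.2) with ha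
  set b := F.toFun q.1 (frameVec x₀ q.1 q.2) with hb
  have ha0 : 0 < a := F.pos _ _ (frameVec_ne (hKs hp.1) (hne _ hp.2))
  have hb0 : 0 < b := F.pos _ _ (frameVec_ne (hKs hq.1) (hne _ hq.2))
  refine ⟨max a⁻¹ b, lt_max_of_lt_right hb0, fun x hx η L hL => ⟨?_, ?_⟩⟩
  · have hne' : Nonempty {y : TangentSpace (𝓡∂ n) x // y ≠ 0} := by
      obtain ⟨w, hw⟩ := hSne
      exact ⟨⟨_, frameVec_ne (hKs hx) (hne w hw)⟩⟩
    have h1 : F.dual x η ≤ a⁻¹ * ‖L‖ := by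
      refine ciSup_le fun y => ?_
      obtain ⟨⟨w, hw⟩, -, hwy⟩ := (range_dual F (hKs hx) η).le ⟨y, rfl⟩
      have hwn : ‖w‖ = 1 := by simpa [hS] using hw
      have h2 : a ≤ F.toFun x (frameVec x₀ x w) := hmin (⟨hx, hw⟩ : (x, w) ∈ K ×ˢ S)
      have h3 : η (frameVec x₀ x w) ≤ ‖L‖ := by
        rw [← hL]
        have := (le_abs_self _).trans (L.le_opNorm w)
        rwa [hwn, mul_one] at this
      refine hwy.symm.le.trans ?_
      change η (frameVec x₀ x w) / F.toFun x (frameVec x₀ x w) ≤ _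
      rw [inv_mul_eq_div]
      exact div_le_div₀ (norm_nonneg _) h3 ha0 h2
    exact h1.trans (mul_le_mul_of_nonneg_right (le_max_left _ _) (norm_nonneg _))
  · have hd := dual_nonneg F x η
    have h1 : ∀ w, L w ≤ b * F.dual x η * ‖w‖ := by
      intro w
      rcases eq_or_ne w 0 with rfl | hw
      · simp
      have hn : 0 < ‖w‖ := norm_pos_iff.2 hw
      have hwS : ‖w‖⁻¹ • w ∈ S := by simp [hS, norm_smul, hn.ne']
      have h2 : F.toFun x (frameVec x₀ x (‖w‖⁻¹ • w)) ≤ b :=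
        hmax (⟨hx, hwS⟩ : (x, ‖w‖⁻¹ • w) ∈ K ×ˢ S)
      have hpos := F.pos x _ (frameVec_ne (hKs hx) (hne _ hwS))
      have h3 : η (frameVec x₀ x (‖w‖⁻¹ • w)) / F.toFun x (frameVec x₀ x (‖w‖⁻¹ • w)) ≤
          F.dual x η :=
        le_ciSup (bddAbove_dual F x η) ⟨_, frameVec_ne (hKs hx) (hne _ hwS)⟩
      rw [div_le_iff₀ hpos, ← hL, map_smul, smul_eq_mul, inv_mul_le_iff₀ hn] at h3
      calc L w ≤ ‖w‖ * (F.dual x η * F.toFun x (frameVec x₀ x (‖w‖⁻¹ • w))) := h3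
        _ ≤ ‖w‖ * (F.dual x η * b) := by gcongr
        _ = b * F.dual x η * ‖w‖ := by ring
    have h2 : ‖L‖ ≤ b * F.dual x η := by
      refine L.opNorm_le_bound (by positivity) fun w => ?_
      rw [Real.norm_eq_abs, abs_le']
      refine ⟨h1 w, ?_⟩
      have := h1 (-w)
      rwa [map_neg, norm_neg] at this
    exact h2.trans (mul_le_mul_of_nonneg_right (le_max_right _ _) hd)

end DualBounds

section MeasureBounds

variable {n : ℕ} [NeZero n] {M : Type*} [TopologicalSpace M]
    [ChartedSpace (EuclideanHalfSpace n) M] [MeasurableSpace M] [BorelSpace M]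

theorem HasChartDensity.lintegral_eq {m : Measure M} {x₀ : M} {σ : EuclideanSpace ℝ (Fin n) → ℝ}
    (hd : HasChartDensity m x₀ σ) (hσ : ContinuousOn σ (extChartAt (𝓡∂ n) x₀).target)
    {G : EuclideanSpace ℝ (Fin n) → ℝ≥0∞} (hG : Measurable G) :
    ∫⁻ x in (extChartAt (𝓡∂ n) x₀).source, G (extChartAt (𝓡∂ n) x₀ x) ∂m =
      ∫⁻ z in (extChartAt (𝓡∂ n) x₀).target, ENNReal.ofReal (σ z) * G z := by
  have hae : AEMeasurable (extChartAt (𝓡∂ n) x₀)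
      (m.restrict (extChartAt (𝓡∂ n) x₀).source) :=
    (continuousOn_extChartAt x₀).aemeasurable (isOpen_extChartAt_source x₀).measurableSet
  have hσm : AEMeasurable (fun z => ENNReal.ofReal (σ z))
      (volume.restrict (extChartAt (𝓡∂ n) x₀).target) :=
    (hσ.aemeasurable (measurableSet_extChartAt_target x₀)).ennreal_ofReal
  have h1 := lintegral_map' (f := G) (hG.aemeasurable) hae
  rw [← h1, show (m.restrict _).map _ = _ from hd,
    lintegral_withDensity_eq_lintegral_mul₀ hσm hG.aemeasurable]
  rfl

/-- Over a compact part of a chart domain a smooth measure is comparable to Lebesgue measure. -/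
theorem exists_measure_bounds [CompactSpace M] {m : Measure M} [IsFiniteMeasure m]
    (hm : IsSmoothMeasure n m)
    {x₀ : M} {K : Set M} (hK : IsCompact K) (hKs : K ⊆ (extChartAt (𝓡∂ n) x₀).source) :
    ∃ C : ℝ, 0 < C ∧ ∀ (h : M → ℝ) (G : EuclideanSpace ℝ (Fin n) → ℝ), Continuous h →
      Continuous G → (∀ x, 0 ≤ h x) → (∀ z, 0 ≤ G z) → Function.support h ⊆ K →
      Function.support G ⊆ extChartAt (𝓡∂ n) x₀ '' K →
      ((∀ x ∈ K, h x ≤ G (extChartAt (𝓡∂ n) x₀ x)) → ∫ x, h x ∂m ≤ C * ∫ z, G z) ∧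
      ((∀ x ∈ K, G (extChartAt (𝓡∂ n) x₀ x) ≤ h x) → ∫ z, G z ≤ C * ∫ x, h x ∂m) := by
  rcases K.eq_empty_or_nonempty with rfl | hKne
  · refine ⟨1, one_pos, fun h G _ _ _ _ hh hG => ?_⟩
    rw [image_empty] at hG
    rw [Function.support_eq_empty_iff.1 (subset_empty_iff.1 hh),
      Function.support_eq_empty_iff.1 (subset_empty_iff.1 hG)]
    simp
  obtain ⟨σ, hσ, hσ0, hd⟩ := hm x₀
  set T := (extChartAt (𝓡∂ n) x₀).target with hT
  have hTm : MeasurableSet T := measurableSet_extChartAt_target x₀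
  have hSm : MeasurableSet (extChartAt (𝓡∂ n) x₀).source :=
    (isOpen_extChartAt_source x₀).measurableSet
  set K' := extChartAt (𝓡∂ n) x₀ '' K with hK'
  have hK'c : IsCompact K' := isCompact_image_extChartAt hK hKs
  have hK'T : K' ⊆ T := by
    rintro _ ⟨x, hx, rfl⟩; exact (extChartAt (𝓡∂ n) x₀).map_source (hKs hx)
  obtain ⟨p, hp, hmin⟩ := hK'c.exists_isMinOn (hKne.image _) (hσ.continuousOn.mono hK'T)
  obtain ⟨q, hq, hmax⟩ := hK'c.exists_isMaxOn (hKne.image _) (hσ.continuousOn.mono hK'T)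
  have hp0 := hσ0 p (hK'T hp)
  have hq0 := hσ0 q (hK'T hq)
  refine ⟨max (σ p)⁻¹ (σ q), lt_max_of_lt_right hq0, fun h G hh hG hh0 hG0 hhK hGK => ?_⟩
  have hGi : Integrable G := hG.integrable_of_hasCompactSupport
    (HasCompactSupport.of_support_subset_isCompact hK'c hGK)
  have hhi : Integrable h m := by
    obtain ⟨C, hC⟩ := isCompact_univ.exists_bound_of_continuousOn hh.continuousOn
    exact Integrable.of_bound hh.measurable.aestronglyMeasurable C
      (Filter.Eventually.of_forall fun x => hC x (mem_univ x))
  have e1 : ENNReal.ofReal (∫ x, h x ∂m) =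
      ∫⁻ x in (extChartAt (𝓡∂ n) x₀).source, ENNReal.ofReal (h x) ∂m := by
    rw [ofReal_integral_eq_lintegral_ofReal hhi (Filter.Eventually.of_forall hh0),
      ← lintegral_indicator hSm]
    refine lintegral_congr fun x => ?_
    by_cases hx : x ∈ (extChartAt (𝓡∂ n) x₀).source
    · rw [indicator_of_mem hx]
    · rw [indicator_of_notMem hx, Function.notMem_support.1 fun h' => hx (hKs (hhK h')),
        ENNReal.ofReal_zero]
  have e2 : ENNReal.ofReal (∫ z, G z) = ∫⁻ z in T, ENNReal.ofReal (G z) := by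
    rw [ofReal_integral_eq_lintegral_ofReal hGi (Filter.Eventually.of_forall hG0),
      ← lintegral_indicator hTm]
    refine lintegral_congr fun z => ?_
    by_cases hz : z ∈ T
    · rw [indicator_of_mem hz]
    · rw [indicator_of_notMem hz, Function.notMem_support.1 fun h' => hz (hK'T (hGK h')),
        ENNReal.ofReal_zero]
  have e3 := hd.lintegral_eq hσ.continuousOn (G := fun z => ENNReal.ofReal (G z))
    hG.measurable.ennreal_ofReal
  have hGz : ∀ z ∉ K', G z = 0 := fun z hz => Function.notMem_support.1 fun h' => hz (hGK h')
  have hGoff : ∀ x ∈ (extChartAt (𝓡∂ n) x₀).source, x ∉ K → G (extChartAt (𝓡∂ n) x₀ x) = 0 := by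
    intro x hx hxK
    refine hGz _ fun hmem => hxK ?_
    obtain ⟨y, hy, hyx⟩ := hmem
    rwa [(extChartAt (𝓡∂ n) x₀).injOn (hKs hy) hx hyx] at hy
  have hhoff : ∀ x ∉ K, h x = 0 := fun x hx => Function.notMem_support.1 fun h' => hx (hhK h')
  have hGint : 0 ≤ ∫ z, G z := integral_nonneg hG0
  have hhint : 0 ≤ ∫ x, h x ∂m := integral_nonneg hh0
  constructor
  · intro hle
    have h1 : ENNReal.ofReal (∫ x, h x ∂m) ≤ ENNReal.ofReal (σ q * ∫ z, G z) := by
      rw [e1, ENNReal.ofReal_mul hq0.le, e2, ← lintegral_const_mul _ hG.measurable.ennreal_ofReal]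
      refine le_trans (setLIntegral_mono' hSm fun x hx => ?_) (e3.le.trans
        (setLIntegral_mono' hTm fun z hz => ?_))
      · by_cases hxK : x ∈ K
        · exact ENNReal.ofReal_le_ofReal (hle x hxK)
        · rw [hhoff x hxK, ENNReal.ofReal_zero]; exact zero_le
      · by_cases hzK : z ∈ K'
        · exact mul_le_mul_left (ENNReal.ofReal_le_ofReal (hmax hzK)) _
        · simp [hGz z hzK]
    exact ((ENNReal.ofReal_le_ofReal_iff (by positivity)).1 h1).trans
      (mul_le_mul_of_nonneg_right (le_max_right _ _) hGint)
  · intro hle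
    have h1 : ENNReal.ofReal (σ p * ∫ z, G z) ≤ ENNReal.ofReal (∫ x, h x ∂m) := by
      rw [e1, ENNReal.ofReal_mul hp0.le, e2, ← lintegral_const_mul _ hG.measurable.ennreal_ofReal]
      refine le_trans (setLIntegral_mono' hTm fun z hz => ?_) (e3.symm.le.trans
        (setLIntegral_mono' hSm fun x hx => ?_))
      · by_cases hzK : z ∈ K'
        · exact mul_le_mul_left (ENNReal.ofReal_le_ofReal (hmin hzK)) _
        · simp [hGz z hzK]
      · by_cases hxK : x ∈ K
        · exact ENNReal.ofReal_le_ofReal (hle x hxK)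
        · rw [hGoff x hx hxK, ENNReal.ofReal_zero]; exact zero_le
    have h2 := (ENNReal.ofReal_le_ofReal_iff hhint).1 h1
    calc ∫ z, G z ≤ (σ p)⁻¹ * ∫ x, h x ∂m := by
          rw [le_inv_mul_iff₀ hp0]; exact h2
      _ ≤ _ := mul_le_mul_of_nonneg_right (le_max_left _ _) hhint

end MeasureBounds

/-! ### Localization of test functions -/

section Localization

variable {𝓜 : CompactFMMM.{u}}

theorem CompactFMMM.TestFunction.tsupport_subset (u : 𝓜.TestFunction) :
    tsupport (u : 𝓜.M → ℝ) ⊆ (𝓡∂ 𝓜.n).interior 𝓜.M :=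
  (show u.1 ∈ 𝓜.testSubmodule from u.2).2

/-- Multiplication of test functions by a smooth function. -/
def mulTest (χ : 𝓜.M → ℝ) (hχ : ContMDiff (𝓡∂ 𝓜.n) 𝓘(ℝ, ℝ) ∞ χ) :
    𝓜.TestFunction →ₗ[ℝ] 𝓜.TestFunction where
  toFun u := ⟨χ * u, hχ.mul u.contMDiff,
    (closure_mono (Function.support_mul_subset_right χ u)).trans u.tsupport_subset⟩
  map_add' u v := Subtype.ext (mul_add χ (u : 𝓜.M → ℝ) v)
  map_smul' c u := Subtype.ext (mul_smul_comm c χ (u : 𝓜.M → ℝ))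

theorem mulTest_apply (χ : 𝓜.M → ℝ) (hχ : ContMDiff (𝓡∂ 𝓜.n) 𝓘(ℝ, ℝ) ∞ χ)
    (u : 𝓜.TestFunction) (x : 𝓜.M) : mulTest χ hχ u x = χ x * u x := rfl

theorem gradAbs_mulTest_le (χ : 𝓜.M → ℝ) (hχ : ContMDiff (𝓡∂ 𝓜.n) 𝓘(ℝ, ℝ) ∞ χ)
    (u : 𝓜.TestFunction) (x : 𝓜.M) :
    𝓜.gradAbs (mulTest χ hχ u) x ≤ |χ x| * 𝓜.gradAbs u x + |u x| * 𝓜.gradAbs χ x := by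
  have h1 : differential 𝓜.n (mulTest χ hχ u) x =
      χ x • differential 𝓜.n u x + u x • differential 𝓜.n χ x :=
    (HasMFDerivAt.mul (hχ.mdifferentiableAt (by simp)).hasMFDerivAt
      (u.contMDiff.mdifferentiableAt (by simp)).hasMFDerivAt).mfderiv
  have h2 := dual_add_le 𝓜.F x (χ x • differential 𝓜.n u x) (u x • differential 𝓜.n χ x)
  rw [← h1, dual_smul, dual_smul] at h2
  exact h2

theorem gradAbs_nonneg (u : 𝓜.M → ℝ) (x : 𝓜.M) : 0 ≤ 𝓜.gradAbs u x := dual_nonneg _ _ _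

theorem continuous_gradAbs (u : 𝓜.TestFunction) : Continuous (𝓜.gradAbs u) :=
  continuous_dual 𝓜.F u.contMDiff

theorem sqrt_integral_sq_mono {α : Type*} [MeasurableSpace α] {μ : Measure α} {f g : α → ℝ}
    (hg : MemLp g 2 μ) (h : ∀ x, |f x| ≤ g x) :
    √(∫ x, f x ^ 2 ∂μ) ≤ √(∫ x, g x ^ 2 ∂μ) :=
  Real.sqrt_le_sqrt (integral_mono_of_nonneg (Filter.Eventually.of_forall fun x => sq_nonneg _)
    hg.integrable_sq (Filter.Eventually.of_forall fun x => by
      simpa using pow_le_pow_left₀ (abs_nonneg _) (h x) 2))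

theorem sqrt_integral_sq_const_mul {α : Type*} [MeasurableSpace α] {μ : Measure α} {c : ℝ}
    (hc : 0 ≤ c) (f : α → ℝ) : √(∫ x, (c * f x) ^ 2 ∂μ) = c * √(∫ x, f x ^ 2 ∂μ) := by
  simp only [mul_pow, integral_const_mul, Real.sqrt_mul (sq_nonneg c), Real.sqrt_sq hc]

theorem testL2_nonneg (u : 𝓜.TestFunction) : 0 ≤ 𝓜.testL2 u := Real.sqrt_nonneg _

theorem testGrad_nonneg (u : 𝓜.TestFunction) : 0 ≤ 𝓜.testGrad u := Real.sqrt_nonneg _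

theorem testL2_le_norm (u : 𝓜.TestFunction) : 𝓜.testL2 u ≤ ‖u‖ := by
  rw [𝓜.norm_testFunction]; linarith [testGrad_nonneg u]

theorem exists_bound_mulTest (χ : 𝓜.M → ℝ) (hχ : ContMDiff (𝓡∂ 𝓜.n) 𝓘(ℝ, ℝ) ∞ χ) :
    ∃ C : ℝ, 0 < C ∧ ∀ u, 𝓜.testL2 (mulTest χ hχ u) ≤ C * 𝓜.testL2 u ∧
      𝓜.testGrad (mulTest χ hχ u) ≤ C * ‖u‖ := by
  obtain ⟨C₁, h₁⟩ := isCompact_univ.exists_bound_of_continuousOn hχ.continuous.continuousOn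
  obtain ⟨C₂, h₂⟩ := isCompact_univ.exists_bound_of_continuousOn
    (continuous_dual 𝓜.F hχ).continuousOn
  set C := max 1 (max C₁ C₂) with hC
  have hC0 : 0 < C := lt_max_of_lt_left one_pos
  have hb₁ : ∀ x, |χ x| ≤ C := fun x =>
    (h₁ x (mem_univ x)).trans ((le_max_left _ _).trans (le_max_right _ _))
  have hb₂ : ∀ x, 𝓜.gradAbs χ x ≤ C := fun x =>
    (le_abs_self _).trans ((h₂ x (mem_univ x)).trans ((le_max_right _ _).trans (le_max_right _ _)))
  refine ⟨C, hC0, fun u => ?_⟩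
  have hu := 𝓜.memLp_of_continuous (u.contMDiff.continuous)
  have hL2 : ∀ x, |mulTest χ hχ u x| ≤ C * |u x| := fun x => by
    rw [mulTest_apply, abs_mul]
    exact mul_le_mul_of_nonneg_right (hb₁ x) (abs_nonneg _)
  have habs : 𝓜.testL2 u = √(∫ x, |u x| ^ 2 ∂𝓜.m) := by simp only [sq_abs]; rfl
  refine ⟨?_, ?_⟩
  · rw [habs, ← sqrt_integral_sq_const_mul hC0.le]
    exact sqrt_integral_sq_mono (hu.abs.const_mul C) hL2
  · rw [𝓜.norm_testFunction, add_comm, mul_add, habs, CompactFMMM.testGrad,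
      ← sqrt_integral_sq_const_mul hC0.le, CompactFMMM.testGrad,
      ← sqrt_integral_sq_const_mul hC0.le]
    refine le_trans (sqrt_integral_sq_mono (((𝓜.memLp_gradAbs u).const_mul C).add
      (hu.abs.const_mul C)) fun x => ?_) (sqrt_integral_sq_add_le ((𝓜.memLp_gradAbs u).const_mul C)
      (hu.abs.const_mul C))
    rw [abs_of_nonneg (gradAbs_nonneg _ _)]
    refine (gradAbs_mulTest_le χ hχ u x).trans (add_le_add ?_ ?_)
    · exact mul_le_mul_of_nonneg_right (hb₁ x) (gradAbs_nonneg _ _)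
    · rw [mul_comm]
      exact mul_le_mul_of_nonneg_right (hb₂ x) (abs_nonneg _)

theorem continuous_norm_fderiv_sq {f : EuclideanSpace ℝ (Fin 𝓜.n) → ℝ} (hf : ContDiff ℝ ∞ f) :
    Continuous fun z => ‖fderiv ℝ f z‖ ^ 2 :=
  (hf.continuous_fderiv (by simp)).norm.pow 2

/-- The norms of test functions with support in a fixed compact part of a chart domain are
comparable to the Euclidean norms of their coordinate expressions. -/
theorem exists_chart_bounds {x₀ : 𝓜.M} {K : Set 𝓜.M} (hK : IsClosed K)
    (hKs : K ⊆ (extChartAt (𝓡∂ 𝓜.n) x₀).source) :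
    ∃ C : ℝ, 0 < C ∧ ∀ u : 𝓜.TestFunction, tsupport (u : 𝓜.M → ℝ) ⊆ K →
      𝓜.testL2 u ≤ C * √(∫ z, chartRep (n := 𝓜.n) x₀ u z ^ 2) ∧
      √(∫ z, chartRep (n := 𝓜.n) x₀ u z ^ 2) ≤ C * 𝓜.testL2 u ∧
      𝓜.testGrad u ≤ C * √(∫ z, ‖fderiv ℝ (chartRep (n := 𝓜.n) x₀ u) z‖ ^ 2) ∧
      √(∫ z, ‖fderiv ℝ (chartRep (n := 𝓜.n) x₀ u) z‖ ^ 2) ≤ C * 𝓜.testGrad u := by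
  obtain ⟨a, ha, hdual⟩ := exists_dual_bounds 𝓜.F hK.isCompact
    (hKs.trans (extChartAt_source (I := 𝓡∂ 𝓜.n) x₀).le)
  obtain ⟨b, hb, hmeas⟩ := exists_measure_bounds 𝓜.smooth_measure hK.isCompact hKs
  set C := max (√b) (a * √b) with hC
  have hsb : 0 < √b := Real.sqrt_pos.2 hb
  have hC1 : √b ≤ C := le_max_left _ _
  have hC2 : a * √b ≤ C := le_max_right _ _
  refine ⟨C, lt_max_of_lt_left hsb, fun u hu => ?_⟩
  set f := chartRep (n := 𝓜.n) x₀ u with hf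
  have hus : tsupport (u : 𝓜.M → ℝ) ⊆ (extChartAt (𝓡∂ 𝓜.n) x₀).source := hu.trans hKs
  have hfs : ContDiff ℝ ∞ f := contDiff_chartRep u.contMDiff u.tsupport_subset hus
  have htf : tsupport f ⊆ extChartAt (𝓡∂ 𝓜.n) x₀ '' K :=
    (tsupport_chartRep_subset hus).trans (image_mono hu)
  have hfd : ∀ x ∈ K, ∀ w, fderiv ℝ f (extChartAt (𝓡∂ 𝓜.n) x₀ x) w =
      differential 𝓜.n u x (frameVec x₀ x w) := fun x hx w =>
    fderiv_chartRep u.contMDiff u.tsupport_subset hus (hKs hx) w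
  have hd0 : ∀ x ∉ K, 𝓜.gradAbs u x = 0 := fun x hx => by
    have h1 : (u : 𝓜.M → ℝ) =ᶠ[𝓝 x] fun _ => 0 :=
      notMem_tsupport_iff_eventuallyEq.1 fun h => hx (hu h)
    have h2 : differential 𝓜.n u x = 0 := by
      rw [differential, h1.mfderiv_eq, mfderiv_const]
      rfl
    have h3 := dual_smul 𝓜.F x 0 0
    rw [zero_smul, abs_zero, zero_mul] at h3
    rw [CompactFMMM.gradAbs, h2, h3]
  have hL2 := hmeas (fun x => u x ^ 2) (fun z => f z ^ 2) (u.contMDiff.continuous.pow 2)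
    (hfs.continuous.pow 2) (fun x => sq_nonneg _) (fun z => sq_nonneg _)
    (fun x hx => hu (subset_tsupport _ fun h => hx (by simp [h])))
    (fun z hz => htf (subset_tsupport _ fun h => hz (by simp [h])))
  have heq : ∀ x ∈ K, f (extChartAt (𝓡∂ 𝓜.n) x₀ x) = u x := fun x hx => chartRep_apply x₀ u (hKs hx)
  have hfd0 : Function.support (fun z => ‖fderiv ℝ f z‖ ^ 2) ⊆ extChartAt (𝓡∂ 𝓜.n) x₀ '' K :=
    fun z hz => htf (support_fderiv_subset ℝ fun h => hz (by simp [h]))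
  have hG1 := (hmeas (fun x => 𝓜.gradAbs u x ^ 2) (fun z => a ^ 2 * ‖fderiv ℝ f z‖ ^ 2)
    ((continuous_gradAbs u).pow 2) ((continuous_norm_fderiv_sq hfs).const_mul _)
    (fun x => sq_nonneg _) (fun z => by positivity)
    (fun x hx => by
      by_contra h
      exact hx (by simp [hd0 x h]))
    (fun z hz => hfd0 (right_ne_zero_of_mul hz))).1 fun x hx => by
      rw [← mul_pow]
      exact pow_le_pow_left₀ (gradAbs_nonneg _ _) (hdual x hx _ _ (hfd x hx)).1 2
  have hG2 := (hmeas (fun x => a ^ 2 * 𝓜.gradAbs u x ^ 2) (fun z => ‖fderiv ℝ f z‖ ^ 2)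
    (((continuous_gradAbs u).pow 2).const_mul _) (continuous_norm_fderiv_sq hfs)
    (fun x => by positivity) (fun z => by positivity)
    (fun x hx => by
      by_contra h
      exact hx (by simp [hd0 x h])) hfd0).2 fun x hx => by
      rw [← mul_pow]
      exact pow_le_pow_left₀ (norm_nonneg _) (hdual x hx _ _ (hfd x hx)).2 2
  rw [integral_const_mul] at hG1 hG2
  have e1 : ∀ {p q : ℝ}, p ≤ b * q → √p ≤ C * √q := fun {p q} h =>
    (Real.sqrt_le_sqrt h).trans (by
      rw [Real.sqrt_mul hb.le]; exact mul_le_mul_of_nonneg_right hC1 (Real.sqrt_nonneg _))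
  have e2 : ∀ {p q : ℝ}, p ≤ b * (a ^ 2 * q) → √p ≤ C * √q := fun {p q} h =>
    (Real.sqrt_le_sqrt h).trans (by
      rw [Real.sqrt_mul hb.le, Real.sqrt_mul (sq_nonneg a), Real.sqrt_sq ha.le, ← mul_assoc,
        mul_comm √b a]
      exact mul_le_mul_of_nonneg_right hC2 (Real.sqrt_nonneg _))
  exact ⟨e1 (hL2.1 fun x hx => by rw [heq x hx]), e1 (hL2.2 fun x hx => by rw [heq x hx]),
    e2 hG1, e2 hG2⟩

/-- A finite smooth partition of unity subordinate to charts. -/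
theorem exists_partition (𝓜 : CompactFMMM.{u}) :
    ∃ (ι : Type u) (_ : Fintype ι) (c : ι → 𝓜.M) (χ : ι → 𝓜.M → ℝ),
      (∀ i, ContMDiff (𝓡∂ 𝓜.n) 𝓘(ℝ, ℝ) ∞ (χ i)) ∧
      (∀ i, tsupport (χ i) ⊆ (extChartAt (𝓡∂ 𝓜.n) (c i)).source) ∧ ∀ x, ∑ i, χ i x = 1 := by
  obtain ⟨t, -, ht⟩ := isCompact_univ.elim_nhds_subcover
    (fun x : 𝓜.M => (extChartAt (𝓡∂ 𝓜.n) x).source) fun x _ => extChartAt_source_mem_nhds x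
  obtain ⟨f, hf⟩ := SmoothPartitionOfUnity.exists_isSubordinate (𝓡∂ 𝓜.n) (s := (univ : Set 𝓜.M))
    isClosed_univ (fun i : t => (extChartAt (𝓡∂ 𝓜.n) i.1).source)
    (fun i => isOpen_extChartAt_source i.1) (fun x hx => by
      obtain ⟨y, hy, hxy⟩ := mem_iUnion₂.1 (ht hx)
      exact mem_iUnion.2 ⟨⟨y, hy⟩, hxy⟩)
  refine ⟨t, inferInstance, fun i => i.1, fun i => f i, fun i => (f i).contMDiff, hf, fun x => ?_⟩
  rw [← finsum_eq_sum_of_fintype]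
  exact f.sum_eq_one (mem_univ x)

theorem sum_mulTest {ι : Type u} [Fintype ι] {χ : ι → 𝓜.M → ℝ}
    (hχ : ∀ i, ContMDiff (𝓡∂ 𝓜.n) 𝓘(ℝ, ℝ) ∞ (χ i)) (h1 : ∀ x, ∑ i, χ i x = 1)
    (u : 𝓜.TestFunction) : ∑ i, mulTest (χ i) (hχ i) u = u := by
  apply Subtype.ext
  ext x
  have h2 : (∑ i, mulTest (χ i) (hχ i) u).1 = ∑ i, (mulTest (χ i) (hχ i) u).1 :=
    map_sum 𝓜.testSubmodule.subtype _ _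
  rw [h2, Finset.sum_apply]
  change ∑ i, χ i x * u x = u x
  rw [← Finset.sum_mul, h1, one_mul]

theorem testL2_sum_le {ι : Type u} (s : Finset ι) (u : ι → 𝓜.TestFunction) :
    𝓜.testL2 (∑ i ∈ s, u i) ≤ ∑ i ∈ s, 𝓜.testL2 (u i) :=
  Finset.le_sum_of_subadditive _ (by
    have h := 𝓜.testL2_smul 0 0
    rw [zero_smul, abs_zero, zero_mul] at h
    exact h.le) 𝓜.testL2_add _ _

theorem testGrad_sum_le {ι : Type u} (s : Finset ι) (u : ι → 𝓜.TestFunction) :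
    𝓜.testGrad (∑ i ∈ s, u i) ≤ ∑ i ∈ s, 𝓜.testGrad (u i) :=
  Finset.le_sum_of_subadditive _ (by
    have h := 𝓜.testGrad_smul 0 0
    rw [zero_smul, abs_zero, zero_mul] at h
    exact h.le) 𝓜.testGrad_add _ _

theorem tsupport_mulTest_subset (χ : 𝓜.M → ℝ) (hχ : ContMDiff (𝓡∂ 𝓜.n) 𝓘(ℝ, ℝ) ∞ χ)
    (u : 𝓜.TestFunction) : tsupport (mulTest χ hχ u : 𝓜.M → ℝ) ⊆ tsupport χ :=
  closure_mono (Function.support_mul_subset_left χ u)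

end Localization

/-! ### The two seminorms on the Sobolev space -/

section Seminorms

variable {𝓜 : CompactFMMM.{u}}

theorem continuous_normL2 : Continuous 𝓜.normL2 := UniformSpace.Completion.continuous_extension

theorem continuous_normGrad : Continuous 𝓜.normGrad :=
  UniformSpace.Completion.continuous_extension

theorem norm_sobolev (u : 𝓜.Sobolev) : ‖u‖ = 𝓜.normL2 u + 𝓜.normGrad u := by
  induction u using UniformSpace.Completion.induction_on with
  | hp => exact isClosed_eq continuous_norm (continuous_normL2.add continuous_normGrad)
  | ih u => rw [UniformSpace.Completion.norm_coe, 𝓜.normL2_coe, 𝓜.normGrad_coe,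
      𝓜.norm_testFunction]

theorem normL2_nonneg (u : 𝓜.Sobolev) : 0 ≤ 𝓜.normL2 u := by
  induction u using UniformSpace.Completion.induction_on with
  | hp => exact isClosed_le continuous_const continuous_normL2
  | ih u => rw [𝓜.normL2_coe]; exact testL2_nonneg u

theorem normGrad_nonneg (u : 𝓜.Sobolev) : 0 ≤ 𝓜.normGrad u := by
  induction u using UniformSpace.Completion.induction_on with
  | hp => exact isClosed_le continuous_const continuous_normGrad
  | ih u => rw [𝓜.normGrad_coe]; exact testGrad_nonneg u

theorem normL2_le_norm (u : 𝓜.Sobolev) : 𝓜.normL2 u ≤ ‖u‖ := by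
  rw [norm_sobolev]; linarith [normGrad_nonneg u]

theorem normGrad_le_norm (u : 𝓜.Sobolev) : 𝓜.normGrad u ≤ ‖u‖ := by
  rw [norm_sobolev]; linarith [normL2_nonneg u]

theorem normL2_smul (c : ℝ) (u : 𝓜.Sobolev) : 𝓜.normL2 (c • u) = |c| * 𝓜.normL2 u := by
  induction u using UniformSpace.Completion.induction_on with
  | hp =>
    exact isClosed_eq (continuous_normL2.comp (continuous_const_smul c))
      (continuous_normL2.const_mul _)
  | ih u => rw [← UniformSpace.Completion.coe_smul, 𝓜.normL2_coe, 𝓜.normL2_coe, 𝓜.testL2_smul]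

theorem normGrad_smul (c : ℝ) (u : 𝓜.Sobolev) : 𝓜.normGrad (c • u) = |c| * 𝓜.normGrad u := by
  induction u using UniformSpace.Completion.induction_on with
  | hp =>
    exact isClosed_eq (continuous_normGrad.comp (continuous_const_smul c))
      (continuous_normGrad.const_mul _)
  | ih u => rw [← UniformSpace.Completion.coe_smul, 𝓜.normGrad_coe, 𝓜.normGrad_coe,
      𝓜.testGrad_smul]

theorem normL2_add_le (u v : 𝓜.Sobolev) : 𝓜.normL2 (u + v) ≤ 𝓜.normL2 u + 𝓜.normL2 v := by
  induction u, v using UniformSpace.Completion.induction_on₂ with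
  | hp =>
    exact isClosed_le (continuous_normL2.comp continuous_add)
      ((continuous_normL2.comp continuous_fst).add (continuous_normL2.comp continuous_snd))
  | ih u v =>
    rw [← UniformSpace.Completion.coe_add, 𝓜.normL2_coe, 𝓜.normL2_coe, 𝓜.normL2_coe]
    exact 𝓜.testL2_add u v

theorem normGrad_add_le (u v : 𝓜.Sobolev) :
    𝓜.normGrad (u + v) ≤ 𝓜.normGrad u + 𝓜.normGrad v := by
  induction u, v using UniformSpace.Completion.induction_on₂ with
  | hp =>
    exact isClosed_le (continuous_normGrad.comp continuous_add)
      ((continuous_normGrad.comp continuous_fst).add (continuous_normGrad.comp continuous_snd))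
  | ih u v =>
    rw [← UniformSpace.Completion.coe_add, 𝓜.normGrad_coe, 𝓜.normGrad_coe, 𝓜.normGrad_coe]
    exact 𝓜.testGrad_add u v

theorem normL2_zero : 𝓜.normL2 0 = 0 := by simpa using normL2_smul 0 (0 : 𝓜.Sobolev)

theorem normGrad_neg (u : 𝓜.Sobolev) : 𝓜.normGrad (-u) = 𝓜.normGrad u := by
  simpa using normGrad_smul (-1) u

theorem energy_neg (u : 𝓜.Sobolev) : 𝓜.energy (-u) = 𝓜.energy u := by
  rw [CompactFMMM.energy, CompactFMMM.energy, normGrad_neg, 𝓜.normL2_neg]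

theorem exists_test_near (u : 𝓜.Sobolev) {δ : ℝ} (hδ : 0 < δ) :
    ∃ v : 𝓜.TestFunction, ‖u - (v : 𝓜.Sobolev)‖ < δ := by
  obtain ⟨v, hv⟩ := UniformSpace.Completion.denseRange_coe.exists_dist_lt u hδ
  exact ⟨v, by rwa [← dist_eq_norm]⟩

/-- A linear map on test functions that is bounded for the Sobolev norm extends to the Sobolev
space. -/
theorem exists_extension {G : Type*} [NormedAddCommGroup G] [NormedSpace ℝ G] [CompleteSpace G]
    (T : 𝓜.TestFunction →ₗ[ℝ] G) (C : ℝ) (hT : ∀ u, ‖T u‖ ≤ C * ‖u‖) :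
    ∃ T' : 𝓜.Sobolev →L[ℝ] G, ∀ u : 𝓜.TestFunction, T' u = T u := by
  refine ⟨(T.mkContinuous C hT).extend UniformSpace.Completion.toComplL, fun u => ?_⟩
  exact ContinuousLinearMap.extend_eq (T.mkContinuous C hT)
    (e := (UniformSpace.Completion.toComplL : 𝓜.TestFunction →L[ℝ] 𝓜.Sobolev))
    UniformSpace.Completion.denseRange_coe
    (UniformSpace.Completion.isUniformInducing_coe _) u

end Seminorms

/-! ### Closability of the gradient -/

section Closability

variable {𝓜 : CompactFMMM.{u}}

theorem sqrt_add_le_add {a b : ℝ} (ha : 0 ≤ a) (hb : 0 ≤ b) : √(a + b) ≤ √a + √b := by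
  rw [Real.sqrt_le_left (by positivity), add_sq, Real.sq_sqrt ha, Real.sq_sqrt hb]
  nlinarith [mul_nonneg (Real.sqrt_nonneg a) (Real.sqrt_nonneg b)]

theorem sqrt_sum_le {ι : Type*} (s : Finset ι) (a : ι → ℝ) (ha : ∀ i, 0 ≤ a i) :
    √(∑ i ∈ s, a i) ≤ ∑ i ∈ s, √(a i) := by
  classical
  induction s using Finset.induction_on with
  | empty => simp
  | insert i s hi ih =>
    rw [Finset.sum_insert hi, Finset.sum_insert hi]
    exact (sqrt_add_le_add (ha i) (Finset.sum_nonneg fun i _ => ha i)).trans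
      (add_le_add le_rfl ih)

theorem norm_sq_le_sum {n : ℕ} (L : EuclideanSpace ℝ (Fin n) →L[ℝ] ℝ) :
    ‖L‖ ^ 2 ≤ ∑ j, L (EuclideanSpace.single j 1) ^ 2 := by
  have h0 : 0 ≤ ∑ j, L (EuclideanSpace.single j 1) ^ 2 :=
    Finset.sum_nonneg fun j _ => sq_nonneg _
  rw [← Real.le_sqrt (norm_nonneg _) h0]
  refine L.opNorm_le_bound (Real.sqrt_nonneg _) fun v => ?_
  have h1 : L v = ∑ j, v j * L (EuclideanSpace.single j 1) := by
    conv_lhs => rw [← (EuclideanSpace.basisFun (Fin n) ℝ).sum_repr v]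
    simp [map_sum]
  have h2 := Finset.sum_mul_sq_le_sq_mul_sq Finset.univ (fun j => v j)
    fun j => L (EuclideanSpace.single j 1)
  rw [← h1] at h2
  rw [EuclideanSpace.norm_eq, ← Real.sqrt_mul h0, Real.norm_eq_abs]
  refine Real.abs_le_sqrt (h2.trans (le_of_eq ?_))
  simp [mul_comm]

section

variable {n : ℕ} {f : EuclideanSpace ℝ (Fin n) → ℝ} (hf : ContDiff ℝ ∞ f)
  (hfc : HasCompactSupport f)
include hf hfc

theorem integrable_norm_fderiv_sq : Integrable fun z => ‖fderiv ℝ f z‖ ^ 2 :=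
  ((hf.continuous_fderiv (by simp)).norm.pow 2).integrable_of_hasCompactSupport
    ((hfc.fderiv ℝ).mono fun z hz h => hz (by simp [h]))

theorem integrable_partial_sq (e : EuclideanSpace ℝ (Fin n)) :
    Integrable fun z => fderiv ℝ f z e ^ 2 :=
  (((hf.continuous_fderiv (by simp)).clm_apply
    continuous_const).pow 2).integrable_of_hasCompactSupport
    ((hfc.fderiv ℝ).mono fun z hz h => hz (by simp [h]))

theorem sqrt_integral_partial_le (j : Fin n) :
    √(∫ z, fderiv ℝ f z (EuclideanSpace.single j 1) ^ 2) ≤ √(∫ z, ‖fderiv ℝ f z‖ ^ 2) :=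
  Real.sqrt_le_sqrt (integral_mono (integrable_partial_sq hf hfc _)
    (integrable_norm_fderiv_sq hf hfc) fun z => by
      have h1 := (fderiv ℝ f z).le_opNorm (EuclideanSpace.single j 1)
      simp only [PiLp.norm_single, norm_one, mul_one] at h1
      exact sq_le_sq.2 (by simpa using h1))

theorem sqrt_integral_norm_fderiv_le :
    √(∫ z, ‖fderiv ℝ f z‖ ^ 2) ≤
      ∑ j, √(∫ z, fderiv ℝ f z (EuclideanSpace.single j 1) ^ 2) := by
  refine le_trans (Real.sqrt_le_sqrt ?_) (sqrt_sum_le Finset.univ _ fun j =>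
    integral_nonneg fun z => sq_nonneg _)
  rw [← integral_finsetSum _ fun j _ => integrable_partial_sq hf hfc _]
  exact integral_mono (integrable_norm_fderiv_sq hf hfc)
    (integrable_finsetSum _ fun j _ => integrable_partial_sq hf hfc _) fun z => norm_sq_le_sum _

end

/-- The expression of `χ u` in the chart around `x₀`, linear in `u`. -/
def localRep (x₀ : 𝓜.M) (χ : 𝓜.M → ℝ) (u : 𝓜.TestFunction) : EuclideanSpace ℝ (Fin 𝓜.n) → ℝ :=
  chartRep x₀ (χ * u)

theorem localRep_add (x₀ : 𝓜.M) (χ : 𝓜.M → ℝ) (u v : 𝓜.TestFunction) :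
    localRep x₀ χ (u + v) = localRep x₀ χ u + localRep x₀ χ v := by
  rw [localRep, localRep, localRep, ← chartRep_add, ← mul_add]; rfl

theorem localRep_smul (x₀ : 𝓜.M) (χ : 𝓜.M → ℝ) (c : ℝ) (u : 𝓜.TestFunction) :
    localRep x₀ χ (c • u) = c • localRep x₀ χ u := by
  rw [localRep, localRep, ← chartRep_smul, ← mul_smul_comm]; rfl

variable {x₀ : 𝓜.M} {χ : 𝓜.M → ℝ}

theorem localRep_sub (u v : 𝓜.TestFunction) :
    localRep x₀ χ (u - v) = localRep x₀ χ u - localRep x₀ χ v := by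
  have h := localRep_smul x₀ χ (-1) v
  rw [neg_one_smul, neg_one_smul] at h
  rw [sub_eq_add_neg, sub_eq_add_neg, localRep_add, h]

section

variable (hχ : ContMDiff (𝓡∂ 𝓜.n) 𝓘(ℝ, ℝ) ∞ χ)
  (hs : tsupport χ ⊆ (extChartAt (𝓡∂ 𝓜.n) x₀).source)
include hχ hs

theorem contDiff_localRep (u : 𝓜.TestFunction) : ContDiff ℝ ∞ (localRep x₀ χ u) :=
  contDiff_chartRep (mulTest χ hχ u).contMDiff (mulTest χ hχ u).tsupport_subset
    ((tsupport_mulTest_subset χ hχ u).trans hs)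

theorem tsupport_localRep_subset (u : 𝓜.TestFunction) :
    tsupport (localRep x₀ χ u) ⊆ extChartAt (𝓡∂ 𝓜.n) x₀ '' tsupport χ :=
  (tsupport_chartRep_subset ((tsupport_mulTest_subset χ hχ u).trans hs)).trans
    (image_mono (tsupport_mulTest_subset χ hχ u))

theorem hasCompactSupport_localRep (u : 𝓜.TestFunction) : HasCompactSupport (localRep x₀ χ u) :=
  hasCompactSupport_chartRep ((tsupport_mulTest_subset χ hχ u).trans hs)

theorem exists_localRep_bounds :
    ∃ C : ℝ, 0 < C ∧ ∀ u : 𝓜.TestFunction,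
      𝓜.testL2 (mulTest χ hχ u) ≤ C * √(∫ z, localRep x₀ χ u z ^ 2) ∧
      √(∫ z, localRep x₀ χ u z ^ 2) ≤ C * 𝓜.testL2 u ∧
      𝓜.testGrad (mulTest χ hχ u) ≤ C * √(∫ z, ‖fderiv ℝ (localRep x₀ χ u) z‖ ^ 2) ∧
      √(∫ z, ‖fderiv ℝ (localRep x₀ χ u) z‖ ^ 2) ≤ C * ‖u‖ := by
  obtain ⟨A, hA, h₁⟩ := exists_chart_bounds (isClosed_tsupport χ) hs
  obtain ⟨B, hB, h₂⟩ := exists_bound_mulTest χ hχ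
  have hAC : A ≤ A * (1 + B) := by nlinarith [mul_pos hA hB]
  have hBC : A * B ≤ A * (1 + B) := by nlinarith
  refine ⟨A * (1 + B), by positivity, fun u => ?_⟩
  obtain ⟨a, b, c, d⟩ := h₁ (mulTest χ hχ u) (tsupport_mulTest_subset χ hχ u)
  obtain ⟨e, f⟩ := h₂ u
  refine ⟨a.trans (mul_le_mul_of_nonneg_right hAC (Real.sqrt_nonneg _)), b.trans ?_,
    c.trans (mul_le_mul_of_nonneg_right hAC (Real.sqrt_nonneg _)), d.trans ?_⟩
  · refine (mul_le_mul_of_nonneg_left e hA.le).trans ?_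
    rw [← mul_assoc]
    exact mul_le_mul_of_nonneg_right hBC (testL2_nonneg u)
  · refine (mul_le_mul_of_nonneg_left f hA.le).trans ?_
    rw [← mul_assoc]
    exact mul_le_mul_of_nonneg_right hBC (norm_nonneg u)

/-- The `L²` norms of the partial derivatives of `χ u` in a chart control the gradient, and if `w`
is small in `L²`, each of them is controlled by the distance of `u` to `w`. -/
theorem exists_partial_bounds :
    ∃ C : ℝ, 0 < C ∧ ∀ u : 𝓜.TestFunction,
      𝓜.testGrad (mulTest χ hχ u) ≤ C * ∑ j, √(∫ z,
        fderiv ℝ (localRep x₀ χ u) z (EuclideanSpace.single j 1) ^ 2) ∧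
      ∀ j, ∃ D : ℝ, ∀ w : 𝓜.TestFunction,
          (∫ z, fderiv ℝ (localRep x₀ χ u) z (EuclideanSpace.single j 1) ^ 2) ≤
          √(∫ z, fderiv ℝ (localRep x₀ χ u) z (EuclideanSpace.single j 1) ^ 2) * (C * ‖u - w‖) +
          D * 𝓜.testL2 w := by
  obtain ⟨C, hC, h⟩ := exists_localRep_bounds hχ hs
  have hsm := contDiff_localRep hχ hs
  have hsu := hasCompactSupport_localRep hχ hs
  refine ⟨C, hC, fun u => ⟨(h u).2.2.1.trans (mul_le_mul_of_nonneg_left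
    (sqrt_integral_norm_fderiv_le (hsm u) (hsu u)) hC.le), fun j => ?_⟩⟩
  obtain ⟨D, hD⟩ := exists_integral_sq_fderiv_le (hsm u) (hsu u) (EuclideanSpace.single j 1)
  refine ⟨|D| * C, fun w => (hD _ (hsm w) (hsu w)).trans (add_le_add ?_ ?_)⟩
  · refine mul_le_mul_of_nonneg_left ?_ (Real.sqrt_nonneg _)
    refine le_trans (le_of_eq ?_) ((sqrt_integral_partial_le (hsm (u - w)) (hsu (u - w)) j).trans
      (h (u - w)).2.2.2)
    have h1 : ∀ z, fderiv ℝ (localRep x₀ χ (u - w)) z =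
        fderiv ℝ (localRep x₀ χ u) z - fderiv ℝ (localRep x₀ χ w) z := fun z => by
      rw [localRep_sub]
      exact fderiv_sub ((hsm u).differentiable (by simp) z) ((hsm w).differentiable (by simp) z)
    simp only [h1, sub_apply]
  · rw [mul_assoc]
    exact mul_le_mul (le_abs_self D) (h w).2.1 (Real.sqrt_nonneg _) (abs_nonneg D)

end

/-- The gradient is closable: an element `U` of the Sobolev space with vanishing `L²` norm
vanishes. A test function `u` near `U` is compared with test functions `w` that are still nearer
to `U` and therefore arbitrarily small in `L²`. -/
theorem eq_zero_of_normL2_eq_zero {U : 𝓜.Sobolev} (hU : 𝓜.normL2 U = 0) : U = 0 := by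
  obtain ⟨ι, _, c, χ, hχ, hs, h1⟩ := exists_partition 𝓜
  choose C hC hb using fun i => exists_partial_bounds (hχ i) (hs i)
  set A : ℝ := ∑ i, C i * (𝓜.n * C i) with hA
  have hA0 : 0 ≤ A := Finset.sum_nonneg fun i _ => by have := hC i; positivity
  have key : ∀ δ : ℝ, 0 < δ → 𝓜.normGrad U ≤ (A + 1) * δ := by
    intro δ hδ
    obtain ⟨u, hu⟩ := exists_test_near U hδ
    have hq : ∀ i j, √(∫ z, fderiv ℝ (localRep (c i) (χ i) u) z (EuclideanSpace.single j 1) ^ 2) ≤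
        C i * δ := by
      intro i j
      obtain ⟨D, hD⟩ := (hb i u).2 j
      set q := √(∫ z, fderiv ℝ (localRep (c i) (χ i) u) z (EuclideanSpace.single j 1) ^ 2) with hq
      have hq0 : 0 ≤ q := Real.sqrt_nonneg _
      have hqq : (∫ z, fderiv ℝ (localRep (c i) (χ i) u) z (EuclideanSpace.single j 1) ^ 2) =
          q * q := (Real.mul_self_sqrt (integral_nonneg fun z => sq_nonneg _)).symm
      rw [hqq] at hD
      have hle : ∀ η : ℝ, 0 < η → q * q ≤ q * (C i * δ) + (q * C i + |D|) * η := by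
        intro η hη
        obtain ⟨w, hw⟩ := exists_test_near U hη
        have h2 : ‖u - w‖ ≤ δ + η := by
          rw [← UniformSpace.Completion.norm_coe, UniformSpace.Completion.coe_sub]
          have h3 : ((u : 𝓜.Sobolev) - w) = (U - w) - (U - u) := by abel
          rw [h3]
          linarith [norm_sub_le (U - (w : 𝓜.Sobolev)) (U - u)]
        have h4 : 𝓜.testL2 w ≤ η := by
          rw [← 𝓜.normL2_coe]
          have h5 := normL2_add_le U (-(U - w))
          rw [𝓜.normL2_neg, hU, neg_sub, add_sub_cancel] at h5
          linarith [normL2_le_norm (U - (w : 𝓜.Sobolev))]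
        have h6 := mul_le_mul_of_nonneg_left h2 (mul_nonneg hq0 (hC i).le)
        have h7 : D * 𝓜.testL2 w ≤ |D| * η :=
          mul_le_mul (le_abs_self D) h4 (testL2_nonneg w) (abs_nonneg D)
        have h8 := hD w
        nlinarith
      have hqle : q * q ≤ q * (C i * δ) := by
        refine le_of_forall_pos_le_add fun ε hε => ?_
        have hE : 0 < q * C i + |D| + 1 := by have := hC i; positivity
        refine (hle (ε / (q * C i + |D| + 1)) (by positivity)).trans ?_
        gcongr
        rw [mul_div_assoc', div_le_iff₀ hE]
        nlinarith
      rcases hq0.eq_or_lt with h0 | h0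
      · rw [← h0]; have := hC i; positivity
      · exact le_of_mul_le_mul_left hqle h0
    have hgu : 𝓜.testGrad u ≤ A * δ := by
      calc 𝓜.testGrad u = 𝓜.testGrad (∑ i, mulTest (χ i) (hχ i) u) := by rw [sum_mulTest hχ h1]
        _ ≤ ∑ i, 𝓜.testGrad (mulTest (χ i) (hχ i) u) := testGrad_sum_le _ _
        _ ≤ ∑ i, C i * (∑ _j : Fin 𝓜.n, C i * δ) := Finset.sum_le_sum fun i _ =>
            (hb i u).1.trans (mul_le_mul_of_nonneg_left
              (Finset.sum_le_sum fun j _ => hq i j) (hC i).le)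
        _ = A * δ := by
            rw [hA, Finset.sum_mul]
            refine Finset.sum_congr rfl fun i _ => ?_
            simp
            ring
    have h2 := normGrad_add_le (u : 𝓜.Sobolev) (U - u)
    rw [add_sub_cancel, 𝓜.normGrad_coe] at h2
    have h3 := normGrad_le_norm (U - (u : 𝓜.Sobolev))
    linarith
  have h0 : 𝓜.normGrad U ≤ 0 := by
    refine le_of_forall_pos_le_add fun ε hε => ?_
    refine (key (ε / (A + 1)) (by positivity)).trans (le_of_eq ?_)
    rw [zero_add]
    exact mul_div_cancel₀ _ (by positivity)
  rw [← norm_le_zero_iff, norm_sobolev, hU]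
  linarith

theorem normL2_pos {u : 𝓜.Sobolev} (hu : u ≠ 0) : 0 < 𝓜.normL2 u :=
  lt_of_le_of_ne (normL2_nonneg u) fun h => hu (eq_zero_of_normL2_eq_zero h.symm)

end Closability

/-! ### Compactness of the embedding into `L²` -/

section Compactness

variable {𝓜 : CompactFMMM.{u}}

theorem abs_setIntegral_ball_le {n : ℕ} {f : EuclideanSpace ℝ (Fin n) → ℝ} (hf : Continuous f)
    (hfc : HasCompactSupport f) (z : EuclideanSpace ℝ (Fin n)) (r : ℝ) :
    |∫ y in Metric.ball z r, f y| ≤ √(volume.real (Metric.ball z r)) * √(∫ y, f y ^ 2) := by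
  have hfin : IsFiniteMeasure (volume.restrict (Metric.ball z r)) :=
    ⟨by rw [Measure.restrict_apply_univ]; exact measure_ball_lt_top⟩
  have h1 := sq_integral_le (memLp_two_restrict (μ := volume) hf
    (Metric.isBounded_ball (x := z) (r := r)))
  have h3 : Integrable fun y => f y ^ 2 := (hf.pow 2).integrable_of_hasCompactSupport
    (hfc.mono fun y hy h => hy (by simp [h]))
  have h2 : (∫ y in Metric.ball z r, f y ^ 2) ≤ ∫ y, f y ^ 2 :=
    setIntegral_le_integral h3 (Filter.Eventually.of_forall fun y => sq_nonneg _)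
  rw [measureReal_restrict_apply_univ] at h1
  rw [← Real.sqrt_mul measureReal_nonneg]
  exact Real.abs_le_sqrt (h1.trans (mul_le_mul_of_nonneg_left h2 measureReal_nonneg))

/-- The functionals are means over small coordinate balls of the expression of `χ u` in a chart. -/
theorem exists_local_functionals {x₀ : 𝓜.M} {χ : 𝓜.M → ℝ}
    (hχ : ContMDiff (𝓡∂ 𝓜.n) 𝓘(ℝ, ℝ) ∞ χ)
    (hs : tsupport χ ⊆ (extChartAt (𝓡∂ 𝓜.n) x₀).source) {ε : ℝ} (hε : 0 < ε) :
    ∃ (t : Finset (EuclideanSpace ℝ (Fin 𝓜.n)))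
      (l : EuclideanSpace ℝ (Fin 𝓜.n) → 𝓜.Sobolev →L[ℝ] ℝ),
      ∀ u : 𝓜.TestFunction, 𝓜.testL2 (mulTest χ hχ u) ≤ ε * ‖u‖ + ∑ z ∈ t, |l z u| := by
  obtain ⟨C, hC, h⟩ := exists_localRep_bounds hχ hs
  obtain ⟨t, r, D, hD, ht⟩ := exists_averages
    (isCompact_image_extChartAt (isClosed_tsupport χ).isCompact hs)
    (ε := (ε / (C * C)) ^ 2) (by positivity)
  have hcont : ∀ u : 𝓜.TestFunction, Continuous (localRep x₀ χ u) := fun u =>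
    (contDiff_localRep hχ hs u).continuous
  have hint : ∀ (z) (u : 𝓜.TestFunction),
      Integrable (localRep x₀ χ u) (volume.restrict (Metric.ball z r)) := fun z u =>
    ((hcont u).integrable_of_hasCompactSupport (hasCompactSupport_localRep hχ hs u)).restrict
  let T : EuclideanSpace ℝ (Fin 𝓜.n) → 𝓜.TestFunction →ₗ[ℝ] ℝ := fun z =>
    { toFun := fun u => C * √D * ∫ y in Metric.ball z r, localRep x₀ χ u y
      map_add' := fun u v => by
        rw [localRep_add, ← mul_add, ← integral_add (hint z u) (hint z v)]
        rfl
      map_smul' := fun a u => by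
        rw [localRep_smul]
        simp only [Pi.smul_apply, smul_eq_mul, integral_const_mul, RingHom.id_apply]
        ring }
  have hT : ∀ z u, ‖T z u‖ ≤ C * √D * √(volume.real (Metric.ball z r)) * C * ‖u‖ := by
    intro z u
    change |C * √D * _| ≤ _
    rw [abs_mul, abs_of_nonneg (show 0 ≤ C * √D by positivity),
      show C * √D * √(volume.real (Metric.ball z r)) * C * ‖u‖ =
        C * √D * (√(volume.real (Metric.ball z r)) * (C * ‖u‖)) by ring]
    refine mul_le_mul_of_nonneg_left ?_ (by positivity)
    exact (abs_setIntegral_ball_le (hcont u) (hasCompactSupport_localRep hχ hs u) z r).trans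
      (mul_le_mul_of_nonneg_left ((h u).2.1.trans
        (mul_le_mul_of_nonneg_left (testL2_le_norm u) hC.le)) (Real.sqrt_nonneg _))
  choose l hl using fun z => exists_extension (T z) _ (hT z)
  refine ⟨t, l, fun u => (h u).1.trans ?_⟩
  have h1 := ht _ ((contDiff_localRep hχ hs u).of_le (by simp)) (tsupport_localRep_subset hχ hs u)
  have h2 := (Real.sqrt_le_sqrt h1).trans (sqrt_add_le_add (by positivity)
    (mul_nonneg hD (Finset.sum_nonneg fun _ _ => sq_nonneg _)))
  rw [Real.sqrt_mul (by positivity), Real.sqrt_sq (by positivity), Real.sqrt_mul hD] at h2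
  have h3 := sqrt_sum_le t (fun z => (∫ y in Metric.ball z r, localRep x₀ χ u y) ^ 2)
    fun z => sq_nonneg _
  simp only [Real.sqrt_sq_eq_abs] at h3
  have h4 : ∑ z ∈ t, |l z u| =
      C * √D * ∑ z ∈ t, |∫ y in Metric.ball z r, localRep x₀ χ u y| := by
    rw [Finset.mul_sum]
    refine Finset.sum_congr rfl fun z _ => ?_
    rw [hl]
    change |C * √D * _| = _
    rw [abs_mul, abs_of_nonneg (show 0 ≤ C * √D by positivity)]
  rw [h4]
  calc C * √(∫ z, localRep x₀ χ u z ^ 2)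
      ≤ C * (ε / (C * C) * (C * ‖u‖) +
        √D * ∑ z ∈ t, |∫ y in Metric.ball z r, localRep x₀ χ u y|) := by
        refine mul_le_mul_of_nonneg_left (h2.trans (add_le_add ?_ ?_)) hC.le
        · exact mul_le_mul_of_nonneg_left (h u).2.2.2 (by positivity)
        · exact mul_le_mul_of_nonneg_left h3 (Real.sqrt_nonneg _)
    _ = _ := by field_simp

/-- Rellich's theorem in quantitative form: up to an arbitrarily small multiple of the Sobolev
norm, the `L²` norm is controlled by finitely many continuous linear functionals. -/
theorem exists_functionals (𝓜 : CompactFMMM.{u}) {ε : ℝ} (hε : 0 < ε) :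
    ∃ (κ : Type u) (_ : Fintype κ) (l : κ → 𝓜.Sobolev →L[ℝ] ℝ),
      ∀ u : 𝓜.Sobolev, 𝓜.normL2 u ≤ ε * ‖u‖ + ∑ k, |l k u| := by
  obtain ⟨ι, _, c, χ, hχ, hs, h1⟩ := exists_partition 𝓜
  have hN : (0 : ℝ) < Fintype.card ι + 1 := by positivity
  choose t l hl using fun i => exists_local_functionals (hχ i) (hs i)
    (ε := ε / (Fintype.card ι + 1)) (by positivity)
  refine ⟨Σ i, ULift.{u} (t i), inferInstance, fun k => l k.1 k.2.down, fun u => ?_⟩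
  induction u using UniformSpace.Completion.induction_on with
  | hp =>
    exact isClosed_le continuous_normL2 ((continuous_const.mul continuous_norm).add
      (continuous_finsetSum _ fun k _ => (l k.1 k.2.down).continuous.abs))
  | ih u =>
    rw [UniformSpace.Completion.norm_coe, 𝓜.normL2_coe, Fintype.sum_sigma]
    calc 𝓜.testL2 u = 𝓜.testL2 (∑ i, mulTest (χ i) (hχ i) u) := by rw [sum_mulTest hχ h1]
      _ ≤ ∑ i, 𝓜.testL2 (mulTest (χ i) (hχ i) u) := testL2_sum_le _ _
      _ ≤ ∑ i, (ε / (Fintype.card ι + 1) * ‖u‖ + ∑ z ∈ t i, |l i z u|) :=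
          Finset.sum_le_sum fun i _ => hl i u
      _ ≤ ε * ‖u‖ + ∑ i, ∑ z ∈ t i, |l i z u| := by
          rw [Finset.sum_add_distrib]
          refine add_le_add ?_ le_rfl
          rw [Finset.sum_const, nsmul_eq_mul, Finset.card_univ, ← mul_assoc]
          refine mul_le_mul_of_nonneg_right ?_ (norm_nonneg u)
          rw [mul_div_assoc', div_le_iff₀ hN]
          nlinarith
      _ = _ := by
          congr 1
          refine Finset.sum_congr rfl fun i _ => ?_
          rw [← Finset.sum_coe_sort (t i) fun z => |l i z u|]
          exact (Equiv.sum_comp Equiv.ulift fun z : t i => |l i z u|).symm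

end Compactness

/-! ### Elements of the Sobolev space as square integrable functions -/

section L2

variable {𝓜 : CompactFMMM.{u}}

/-- The class in `L²` of a test function. -/
def testToLp (𝓜 : CompactFMMM.{u}) : 𝓜.TestFunction →ₗ[ℝ] Lp ℝ 2 𝓜.m where
  toFun u := (𝓜.memLp_of_continuous u.contMDiff.continuous).toLp u
  map_add' _ _ := rfl
  map_smul' _ _ := rfl

theorem norm_testToLp (u : 𝓜.TestFunction) : ‖testToLp 𝓜 u‖ = 𝓜.testL2 u := by
  have h := 𝓜.memLp_of_continuous u.contMDiff.continuous
  exact (Lp.norm_toLp _ h).trans (sqrt_integral_sq h).symm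

/-- The continuous linear map from the Sobolev space to `L²`. -/
def toL2 (𝓜 : CompactFMMM.{u}) : 𝓜.Sobolev →L[ℝ] Lp ℝ 2 𝓜.m :=
  (exists_extension (testToLp 𝓜) 1 fun u => by
    rw [norm_testToLp, one_mul]; exact testL2_le_norm u).choose

theorem toL2_coe (u : 𝓜.TestFunction) : toL2 𝓜 u = testToLp 𝓜 u :=
  (exists_extension (testToLp 𝓜) 1 fun u => by
    rw [norm_testToLp, one_mul]; exact testL2_le_norm u).choose_spec u

theorem coeFn_toL2_coe (u : 𝓜.TestFunction) : toL2 𝓜 u =ᵐ[𝓜.m] u := by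
  rw [toL2_coe]
  exact (𝓜.memLp_of_continuous u.contMDiff.continuous).coeFn_toLp

theorem norm_toL2 (u : 𝓜.Sobolev) : ‖toL2 𝓜 u‖ = 𝓜.normL2 u := by
  induction u using UniformSpace.Completion.induction_on with
  | hp => exact isClosed_eq (toL2 𝓜).continuous.norm continuous_normL2
  | ih u => rw [toL2_coe, norm_testToLp, 𝓜.normL2_coe]

theorem eq_zero_of_toL2 {u : 𝓜.Sobolev} (h : toL2 𝓜 u =ᵐ[𝓜.m] 0) : u = 0 := by
  refine eq_zero_of_normL2_eq_zero ?_
  rw [← norm_toL2, norm_eq_zero]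
  exact (Lp.eq_zero_iff_ae_eq_zero).2 h

/-- A smooth function acts on the Sobolev space by multiplication. -/
theorem exists_mulSobolev (φ : 𝓜.M → ℝ) (hφ : ContMDiff (𝓡∂ 𝓜.n) 𝓘(ℝ, ℝ) ∞ φ) :
    ∃ T : 𝓜.Sobolev →L[ℝ] 𝓜.Sobolev, ∀ u,
      toL2 𝓜 (T u) =ᵐ[𝓜.m] fun x => φ x * toL2 𝓜 u x := by
  obtain ⟨C, hC, h⟩ := exists_bound_mulTest φ hφ
  obtain ⟨T, hT⟩ := exists_extension
    ((UniformSpace.Completion.toComplL (𝕜 := ℝ) (E := 𝓜.TestFunction)).toLinearMap ∘ₗ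
      mulTest φ hφ) (C + C) fun u => by
      change ‖((mulTest φ hφ u : 𝓜.TestFunction) : 𝓜.Sobolev)‖ ≤ _
      rw [UniformSpace.Completion.norm_coe, 𝓜.norm_testFunction (mulTest φ hφ u), add_mul]
      exact add_le_add ((h u).1.trans (mul_le_mul_of_nonneg_left (testL2_le_norm u) hC.le)) (h u).2
  refine ⟨T, fun u => ?_⟩
  obtain ⟨D, hD⟩ := isCompact_univ.exists_bound_of_continuousOn hφ.continuous.continuousOn
  have hmem : MemLp φ ∞ 𝓜.m := memLp_top_of_bound
    hφ.continuous.measurable.aestronglyMeasurable D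
    (Filter.Eventually.of_forall fun x => hD x (mem_univ x))
  let P : Lp ℝ 2 𝓜.m →L[ℝ] Lp ℝ 2 𝓜.m :=
    ContinuousLinearMap.holderL 𝓜.m ∞ 2 2 (ContinuousLinearMap.mul ℝ ℝ) hmem.toLp
  have hP : ∀ g : Lp ℝ 2 𝓜.m, P g =ᵐ[𝓜.m] fun x => φ x * g x := fun g => by
    filter_upwards [ContinuousLinearMap.coeFn_holder (r := 2) (ContinuousLinearMap.mul ℝ ℝ)
      hmem.toLp g, hmem.coeFn_toLp] with x hx hx'
    rw [← hx']
    exact hx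
  have key : toL2 𝓜 (T u) = P (toL2 𝓜 u) := by
    induction u using UniformSpace.Completion.induction_on with
    | hp => exact isClosed_eq ((toL2 𝓜).comp T).continuous (P.comp (toL2 𝓜)).continuous
    | ih u =>
      rw [hT]
      change toL2 𝓜 ((mulTest φ hφ u : 𝓜.TestFunction) : 𝓜.Sobolev) = _
      refine Lp.ext ?_
      filter_upwards [coeFn_toL2_coe (mulTest φ hφ u), hP (toL2 𝓜 u), coeFn_toL2_coe u]
        with x h1 h2 h3
      rw [h1, h2, h3]
      rfl
  rw [key]
  exact hP _

end L2

/-! ### A multiplication operator that is injective but not surjective -/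

section Multiplier

variable {n : ℕ} [NeZero n] {M : Type*} [TopologicalSpace M]
    [ChartedSpace (EuclideanHalfSpace n) M]

theorem interior_nonempty [IsManifold (𝓡∂ n) ∞ M] [Nonempty M] :
    ((𝓡∂ n).interior M).Nonempty := by
  obtain ⟨x⟩ := ‹Nonempty M›
  obtain ⟨δ, hδ, hball⟩ := Metric.mem_nhdsWithin_iff.1
    (extChartAt_target_mem_nhdsWithin (I := 𝓡∂ n) x)
  set z₁ := extChartAt (𝓡∂ n) x x with hz₁
  set z : EuclideanSpace ℝ (Fin n) := z₁ + EuclideanSpace.single 0 (δ / 2) with hz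
  have h1 : 0 ≤ z₁ 0 := by
    have : z₁ ∈ range (𝓡∂ n) := extChartAt_target_subset_range x (mem_extChartAt_target x)
    rwa [range_modelWithCornersEuclideanHalfSpace] at this
  have hzpos : 0 < z 0 := by
    have : z 0 = z₁ 0 + δ / 2 := by simp [hz]
    rw [this]; positivity
  have hzball : z ∈ Metric.ball z₁ δ := by
    rw [Metric.mem_ball, dist_eq_norm, hz, add_sub_cancel_left, PiLp.norm_single,
      Real.norm_eq_abs, abs_of_pos (by positivity)]
    linarith
  have hopen : IsOpen {y : EuclideanSpace ℝ (Fin n) | 0 < y 0} :=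
    isOpen_lt continuous_const (by fun_prop)
  have hsub : Metric.ball z₁ δ ∩ {y | 0 < y 0} ⊆ (extChartAt (𝓡∂ n) x).target := fun y hy =>
    hball ⟨hy.1, by
      rw [range_modelWithCornersEuclideanHalfSpace]
      exact (le_of_lt hy.2 : (0 : ℝ) ≤ y 0)⟩
  have hzi : z ∈ interior (extChartAt (𝓡∂ n) x).target :=
    interior_maximal hsub (Metric.isOpen_ball.inter hopen) ⟨hzball, hzpos⟩
  have hzt := interior_subset hzi
  refine ⟨(extChartAt (𝓡∂ n) x).symm z, ((𝓡∂ n).isInteriorPoint_iff_of_mem_atlas (n := ∞)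
    (by simp) (chart_mem_atlas _ x) ?_).2 ?_⟩
  · rw [← extChartAt_source (I := 𝓡∂ n)]
    exact (extChartAt (𝓡∂ n) x).map_target hzt
  · change extChartAt (𝓡∂ n) x _ ∈ interior (extChartAt (𝓡∂ n) x).target
    rwa [(extChartAt (𝓡∂ n) x).right_inv hzt]

variable [MeasurableSpace M] [BorelSpace M]

theorem IsSmoothMeasure.measure_singleton [T1Space M] {m : Measure M}
    (hm : IsSmoothMeasure n m) (x₀ : M) :
    m {x₀} = 0 := by
  obtain ⟨σ, hσ, -, hd⟩ := hm x₀
  set z₀ := extChartAt (𝓡∂ n) x₀ x₀ with hz₀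
  have h := hd.lintegral_eq hσ.continuousOn (G := indicator {z₀} 1)
    (measurable_one.indicator (measurableSet_singleton z₀))
  have h0 : ∫⁻ z in (extChartAt (𝓡∂ n) x₀).target,
      ENNReal.ofReal (σ z) * indicator {z₀} 1 z = 0 := by
    refine (lintegral_congr_ae (ae_restrict_of_ae ?_)).trans lintegral_zero
    have h1 : ∀ᵐ z : EuclideanSpace ℝ (Fin n), z ∉ ({z₀} : Set _) :=
      measure_eq_zero_iff_ae_notMem.1 (MeasureTheory.measure_singleton z₀)
    filter_upwards [h1] with z hz
    rw [indicator_of_notMem hz, mul_zero]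
  rw [h0] at h
  refine le_antisymm ?_ (zero_le)
  rw [← h, ← setLIntegral_one]
  have hx : x₀ ∈ (extChartAt (𝓡∂ n) x₀).source := mem_extChartAt_source x₀
  calc ∫⁻ _ in {x₀}, (1 : ℝ≥0∞) ∂m
      ≤ ∫⁻ x in {x₀}, indicator {z₀} 1 (extChartAt (𝓡∂ n) x₀ x) ∂m :=
        setLIntegral_mono_ae' (isClosed_singleton.measurableSet)
          (Filter.Eventually.of_forall fun x hx' => by
          rw [mem_singleton_iff.1 hx', indicator_of_mem (mem_singleton_iff.2 hz₀.symm)]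
          rfl)
    _ ≤ _ := lintegral_mono_set (singleton_subset_iff.2 hx)

/-- Lower bound for the measure of small coordinate balls around an interior point. -/
theorem IsSmoothMeasure.exists_le_measure_ball [IsManifold (𝓡∂ n) ∞ M] {m : Measure M}
    (hm : IsSmoothMeasure n m) {x₀ : M} (hx₀ : x₀ ∈ (𝓡∂ n).interior M) :
    ∃ c R : ℝ, 0 < c ∧ 0 < R ∧ ∀ r, 0 < r → r ≤ R → ENNReal.ofReal (c * r ^ n) ≤
      m ((extChartAt (𝓡∂ n) x₀).source ∩
        extChartAt (𝓡∂ n) x₀ ⁻¹' Metric.ball (extChartAt (𝓡∂ n) x₀ x₀) r) := by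
  obtain ⟨σ, hσ, hσ0, hd⟩ := hm x₀
  set z₀ := extChartAt (𝓡∂ n) x₀ x₀ with hz₀
  have hT : (extChartAt (𝓡∂ n) x₀).target ∈ 𝓝 z₀ :=
    target_mem_nhds_of_interior (mem_extChartAt_source x₀) hx₀
  have hpos : 0 < σ z₀ := hσ0 z₀ (mem_extChartAt_target x₀)
  have hev : ∀ᶠ z in 𝓝 z₀, σ z₀ / 2 < σ z :=
    (hσ.continuousOn.continuousAt hT).eventually (lt_mem_nhds (by linarith))
  obtain ⟨R, hR, hball⟩ := Metric.mem_nhds_iff.1 (Filter.inter_mem hT hev)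
  have hb1 : 0 < volume (Metric.ball (0 : EuclideanSpace ℝ (Fin n)) 1) :=
    Metric.measure_ball_pos _ _ one_pos
  have hb2 : volume (Metric.ball (0 : EuclideanSpace ℝ (Fin n)) 1) ≠ ⊤ := measure_ball_lt_top.ne
  set b := (volume (Metric.ball (0 : EuclideanSpace ℝ (Fin n)) 1)).toReal with hb
  have hb0 : 0 < b := ENNReal.toReal_pos hb1.ne' hb2
  refine ⟨σ z₀ / 2 * b, R, by positivity, hR, fun r hr hrR => ?_⟩
  have h := hd.lintegral_eq hσ.continuousOn (G := indicator (Metric.ball z₀ r) 1)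
    (measurable_one.indicator measurableSet_ball)
  have hsub : Metric.ball z₀ r ⊆ (extChartAt (𝓡∂ n) x₀).target ∩ {z | σ z₀ / 2 < σ z} :=
    (Metric.ball_subset_ball hrR).trans hball
  have hlow : ENNReal.ofReal (σ z₀ / 2 * b * r ^ n) ≤ ∫⁻ z in (extChartAt (𝓡∂ n) x₀).target,
      ENNReal.ofReal (σ z) * indicator (Metric.ball z₀ r) 1 z := by
    calc ENNReal.ofReal (σ z₀ / 2 * b * r ^ n)
        = ENNReal.ofReal (σ z₀ / 2) * volume (Metric.ball z₀ r) := by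
          rw [Measure.addHaar_ball _ _ hr.le, finrank_euclideanSpace_fin, mul_assoc,
            ENNReal.ofReal_mul (by positivity), mul_comm b, ENNReal.ofReal_mul (by positivity),
            hb, ENNReal.ofReal_toReal hb2]
      _ = ∫⁻ z in Metric.ball z₀ r, ENNReal.ofReal (σ z₀ / 2) := by
          rw [setLIntegral_const]
      _ ≤ ∫⁻ z in Metric.ball z₀ r, ENNReal.ofReal (σ z) * indicator (Metric.ball z₀ r) 1 z :=
          setLIntegral_mono_ae' measurableSet_ball (Filter.Eventually.of_forall fun z hz => by
            rw [indicator_of_mem hz, Pi.one_apply, mul_one]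
            exact ENNReal.ofReal_le_ofReal (hsub hz).2.le)
      _ ≤ _ := lintegral_mono_set fun z hz => (hsub hz).1
  rw [← h] at hlow
  refine hlow.trans ?_
  have hset : MeasurableSet ((extChartAt (𝓡∂ n) x₀).source ∩
      extChartAt (𝓡∂ n) x₀ ⁻¹' Metric.ball z₀ r) :=
    (isOpen_extChartAt_preimage' x₀ Metric.isOpen_ball).measurableSet
  rw [← setLIntegral_one, ← lintegral_indicator (isOpen_extChartAt_source x₀).measurableSet,
    ← lintegral_indicator hset]
  refine lintegral_mono fun x => ?_
  by_cases hx : x ∈ (extChartAt (𝓡∂ n) x₀).source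
  · by_cases hx' : extChartAt (𝓡∂ n) x₀ x ∈ Metric.ball z₀ r
    · rw [indicator_of_mem hx, indicator_of_mem hx', indicator_of_mem (mem_inter hx hx')]
      rfl
    · rw [indicator_of_mem hx, indicator_of_notMem hx']
      exact zero_le
  · rw [indicator_of_notMem hx]
    exact zero_le

end Multiplier

section Contractible

variable {𝓜 : CompactFMMM.{u}}

/-- There are a smooth function `φ ≥ 0` with a single zero, of high order, and a test function `e`
that is not of the form `φ v` with `v ∈ L²`. -/
theorem exists_multiplier (𝓜 : CompactFMMM.{u}) :
    ∃ φ : 𝓜.M → ℝ, ContMDiff (𝓡∂ 𝓜.n) 𝓘(ℝ, ℝ) ∞ φ ∧ (∀ᵐ x ∂𝓜.m, 0 < φ x) ∧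
      ∃ e : 𝓜.TestFunction, ∀ v : 𝓜.M → ℝ, MemLp v 2 𝓜.m → ¬ e =ᵐ[𝓜.m] fun x => φ x * v x := by
  obtain ⟨x₀, hx₀⟩ := interior_nonempty (n := 𝓜.n) (M := 𝓜.M)
  have hio : (𝓡∂ 𝓜.n).interior 𝓜.M ∈ 𝓝 x₀ :=
    ((𝓡∂ 𝓜.n).isOpen_interior (n := ∞) (by simp)).mem_nhds hx₀
  obtain ⟨b, -, hb⟩ := (SmoothBumpFunction.nhds_basis_tsupport (I := 𝓡∂ 𝓜.n) x₀).mem_iff.1 hio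
  set z₀ := extChartAt (𝓡∂ 𝓜.n) x₀ x₀ with hz₀
  have hn : 1 ≤ 𝓜.n := NeZero.one_le
  have hsm1 : ContMDiffOn (𝓡∂ 𝓜.n) 𝓘(ℝ, ℝ) ∞
      (fun x => (‖extChartAt (𝓡∂ 𝓜.n) x₀ x - z₀‖ ^ 2) ^ 𝓜.n)
        (chartAt (EuclideanHalfSpace 𝓜.n) x₀).source := by
    have h1 : ContDiff ℝ ∞ fun z : EuclideanSpace ℝ (Fin 𝓜.n) => (‖z - z₀‖ ^ 2) ^ 𝓜.n :=
      ((contDiff_id.sub contDiff_const).norm_sq ℝ).pow 𝓜.n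
    exact h1.contMDiff.comp_contMDiffOn (contMDiffOn_extChartAt (n := ∞))
  set φ : 𝓜.M → ℝ := fun x => b x • (‖extChartAt (𝓡∂ 𝓜.n) x₀ x - z₀‖ ^ 2) ^ 𝓜.n + (1 - b x) with hφ
  have hφs : ContMDiff (𝓡∂ 𝓜.n) 𝓘(ℝ, ℝ) ∞ φ :=
    (b.contMDiff_smul hsm1).add (contMDiff_const.sub b.contMDiff)
  let e : 𝓜.testSubmodule := ⟨b, b.contMDiff, hb⟩
  refine ⟨φ, hφs, ?_, e, fun v hv hev => ?_⟩
  · have h1 : ∀ᵐ x ∂𝓜.m, x ∉ ({x₀} : Set 𝓜.M) :=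
      measure_eq_zero_iff_ae_notMem.1 (𝓜.smooth_measure.measure_singleton x₀)
    filter_upwards [h1] with x hx
    have hb0 : 0 ≤ b x := b.nonneg
    have hb1 : b x ≤ 1 := b.le_one
    rcases hb1.lt_or_eq with hlt | heq
    · have : 0 ≤ b x • (‖extChartAt (𝓡∂ 𝓜.n) x₀ x - z₀‖ ^ 2) ^ 𝓜.n := by
        rw [smul_eq_mul]; positivity
      simp only [hφ]; linarith
    · have hxs : x ∈ (extChartAt (𝓡∂ 𝓜.n) x₀).source :=
        b.tsupport_subset_extChartAt_source (subset_tsupport _ (by simp [heq]))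
      have hne : extChartAt (𝓡∂ 𝓜.n) x₀ x - z₀ ≠ 0 := fun h0 =>
        hx ((extChartAt (𝓡∂ 𝓜.n) x₀).injOn hxs (mem_extChartAt_source x₀) (sub_eq_zero.1 h0))
      have : 0 < ‖extChartAt (𝓡∂ 𝓜.n) x₀ x - z₀‖ := norm_pos_iff.2 hne
      simp only [hφ, heq, one_smul, sub_self, add_zero]
      positivity
  · -- On the coordinate ball of radius `r` around the zero, `e = 1` and `φ ≤ r ^ (2 n)`, so that
    -- `e = φ v` bounds the measure of the ball, which is of order `r ^ n`, by
    -- `r ^ (4 n) ∫ v ^ 2`.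
    obtain ⟨c, R, hc, hR, hball⟩ := 𝓜.smooth_measure.exists_le_measure_ball hx₀
    have hnear : {z | b ((extChartAt (𝓡∂ 𝓜.n) x₀).symm z) = 1} ∈ 𝓝 z₀ :=
      (continuousAt_extChartAt_symm (I := 𝓡∂ 𝓜.n) x₀).eventually (p := fun x => b x = 1) (by
        rw [(extChartAt (𝓡∂ 𝓜.n) x₀).left_inv (mem_extChartAt_source x₀)]
        exact b.eventuallyEq_one)
    obtain ⟨R', hR', hnear⟩ := Metric.mem_nhds_iff.1 hnear
    set V : ℝ := ∫ x, v x ^ 2 ∂𝓜.m with hV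
    have hV0 : 0 ≤ V := integral_nonneg fun x => sq_nonneg _
    have key : ∀ r, 0 < r → r ≤ R → r ≤ R' → r ≤ 1 → c ≤ r * V := by
      intro r hr hrR hrR' hr1
      set U := (extChartAt (𝓡∂ 𝓜.n) x₀).source ∩ extChartAt (𝓡∂ 𝓜.n) x₀ ⁻¹' Metric.ball z₀ r with hU
      have hUm : MeasurableSet U :=
        (isOpen_extChartAt_preimage' x₀ Metric.isOpen_ball).measurableSet
      have h1 : c * r ^ 𝓜.n ≤ 𝓜.m.real U := by
        have := ENNReal.toReal_mono (measure_ne_top 𝓜.m U) (hball r hr hrR)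
        rwa [ENNReal.toReal_ofReal (by positivity)] at this
      have h2 : ∀ᵐ x ∂𝓜.m.restrict U, (1 : ℝ) ≤ (r ^ 𝓜.n * r ^ 𝓜.n) ^ 2 * v x ^ 2 := by
        filter_upwards [ae_restrict_of_ae hev, ae_restrict_mem hUm] with x hx hxU
        have hbx : b x = 1 := by
          have := hnear (Metric.ball_subset_ball hrR' hxU.2)
          rwa [mem_ofPred_eq, (extChartAt (𝓡∂ 𝓜.n) x₀).left_inv hxU.1] at this
        have hx' : b x = φ x * v x := hx
        have hφx : φ x = (‖extChartAt (𝓡∂ 𝓜.n) x₀ x - z₀‖ ^ 2) ^ 𝓜.n := by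
          simp only [hφ, hbx, one_smul, sub_self, add_zero]
        have hφr : φ x ≤ r ^ 𝓜.n * r ^ 𝓜.n := by
          rw [hφx, ← mul_pow, ← sq]
          refine pow_le_pow_left₀ (by positivity) (pow_le_pow_left₀ (norm_nonneg _) ?_ 2) 𝓜.n
          exact (mem_ball_iff_norm.1 hxU.2).le
        have hφ0 : 0 ≤ φ x := by rw [hφx]; positivity
        calc (1 : ℝ) = (φ x * v x) ^ 2 := by rw [← hx', hbx]; norm_num
          _ = φ x ^ 2 * v x ^ 2 := mul_pow _ _ _
          _ ≤ _ := mul_le_mul_of_nonneg_right (pow_le_pow_left₀ hφ0 hφr 2) (sq_nonneg _)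
      have h3 : 𝓜.m.real U ≤ (r ^ 𝓜.n * r ^ 𝓜.n) ^ 2 * V := by
        calc 𝓜.m.real U = ∫ _ in U, (1 : ℝ) ∂𝓜.m := by simp
          _ ≤ ∫ x in U, (r ^ 𝓜.n * r ^ 𝓜.n) ^ 2 * v x ^ 2 ∂𝓜.m :=
              integral_mono_ae (integrable_const _)
                ((hv.integrable_sq.const_mul _).restrict) h2
          _ ≤ ∫ x, (r ^ 𝓜.n * r ^ 𝓜.n) ^ 2 * v x ^ 2 ∂𝓜.m :=
              setIntegral_le_integral (hv.integrable_sq.const_mul _)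
                (Filter.Eventually.of_forall fun x => by positivity)
          _ = _ := integral_const_mul _ _
      have h4 : c ≤ (r ^ 𝓜.n) ^ 3 * V := by
        refine le_of_mul_le_mul_right ?_ (pow_pos hr 𝓜.n)
        calc c * r ^ 𝓜.n ≤ _ := h1.trans h3
          _ = _ := by ring
      refine h4.trans (mul_le_mul_of_nonneg_right ?_ hV0)
      rw [← pow_mul]
      exact pow_le_of_le_one hr.le hr1 (by omega)
    set r := min (min R R') (min 1 (c / (2 * (V + 1)))) with hr
    have hr0 : 0 < r := by positivity
    have h1 := key r hr0 ((min_le_left _ _).trans (min_le_left _ _))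
      ((min_le_left _ _).trans (min_le_right _ _)) ((min_le_right _ _).trans (min_le_left _ _))
    have h2 : r * (2 * (V + 1)) ≤ c := by
      rw [← le_div_iff₀ (by positivity)]
      exact (min_le_right _ _).trans (min_le_right _ _)
    nlinarith [mul_nonneg hr0.le hV0]

/-! ### The sphere is contractible -/

instance : ContinuousNeg 𝓜.Sphere :=
  ⟨Continuous.subtype_mk (continuous_neg.comp continuous_subtype_val) _⟩

theorem Sphere.ne_zero (u : 𝓜.Sphere) : (u : 𝓜.Sobolev) ≠ 0 := fun h => by
  have h1 : 𝓜.normL2 u = 1 := u.2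
  rw [h, normL2_zero] at h1
  exact one_ne_zero h1.symm

theorem Sphere.neg_ne (u : 𝓜.Sphere) : -u ≠ u := fun h => by
  have h1 : -(u : 𝓜.Sobolev) = u := congrArg Subtype.val h
  refine Sphere.ne_zero u ?_
  have h2 : (2 : ℝ) • (u : 𝓜.Sobolev) = 0 := by
    rw [two_smul]
    nth_rw 1 [← h1]
    exact neg_add_cancel _
  exact (smul_eq_zero.1 h2).resolve_left two_ne_zero

/-- The radial projection of a nonzero element onto the unit sphere of the `L²` norm. -/
def normalize (u : 𝓜.Sobolev) (hu : u ≠ 0) : 𝓜.Sphere :=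
  ⟨(𝓜.normL2 u)⁻¹ • u, by
    have h := normL2_pos hu
    change 𝓜.normL2 _ = 1
    rw [normL2_smul, abs_of_pos (inv_pos.2 h), inv_mul_cancel₀ h.ne']⟩

theorem continuous_normalize {X : Type*} [TopologicalSpace X] {f : X → 𝓜.Sobolev}
    (hf : Continuous f) (h0 : ∀ x, f x ≠ 0) : Continuous fun x => normalize (f x) (h0 x) :=
  Continuous.subtype_mk (((continuous_normL2.comp hf).inv₀ fun x => (normL2_pos (h0 x)).ne').smul
    hf) _

theorem normalize_coe (u : 𝓜.Sphere) : normalize (u : 𝓜.Sobolev) (Sphere.ne_zero u) = u := by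
  refine Subtype.ext ?_
  have h : 𝓜.normL2 u = 1 := u.2
  simp [normalize, h]

/-- Two nowhere vanishing maps joined by segments avoiding the origin have homotopic
normalizations. -/
theorem homotopic_normalize {X : Type*} [TopologicalSpace X] {f g : X → 𝓜.Sobolev}
    (hf : Continuous f) (hg : Continuous g)
    (h : ∀ x, ∀ t ∈ Icc (0 : ℝ) 1, (1 - t) • f x + t • g x ≠ 0)
    (hf0 : ∀ x, f x ≠ 0) (hg0 : ∀ x, g x ≠ 0) :
    ContinuousMap.Homotopic (⟨_, continuous_normalize hf hf0⟩ : C(X, 𝓜.Sphere))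
      ⟨_, continuous_normalize hg hg0⟩ :=
  ⟨{ toFun := fun p => normalize ((1 - (p.1 : ℝ)) • f p.2 + (p.1 : ℝ) • g p.2) (h p.2 p.1 p.1.2)
     continuous_toFun := continuous_normalize (by fun_prop) _
     map_zero_left := fun x => by simp
     map_one_left := fun x => by simp }⟩

/-- The sphere is contracted by first moving it along the segments to `φ u`, where `φ` is a
multiplier, and then along the segments to a fixed element outside the range of the multiplication
by `φ`. -/
instance : ContractibleSpace 𝓜.Sphere := by
  obtain ⟨φ, hφ, hpos, e, he⟩ := exists_multiplier 𝓜
  obtain ⟨T, hT⟩ := exists_mulSobolev φ hφ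
  have hseg : ∀ u : 𝓜.Sobolev, u ≠ 0 → ∀ t ∈ Icc (0 : ℝ) 1, (1 - t) • u + t • T u ≠ 0 := by
    intro u hu t ht h0
    refine hu (eq_zero_of_toL2 ?_)
    have h1 : (1 - t) • toL2 𝓜 u + t • toL2 𝓜 (T u) = 0 := by
      rw [← map_smul, ← map_smul, ← map_add, h0, map_zero]
    filter_upwards [hT u, hpos, Lp.coeFn_add ((1 - t) • toL2 𝓜 u) (t • toL2 𝓜 (T u)),
      Lp.coeFn_smul (1 - t) (toL2 𝓜 u), Lp.coeFn_smul t (toL2 𝓜 (T u)),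
      Lp.coeFn_zero ℝ 2 𝓜.m] with x hx1 hx2 hx3 hx4 hx5 hx6
    rw [h1, hx6, Pi.add_apply, hx4, hx5, Pi.smul_apply, Pi.smul_apply, hx1] at hx3
    simp only [Pi.zero_apply, smul_eq_mul] at hx3
    have h2 : ((1 - t) + t * φ x) * toL2 𝓜 u x = 0 := by rw [hx3]; ring
    refine (mul_eq_zero.1 h2).resolve_left (ne_of_gt ?_)
    rcases ht.1.eq_or_lt with h3 | h3
    · rw [← h3]; norm_num
    · have := mul_pos h3 hx2
      linarith [ht.2]
  have hTinj : ∀ u : 𝓜.Sobolev, u ≠ 0 → T u ≠ 0 := fun u hu h0 =>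
    hseg u hu 1 ⟨zero_le_one, le_rfl⟩ (by simp [h0])
  have hrange : ∀ u : 𝓜.Sobolev, T u ≠ (e : 𝓜.Sobolev) := by
    intro u hu
    refine he (toL2 𝓜 u) (Lp.memLp _) ?_
    have h1 := hT u
    rw [hu] at h1
    exact (coeFn_toL2_coe e).symm.trans h1
  have he0 : (e : 𝓜.Sobolev) ≠ 0 := fun h => hrange 0 (by rw [map_zero, h])
  have hseg' : ∀ u : 𝓜.Sobolev, u ≠ 0 → ∀ t ∈ Icc (0 : ℝ) 1,
      (1 - t) • T u + t • (e : 𝓜.Sobolev) ≠ 0 := by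
    intro u hu t ht h0
    rcases ht.1.eq_or_lt with h3 | h3
    · rw [← h3] at h0
      exact hTinj u hu (by simpa using h0)
    · refine hrange (-(t⁻¹ * (1 - t)) • u) ?_
      rw [map_smul, neg_smul, neg_eq_iff_add_eq_zero, mul_smul, ← inv_smul_smul₀ h3.ne'
        (e : 𝓜.Sobolev), ← smul_add, h0, smul_zero]
  rw [contractible_iff_id_nullhomotopic]
  refine ⟨normalize (e : 𝓜.Sobolev) he0, ?_⟩
  have h1 := homotopic_normalize (X := 𝓜.Sphere) (f := fun u => (u : 𝓜.Sobolev))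
    (g := fun u => T u) continuous_subtype_val (T.continuous.comp continuous_subtype_val)
    (fun u => hseg u (Sphere.ne_zero u)) Sphere.ne_zero fun u => hTinj u (Sphere.ne_zero u)
  have h2 := homotopic_normalize (X := 𝓜.Sphere) (f := fun u => T u)
    (g := fun _ => (e : 𝓜.Sobolev)) (T.continuous.comp continuous_subtype_val) continuous_const
    (fun u => hseg' u (Sphere.ne_zero u)) (fun u => hTinj u (Sphere.ne_zero u)) fun _ => he0
  have h3 : (⟨_, continuous_normalize continuous_subtype_val Sphere.ne_zero⟩ :
      C(𝓜.Sphere, 𝓜.Sphere)) = ContinuousMap.id _ := ContinuousMap.ext normalize_coe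
  rw [← h3]
  exact h1.trans h2

end Contractible

/-! ### Properties of the genus -/

section Genus

variable {Y : Type*} [TopologicalSpace Y]

theorem lsCategory_mono {A B : Set Y} (h : A ⊆ B) : lsCategory A ≤ lsCategory B :=
  le_iInf₂ fun k ⟨C, hC, hB⟩ => iInf₂_le_of_le k ⟨C, hC, h.trans hB⟩ le_rfl

variable [Neg Y]

theorem krasnoselskiiGenus_le {A : Set Y} {m : ℕ} {h : Y → EuclideanSpace ℝ (Fin m)}
    (hc : ContinuousOn h A) (ho : ∀ u ∈ A, h u ≠ 0 ∧ h (-u) = -h u) :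
    krasnoselskiiGenus A ≤ m :=
  iInf₂_le m ⟨h, hc, ho⟩

theorem exists_of_krasnoselskiiGenus_le {A : Set Y} {m : ℕ} (h : krasnoselskiiGenus A ≤ m) :
    ∃ m' ≤ m, ∃ h : Y → EuclideanSpace ℝ (Fin m'),
      ContinuousOn h A ∧ ∀ u ∈ A, h u ≠ 0 ∧ h (-u) = -h u := by
  by_contra! hne
  have h1 : ((m + 1 : ℕ) : ℕ∞) ≤ krasnoselskiiGenus A := le_iInf₂ fun m' ⟨f, hf, ho⟩ => by
    rw [Nat.cast_le]
    by_contra! hlt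
    obtain ⟨u, hu, hu'⟩ := hne m' (by omega) f hf
    exact hu' (ho u hu).1 (ho u hu).2
  have h2 := h1.trans h
  rw [Nat.cast_le] at h2
  omega

theorem krasnoselskiiGenus_mono {A B : Set Y} (h : A ⊆ B) :
    krasnoselskiiGenus A ≤ krasnoselskiiGenus B :=
  le_iInf₂ fun _ ⟨_, hf, ho⟩ => krasnoselskiiGenus_le (hf.mono h) fun u hu => ho u (h hu)

theorem krasnoselskiiGenus_eq_zero_iff {A : Set Y} : krasnoselskiiGenus A = 0 ↔ A = ∅ := by
  refine ⟨fun h => ?_, ?_⟩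
  · obtain ⟨m, hm, f, -, ho⟩ := exists_of_krasnoselskiiGenus_le (A := A) (m := 0) (by simp [h])
    obtain rfl : m = 0 := by omega
    exact eq_empty_of_forall_notMem fun u hu => (ho u hu).1 (Subsingleton.elim _ _)
  · rintro rfl
    have h := krasnoselskiiGenus_le (A := (∅ : Set Y)) (m := 0) (h := fun _ => 0)
      continuousOn_const (by simp)
    simpa using h

theorem krasnoselskiiGenus_image_le (h : Y ≃ₜ Y) (hodd : ∀ u, h (-u) = -h u) (A : Set Y) :
    krasnoselskiiGenus (h '' A) ≤ krasnoselskiiGenus A := by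
  refine le_iInf₂ fun m ⟨f, hf, ho⟩ => ?_
  have hmaps : MapsTo h.symm (h '' A) A := by
    rintro _ ⟨v, hv, rfl⟩
    rwa [h.symm_apply_apply]
  refine krasnoselskiiGenus_le (h := f ∘ h.symm)
    (hf.comp h.symm.continuous.continuousOn hmaps) ?_
  rintro _ ⟨v, hv, rfl⟩
  simp only [Function.comp_apply, ← hodd, h.symm_apply_apply]
  exact ho v hv

theorem krasnoselskiiGenus_image (h : Y ≃ₜ Y) (hodd : ∀ u, h (-u) = -h u) (A : Set Y) :
    krasnoselskiiGenus (h '' A) = krasnoselskiiGenus A := by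
  refine le_antisymm (krasnoselskiiGenus_image_le h hodd A) ?_
  have h1 := krasnoselskiiGenus_image_le h.symm (fun u => by
    rw [h.symm_apply_eq, hodd, h.apply_symm_apply]) (h '' A)
  rwa [image_image, show (fun x => h.symm (h x)) = id from funext h.symm_apply_apply,
    image_id] at h1

end Genus

/-! ### The genus gives a dimension pair -/

section DimensionPair

variable {𝓜 : CompactFMMM.{u}}

/-- By the Borsuk–Ulam theorem the genus of the sphere of a `k`-dimensional subspace is at least
`k`. -/
theorem le_dimK_subspaceSphere {k : ℕ} (V : Submodule ℝ 𝓜.Sobolev) (hk : 1 ≤ k)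
    (hV : Module.finrank ℝ V = k) : (k : ℕ∞) ≤ dimK 𝓜 (𝓜.subspaceSphere V) := by
  refine le_iInf₂ fun m ⟨f, hf, ho⟩ => ?_
  rw [Nat.cast_le]
  by_contra! hlt
  obtain ⟨N, rfl⟩ : ∃ N, k = N + 1 := ⟨k - 1, by omega⟩
  have : FiniteDimensional ℝ V := Module.finite_of_finrank_pos (by omega)
  let L : (Fin (N + 1) → ℝ) ≃ₗ[ℝ] V := (Module.finBasisOfFinrankEq ℝ V hV).equivFun.symm
  have hLc : Continuous fun y => (L y : 𝓜.Sobolev) :=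
    continuous_subtype_val.comp L.toLinearMap.continuous_of_finiteDimensional
  have hL0 : ∀ y : Fin (N + 1) → ℝ, ∑ i, y i ^ 2 = 1 → (L y : 𝓜.Sobolev) ≠ 0 := by
    intro y hy h0
    have : y = 0 := L.map_eq_zero_iff.1 (Subtype.ext h0)
    rw [this] at hy
    simp at hy
  classical
  let F : (Fin (N + 1) → ℝ) → EuclideanSpace ℝ (Fin m) := fun y =>
    if hy : (L y : 𝓜.Sobolev) ≠ 0 then f (normalize _ hy) else 0
  have hmem : ∀ y (hy : (L y : 𝓜.Sobolev) ≠ 0), normalize _ hy ∈ 𝓜.subspaceSphere V :=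
    fun y hy => V.smul_mem _ (L y).2
  have hFc : ContinuousOn F {y | ∑ i, y i ^ 2 = 1} := by
    rw [continuousOn_iff_continuous_domRestrict]
    have h1 : Continuous fun y : {y : Fin (N + 1) → ℝ | ∑ i, y i ^ 2 = 1} =>
        f (normalize (L y.1 : 𝓜.Sobolev) (hL0 y.1 y.2)) :=
      hf.comp_continuous (continuous_normalize (hLc.comp continuous_subtype_val)
        fun y => hL0 y.1 y.2) fun y => hmem y.1 (hL0 y.1 y.2)
    exact h1.congr fun y =>
      (show F y.1 = f (normalize _ (hL0 y.1 y.2)) from dif_pos (hL0 y.1 y.2)).symm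
  have hFo : ∀ y : Fin (N + 1) → ℝ, ∑ i, y i ^ 2 = 1 → F (-y) = -F y := by
    intro y hy
    have hy' : (L (-y) : 𝓜.Sobolev) ≠ 0 := hL0 (-y) (by simpa using hy)
    have h1 : normalize _ hy' = -normalize _ (hL0 y hy) := by
      refine Subtype.ext ?_
      change (𝓜.normL2 (L (-y) : 𝓜.Sobolev))⁻¹ • (L (-y) : 𝓜.Sobolev) =
        -((𝓜.normL2 (L y : 𝓜.Sobolev))⁻¹ • (L y : 𝓜.Sobolev))
      rw [map_neg, Submodule.coe_neg, 𝓜.normL2_neg, smul_neg]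
    have h2 : F (-y) = f (normalize _ hy') := dif_pos hy'
    have h3 : F y = f (normalize _ (hL0 y hy)) := dif_pos (hL0 y hy)
    rw [h2, h3, h1]
    exact (ho _ (hmem y (hL0 y hy))).2
  -- `F` has fewer components than needed; the missing ones are set to zero
  let G : (Fin (N + 1) → ℝ) → Fin N → ℝ := fun y j => if hj : j.1 < m then F y ⟨j, hj⟩ else 0
  have hGc : ContinuousOn G {y | ∑ i, y i ^ 2 = 1} := continuousOn_pi.2 fun j => by
    by_cases hj : j.1 < m
    · simp only [G, dif_pos hj]
      exact (EuclideanSpace.proj (𝕜 := ℝ) (⟨j, hj⟩ : Fin m)).continuous.comp_continuousOn hFc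
    · simp only [G, dif_neg hj]
      exact continuousOn_const
  obtain ⟨y, hy, hGy⟩ := borsuk_ulam hGc fun y hy => by
    ext j
    by_cases hj : j.1 < m
    · simp [G, hj, hFo y hy]
    · simp [G, hj]
  have hF0 : F y = 0 := by
    ext j
    have h1 := congrFun hGy ⟨j.1, by omega⟩
    simpa [G, j.2] using h1
  have h3 : F y = f (normalize _ (hL0 y hy)) := dif_pos (hL0 y hy)
  exact (ho _ (hmem y (hL0 y hy))).1 (h3 ▸ hF0)

/-- The `L²` norm and the Sobolev norm are equivalent on a subspace of finite dimension. -/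
theorem isCompact_subspaceSphere (V : Submodule ℝ 𝓜.Sobolev) [FiniteDimensional ℝ V] :
    IsCompact (𝓜.subspaceSphere V) := by
  have := FiniteDimensional.proper_real V
  have hker : LinearMap.ker ((toL2 𝓜).toLinearMap ∘ₗ V.subtype) = ⊥ := by
    refine LinearMap.ker_eq_bot'.2 fun v hv => ?_
    refine Subtype.ext (eq_zero_of_normL2_eq_zero ?_)
    rw [← norm_toL2, norm_eq_zero]
    exact hv
  obtain ⟨K, -, hK⟩ := ((toL2 𝓜).toLinearMap ∘ₗ V.subtype).exists_antilipschitzWith hker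
  have hbound : ∀ v : V, ‖v‖ ≤ K * 𝓜.normL2 (v : 𝓜.Sobolev) := fun v => by
    have h := hK.le_mul_dist v 0
    rw [map_zero, dist_zero_right, dist_zero_right] at h
    rw [← norm_toL2]
    exact h
  have hcl : IsClosed {v : V | 𝓜.normL2 (v : 𝓜.Sobolev) = 1} :=
    isClosed_eq (continuous_normL2.comp continuous_subtype_val) continuous_const
  have hcomp : IsCompact {v : V | 𝓜.normL2 (v : 𝓜.Sobolev) = 1} :=
    (isCompact_closedBall (0 : V) K).of_isClosed_subset hcl fun v hv => by
      rw [mem_closedBall_zero_iff]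
      simpa [show 𝓜.normL2 (v : 𝓜.Sobolev) = 1 from hv] using hbound v
  rw [Subtype.isCompact_iff]
  convert hcomp.image continuous_subtype_val using 1
  ext u
  constructor
  · rintro ⟨v, hv, rfl⟩
    exact ⟨⟨v, hv⟩, v.2, rfl⟩
  · rintro ⟨v, hv, rfl⟩
    exact ⟨⟨v, hv⟩, v.2, rfl⟩

theorem isClosed_of_mem_familyC {α : FamilyIndex} {A : Set 𝓜.Sphere} (hA : A ∈ familyC 𝓜 α) :
    IsClosed A := by
  cases α with
  | one => exact hA
  | two => exact IsCompact.isClosed hA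

theorem mem_familyC_of_isCompact (α : FamilyIndex) {A : Set 𝓜.Sphere} (hA : IsCompact A) :
    A ∈ familyC 𝓜 α := by
  cases α with
  | one => exact hA.isClosed
  | two => exact hA

theorem image_mem_familyC {α : FamilyIndex} (h : 𝓜.Sphere ≃ₜ 𝓜.Sphere) {A : Set 𝓜.Sphere}
    (hA : A ∈ familyC 𝓜 α) : h '' A ∈ familyC 𝓜 α := by
  cases α with
  | one => exact h.isClosedMap A hA
  | two => exact IsCompact.image hA h.continuous

theorem union_mem_familyC {α : FamilyIndex} {A B : Set 𝓜.Sphere} (hA : A ∈ familyC 𝓜 α)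
    (hB : B ∈ familyC 𝓜 α) : A ∪ B ∈ familyC 𝓜 α := by
  cases α with
  | one => exact IsClosed.union hA hB
  | two => exact IsCompact.union hA hB

theorem subspaceSphere_mem_familyD (α : FamilyIndex) (V : Submodule ℝ 𝓜.Sobolev)
    [FiniteDimensional ℝ V] : 𝓜.subspaceSphere V ∈ familyD 𝓜 α :=
  ⟨mem_familyC_of_isCompact α (isCompact_subspaceSphere V), fun u =>
    (neg_mem_iff (S := Submodule ℝ 𝓜.Sobolev) (H := V) (x := (u : 𝓜.Sobolev))).symm⟩

theorem isDimensionPair_dimK (𝓜 : CompactFMMM.{u}) (α : FamilyIndex) :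
    IsDimensionPair 𝓜 (familyD 𝓜 α) (dimK 𝓜) where
  optional :=
    { empty_mem := ⟨mem_familyC_of_isCompact α isCompact_empty, by simp⟩
      subspace_mem := fun k hk V hV => by
        have : FiniteDimensional ℝ V := Module.finite_of_finrank_pos (by omega)
        exact subspaceSphere_mem_familyD α V
      image_mem := fun h hodd A hA => by
        refine ⟨image_mem_familyC h hA.1, fun u => ?_⟩
        have key : ∀ u ∈ h '' A, -u ∈ h '' A := by
          rintro _ ⟨v, hv, rfl⟩
          exact ⟨-v, (hA.2 v).1 hv, hodd v⟩
        exact ⟨key u, fun hu => by simpa using key _ hu⟩ }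
  dimensionLike :=
    { eq_zero_iff := fun _ _ => krasnoselskiiGenus_eq_zero_iff
      mono := fun _ _ _ _ h => krasnoselskiiGenus_mono h
      le_subspace := fun _ hk V hV => le_dimK_subspaceSphere V hk hV
      image_eq := fun h hodd A _ => krasnoselskiiGenus_image h hodd A }

/-! ### Comparison of the two spectra -/

theorem dimLS_eq_dimK {α : FamilyIndex} {A : Set 𝓜.Sphere} (hA : A ∈ familyD 𝓜 α) :
    dimLS 𝓜 A = dimK 𝓜 A :=
  lsCategory_image_eq_krasnoselskiiGenus Sphere.neg_ne (isClosed_of_mem_familyC hA.1)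
    fun u => (hA.2 u).1

/-- A set and its symmetrization have the same image in the projective space, and the energy is
even. -/
theorem sublevelDim_dimLS_eq (α : FamilyIndex) (c : ℝ≥0∞) :
    sublevelDim 𝓜 (familyC 𝓜 α) (dimLS 𝓜) c = sublevelDim 𝓜 (familyD 𝓜 α) (dimK 𝓜) c := by
  refine le_antisymm (iSup₂_le fun A hA => ?_) (iSup₂_le fun A hA => ?_)
  · have hneg : Homeomorph.neg 𝓜.Sphere '' A ∈ familyC 𝓜 α := image_mem_familyC _ hA.1
    set B := A ∪ Homeomorph.neg 𝓜.Sphere '' A with hB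
    have hmem : ∀ u, u ∈ B ↔ u ∈ A ∨ -u ∈ A := by
      intro u
      simp only [hB, mem_union, Homeomorph.coe_neg, mem_image]
      refine or_congr_right ⟨?_, fun h => ⟨-u, h, neg_neg u⟩⟩
      rintro ⟨v, hv, rfl⟩
      rwa [neg_neg]
    have hBD : B ∈ familyD 𝓜 α := by
      refine ⟨union_mem_familyC hA.1 hneg, fun u => ?_⟩
      rw [hmem, hmem, neg_neg, or_comm]
    refine le_trans (lsCategory_mono (image_mono (subset_union_left : A ⊆ B))) ?_
    refine le_trans (dimLS_eq_dimK hBD).le (le_iSup₂_of_le B ⟨hBD, fun u hu => ?_⟩ le_rfl)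
    rcases (hmem u).1 hu with h | h
    · exact hA.2 u h
    · have h1 := hA.2 (-u) h
      rwa [show ((-u : 𝓜.Sphere) : 𝓜.Sobolev) = -u from rfl, energy_neg] at h1
  · rw [← dimLS_eq_dimK hA.1]
    exact le_iSup₂_of_le A ⟨hA.1.1, hA.2⟩ le_rfl

end DimensionPair

/-! ### Spectral theory of a pair of quadratic forms -/

section SymmetricForms

variable {E : Type*} [AddCommGroup E] [Module ℝ E] {a : E →ₗ[ℝ] E →ₗ[ℝ] ℝ}

theorem apply_add_smul_self (hs : ∀ u v, a u v = a v u) (u v : E) (t : ℝ) :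
    a (u + t • v) (u + t • v) = a u u + 2 * t * a u v + t * t * a v v := by
  simp only [map_add, map_smul, LinearMap.add_apply, LinearMap.smul_apply, smul_eq_mul, hs v u]
  ring

theorem sq_apply_le_of_nonneg (hs : ∀ u v, a u v = a v u) (hpos : ∀ u, 0 ≤ a u u) (u v : E) :
    a u v ^ 2 ≤ a u u * a v v := by
  have h1 : ∀ t : ℝ, 0 ≤ a v v * (t * t) + (2 * a u v) * t + a u u := fun t => by
    have h2 := hpos (u + t • v)
    rw [apply_add_smul_self hs] at h2
    linarith
  have h2 := discrim_le_zero h1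
  rw [discrim] at h2
  linarith

/-- The squared norm of a linear functional represented by `w` with respect to an inner product is
the squared norm of `w`. -/
theorem sq_iSup_div_sqrt (hs : ∀ u v, a u v = a v u) (hpos : ∀ u, u ≠ 0 → 0 < a u u) (w : E) :
    (⨆ y : {y : E // y ≠ 0}, a w y.1 / √(a y.1 y.1)) ^ 2 = a w w := by
  have hpos' : ∀ u, 0 ≤ a u u := fun u => by
    by_cases h : u = 0
    · simp [h]
    · exact (hpos u h).le
  by_cases hw : w = 0
  · simp [hw]
  have hle : ∀ y : {y : E // y ≠ 0}, a w y.1 / √(a y.1 y.1) ≤ √(a w w) := fun y => by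
    rw [div_le_iff₀ (Real.sqrt_pos.2 (hpos _ y.2)), ← Real.sqrt_mul (hpos' w)]
    exact Real.le_sqrt_of_sq_le (sq_apply_le_of_nonneg hs hpos' w y.1)
  have hne : Nonempty {y : E // y ≠ 0} := ⟨⟨w, hw⟩⟩
  have heq : (⨆ y : {y : E // y ≠ 0}, a w y.1 / √(a y.1 y.1)) = √(a w w) := by
    refine le_antisymm (ciSup_le hle) ?_
    refine le_trans (le_of_eq ?_) (le_ciSup ⟨_, forall_mem_range.2 hle⟩ ⟨w, hw⟩)
    exact (Real.div_sqrt).symm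
  rw [heq, Real.sq_sqrt (hpos' w)]

theorem exists_represents [FiniteDimensional ℝ E] (hpos : ∀ u, u ≠ 0 → 0 < a u u)
    (η : E →ₗ[ℝ] ℝ) : ∃ w, a w = η := by
  have hinj : Function.Injective a := by
    rw [injective_iff_map_eq_zero]
    intro u hu
    by_contra h
    have := hpos u h
    rw [hu] at this
    simp at this
  exact (LinearMap.injective_iff_surjective_of_finrank_eq_finrank
    (Subspace.dual_finrank_eq (K := ℝ) (V := E)).symm).1 hinj η

end SymmetricForms

section Forms

variable {E : Type*} [NormedAddCommGroup E] [NormedSpace ℝ E]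

/-- The Jordan–von Neumann theorem: polarization of a continuous function that satisfies the
parallelogram law gives a bilinear form. -/
theorem exists_bilinear_of_parallelogram {Q : E → ℝ} (hc : Continuous Q)
    (hQ : ∀ x y, Q (x + y) + Q (x - y) = 2 * Q x + 2 * Q y) :
    ∃ B : E →ₗ[ℝ] E →ₗ[ℝ] ℝ, (∀ x y, B x y = (Q (x + y) - Q (x - y)) / 4) ∧
      (∀ x y, B x y = B y x) ∧ ∀ x, B x x = Q x := by
  have h0 : Q 0 = 0 := by
    have := hQ 0 0
    rw [add_zero, sub_zero] at this
    linarith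
  have heven : ∀ x, Q (-x) = Q x := fun x => by
    have := hQ 0 x
    rw [zero_add, zero_sub, h0] at this
    linarith
  set b : E → E → ℝ := fun x y => (Q (x + y) - Q (x - y)) / 4 with hb
  have hsymm : ∀ x y, b x y = b y x := fun x y => by
    simp only [hb]
    rw [add_comm x y, ← heven (x - y), neg_sub]
  have hadd : ∀ x z y, b (x + z) y = b x y + b z y := fun x z y => by
    have h1 := hQ (x + y) z
    have h2 := hQ (x - y) z
    have h3 := hQ (z + y) x
    have h4 := hQ (z - y) x
    have e1 : x + y + z = x + z + y := by abel
    have e2 : x - y + z = x + z - y := by abel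
    have e3 : z + y + x = x + z + y := by abel
    have e4 : z - y + x = x + z - y := by abel
    have e5 : z - y - x = -(x + y - z) := by abel
    have e6 : z + y - x = -(x - y - z) := by abel
    rw [e1] at h1
    rw [e2] at h2
    rw [e3, e6, heven] at h3
    rw [e4, e5, heven] at h4
    simp only [hb]
    linarith
  have hcont : ∀ y, Continuous fun x => b x y := fun y => by
    simp only [hb]; fun_prop
  have hsmul : ∀ (c : ℝ) x y, b (c • x) y = c * b x y := fun c x y => by
    let f : E →+ ℝ := AddMonoidHom.mk' (fun x => b x y) fun x z => hadd x z y
    exact map_real_smul f (hcont y) c x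
  refine ⟨LinearMap.mk₂ ℝ b hadd hsmul (fun x y z => ?_) (fun c x y => ?_), fun x y => rfl,
    hsymm, fun x => ?_⟩
  · rw [hsymm x, hadd, hsymm y, hsymm z]
  · rw [hsymm x, hsmul, hsymm y, smul_eq_mul]
  · have h1 := hQ x x
    rw [sub_self, h0] at h1
    change (Q (x + x) - Q (x - x)) / 4 = Q x
    rw [sub_self, h0]
    linarith

variable {a b : E →ₗ[ℝ] E →ₗ[ℝ] ℝ}

/-- The Euler–Lagrange equation of a minimizer of the Rayleigh quotient. -/
theorem eq_of_rayleigh_min (ha : ∀ u v, a u v = a v u) (hb : ∀ u v, b u v = b v u)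
    {W : Submodule ℝ E} {w : E} (hw : w ∈ W) {c : ℝ} (hwc : b w w = c * a w w)
    (hmin : ∀ v ∈ W, c * a v v ≤ b v v) {v : E} (hv : v ∈ W) : b w v = c * a w v := by
  have h1 : ∀ t : ℝ, 0 ≤ (b v v - c * a v v) * (t * t) + (2 * (b w v - c * a w v)) * t + 0 := by
    intro t
    have h2 := hmin _ (W.add_mem hw (W.smul_mem t hv))
    rw [apply_add_smul_self ha, apply_add_smul_self hb] at h2
    nlinarith
  have h2 := discrim_le_zero h1
  rw [discrim, mul_zero, sub_zero] at h2
  have h3 := pow_eq_zero_iff (two_ne_zero) |>.1 (le_antisymm h2 (sq_nonneg _))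
  linarith

/-- On the span of eigenvectors with eigenvalues at most `c` the Rayleigh quotient is at
most `c`: eigenvectors `e i`, `e j` with different eigenvalues are orthogonal, so for
`u = ∑ x i • e i` the difference `c a(u, u) - b(u, u)` is the squared norm of
`∑ √(c - μ i) x i • e i`. -/
theorem rayleigh_le_of_eigenvectors {ι : Type*} [Fintype ι] (ha : ∀ u v, a u v = a v u)
    (hb : ∀ u v, b u v = b v u) (hpos : ∀ u, 0 ≤ a u u) {e : ι → E} {μ : ι → ℝ}
    (he : ∀ i v, b (e i) v = μ i * a (e i) v) {c : ℝ} (hμ : ∀ i, μ i ≤ c) {u : E}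
    (hu : u ∈ Submodule.span ℝ (range e)) : b u u ≤ c * a u u := by
  obtain ⟨x, rfl⟩ := (Submodule.mem_span_range_iff_exists_fun ℝ).1 hu
  have horth : ∀ i j, (c - μ i) * a (e i) (e j) = √(c - μ i) * √(c - μ j) * a (e i) (e j) := by
    intro i j
    by_cases hij : μ i = μ j
    · rw [← hij, Real.mul_self_sqrt (sub_nonneg.2 (hμ i))]
    · have h1 : μ i * a (e i) (e j) = μ j * a (e i) (e j) := by
        rw [← he, hb, he, ha]
      have h2 : a (e i) (e j) = 0 := by
        by_contra h
        exact hij (mul_right_cancel₀ h h1)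
      rw [h2, mul_zero, mul_zero]
  have hexp : ∀ (f : E →ₗ[ℝ] E →ₗ[ℝ] ℝ) (y : ι → ℝ),
      f (∑ i, y i • e i) (∑ i, y i • e i) = ∑ i, ∑ j, y i * y j * f (e i) (e j) := by
    intro f y
    simp only [map_sum, map_smul, smul_eq_mul, LinearMap.sum_apply, LinearMap.smul_apply,
      Finset.mul_sum]
    rw [Finset.sum_comm]
    refine Finset.sum_congr rfl fun i _ => Finset.sum_congr rfl fun j _ => ?_
    ring
  have h1 := hpos (∑ i, (√(c - μ i) * x i) • e i)
  rw [hexp] at h1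
  rw [hexp, hexp, Finset.mul_sum, ← sub_nonneg, ← Finset.sum_sub_distrib]
  refine h1.trans (le_of_eq (Finset.sum_congr rfl fun i _ => ?_))
  rw [Finset.mul_sum, ← Finset.sum_sub_distrib]
  refine Finset.sum_congr rfl fun j _ => ?_
  rw [he]
  linear_combination (-(x i * x j)) * horth i j

/-- The orthogonal projection onto the span of finitely many vectors. -/
theorem exists_orthogonal_decomposition {ι : Type*} [Fintype ι]
    (hdef : ∀ u, a u u = 0 → u = 0) {e : ι → E} (hli : LinearIndependent ℝ e) (v : E) :
    ∃ x : ι → ℝ, ∀ i, a (v - ∑ j, x j • e j) (e i) = 0 := by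
  let T : (ι → ℝ) →ₗ[ℝ] (ι → ℝ) :=
    LinearMap.pi fun i => a.flip (e i) ∘ₗ Fintype.linearCombination ℝ e
  have hT : ∀ x i, T x i = a (∑ j, x j • e j) (e i) := fun x i => rfl
  have hinj : Function.Injective T := by
    rw [injective_iff_map_eq_zero]
    intro x hx
    have h1 : ∀ i, a (∑ j, x j • e j) (e i) = 0 := fun i => by rw [← hT, hx]; rfl
    have h2 : ∑ j, x j • e j = 0 := hdef _ (by
      rw [map_sum (a (∑ j, x j • e j))]
      exact Finset.sum_eq_zero fun i _ => by rw [map_smul, h1, smul_zero])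
    exact funext (Fintype.linearIndependent_iff.1 hli x h2)
  obtain ⟨x, hx⟩ := LinearMap.injective_iff_surjective.1 hinj fun i => a v (e i)
  refine ⟨x, fun i => ?_⟩
  rw [map_sub, LinearMap.sub_apply, ← hT, hx, sub_self]

variable [CompleteSpace E]

/-- The direct method: if the form `b + a` is equivalent to the squared norm and the form `a` is
compact, then the Rayleigh quotient `b / a` attains its minimum on every nonzero closed subspace.
By compactness a minimizing sequence is a Cauchy sequence for `a`, and by the parallelogram law
also for `b`. -/
theorem exists_rayleigh_min
    (hapos : ∀ u, 0 ≤ a u u) (hbpos : ∀ u, 0 ≤ b u u) (hdef : ∀ u, a u u = 0 → u = 0)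
    (hac : Continuous fun u => a u u) (hbc : Continuous fun u => b u u)
    (hnorm : ∀ u, ‖u‖ ≤ √(a u u) + √(b u u))
    (hcomp : ∀ ε : ℝ, 0 < ε → ∃ (κ : Type u) (_ : Fintype κ) (l : κ → E →L[ℝ] ℝ),
      ∀ v, √(a v v) ≤ ε * ‖v‖ + ∑ k, |l k v|)
    {W : Submodule ℝ E} (hW : IsClosed (W : Set E)) {u₀ : E} (hu₀ : u₀ ∈ W) (hne : u₀ ≠ 0) :
    ∃ w ∈ W, w ≠ 0 ∧ ∃ c : ℝ, b w w = c * a w w ∧ ∀ v ∈ W, c * a v v ≤ b v v := by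
  set S : Set ℝ := (fun u => b u u) '' {u | u ∈ W ∧ a u u = 1} with hS
  set c := sInf S with hc
  have hscale : ∀ (f : E →ₗ[ℝ] E →ₗ[ℝ] ℝ) (t : ℝ) (v : E), f (t • v) (t • v) = t ^ 2 * f v v := by
    intro f t v
    simp only [map_smul, LinearMap.smul_apply, smul_eq_mul]
    ring
  have hapos' : ∀ v : E, v ≠ 0 → 0 < a v v := fun v hv =>
    lt_of_le_of_ne (hapos v) fun h => hv (hdef v h.symm)
  have hunit : ∀ v : E, v ≠ 0 → a ((√(a v v))⁻¹ • v) ((√(a v v))⁻¹ • v) = 1 := fun v hv => by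
    rw [hscale, inv_pow, Real.sq_sqrt (hapos v), inv_mul_cancel₀ (hapos' v hv).ne']
  have hSne : S.Nonempty := ⟨_, (√(a u₀ u₀))⁻¹ • u₀, ⟨W.smul_mem _ hu₀, hunit u₀ hne⟩, rfl⟩
  have hSb : BddBelow S := ⟨0, by rintro _ ⟨u, -, rfl⟩; exact hbpos u⟩
  have hc0 : 0 ≤ c := le_csInf hSne (by rintro _ ⟨u, -, rfl⟩; exact hbpos u)
  have hmin : ∀ v ∈ W, c * a v v ≤ b v v := by
    intro v hv
    by_cases h0 : v = 0
    · simp [h0]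
    · have h1 : c ≤ _ := csInf_le hSb ⟨_, ⟨W.smul_mem (√(a v v))⁻¹ hv, hunit v h0⟩, rfl⟩
      have h1' : c ≤ b ((√(a v v))⁻¹ • v) ((√(a v v))⁻¹ • v) := h1
      rw [hscale, inv_pow, Real.sq_sqrt (hapos v), inv_mul_eq_div, le_div_iff₀ (hapos' v h0)] at h1'
      exact h1'
  obtain ⟨s, -, hs, hsS⟩ := exists_seq_tendsto_sInf hSne hSb
  choose u huW hu using hsS
  have hu1 : ∀ k, a (u k) (u k) = 1 := fun k => (huW k).2
  -- an ultrafilter replaces the successive choice of subsequences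
  let 𝒰 : Ultrafilter ℕ := Filter.hyperfilter ℕ
  have hU : (𝒰 : Filter ℕ) ≤ Filter.atTop := Nat.hyperfilter_le_atTop
  have hbU : Filter.Tendsto (fun k => b (u k) (u k)) 𝒰 (𝓝 c) := by
    have : (fun k => b (u k) (u k)) = s := funext hu
    rw [this]
    exact hs.mono_left hU
  have hbdd : ∀ᶠ k in (𝒰 : Filter ℕ), b (u k) (u k) < c + 1 :=
    hbU.eventually (gt_mem_nhds (by linarith))
  set R : ℝ := 1 + √(c + 1) with hR
  have hR0 : 0 < R := by positivity
  have hbddR : ∀ᶠ k in (𝒰 : Filter ℕ), ‖u k‖ ≤ R := hbdd.mono fun k hk => by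
    refine (hnorm _).trans ?_
    rw [hu1, Real.sqrt_one]
    exact add_le_add le_rfl (Real.sqrt_le_sqrt hk.le)
  have hacauchy : ∀ ε : ℝ, 0 < ε → ∃ P ∈ (𝒰 : Filter ℕ), ∀ k ∈ P, ∀ l ∈ P,
      √(a (u k - u l) (u k - u l)) ≤ ε := by
    intro ε hε
    obtain ⟨κ, _, L, hL⟩ := hcomp (ε / (4 * R)) (by positivity)
    have hlim : ∀ j, ∃ y : ℝ, Filter.Tendsto (fun k => L j (u k)) 𝒰 (𝓝 y) := by
      intro j
      have h1 : ∀ᶠ k in (𝒰 : Filter ℕ), L j (u k) ∈ Icc (-(‖L j‖ * R)) (‖L j‖ * R) :=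
        hbddR.mono fun k hk => abs_le.1 (((L j).le_opNorm (u k)).trans
          (mul_le_mul_of_nonneg_left hk (norm_nonneg _)))
      obtain ⟨y, -, hy⟩ := isCompact_Icc.ultrafilter_le_nhds (𝒰.map fun k => L j (u k))
        (Filter.le_principal_iff.2 h1)
      exact ⟨y, hy⟩
    choose y hy using hlim
    set τ : ℝ := ε / (4 * (Fintype.card κ + 1)) with hτ
    have hτ0 : 0 < τ := by positivity
    have hev : ∀ᶠ k in (𝒰 : Filter ℕ), ‖u k‖ ≤ R ∧ ∀ j, |L j (u k) - y j| < τ :=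
      hbddR.and (Filter.eventually_all.2 fun j => by
        have := (hy j).eventually (Metric.ball_mem_nhds (y j) hτ0)
        exact this)
    refine ⟨_, hev, fun k hk l hl => (hL _).trans ?_⟩
    have h1 : ‖u k - u l‖ ≤ 2 * R := (norm_sub_le _ _).trans (by linarith [hk.1, hl.1])
    have h2 : ∀ j, |L j (u k - u l)| ≤ 2 * τ := fun j => by
      rw [map_sub]
      have h3 := (abs_lt.1 (hk.2 j))
      have h4 := (abs_lt.1 (hl.2 j))
      rw [abs_le]
      constructor <;> linarith [h3.1, h3.2, h4.1, h4.2]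
    have h5 : ∑ j, |L j (u k - u l)| ≤ Fintype.card κ * (2 * τ) := by
      refine (Finset.sum_le_sum fun j _ => h2 j).trans (le_of_eq ?_)
      simp
    have h6 : ε / (4 * R) * ‖u k - u l‖ ≤ ε / 2 := by
      refine (mul_le_mul_of_nonneg_left h1 (by positivity)).trans (le_of_eq ?_)
      field_simp
      norm_num
    have h7 : (Fintype.card κ : ℝ) * (2 * τ) ≤ ε / 2 := by
      rw [hτ, mul_div_assoc', mul_div_assoc', div_le_div_iff₀ (by positivity) (by positivity)]
      nlinarith
    linarith
  have hcauchy : Cauchy (Filter.map u 𝒰) := by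
    rw [Metric.cauchy_iff]
    refine ⟨inferInstance, fun δ hδ => ?_⟩
    set θ := δ / 3 with hθ
    have hθ0 : 0 < θ := by positivity
    set ε := θ / (2 * (c + 1)) with hε
    have hε0 : 0 < ε := by positivity
    have hεθ : ε ≤ θ := div_le_self hθ0.le (by linarith)
    have hcε : c * ε ^ 2 ≤ θ ^ 2 / 4 := by
      rw [hε, div_pow, mul_div_assoc', div_le_div_iff₀ (by positivity) (by positivity)]
      nlinarith [mul_nonneg (sq_nonneg θ) hc0, mul_nonneg (sq_nonneg θ) (sq_nonneg c)]
    obtain ⟨P, hP, hPa⟩ := hacauchy ε hε0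
    have hev : ∀ᶠ k in (𝒰 : Filter ℕ), b (u k) (u k) < c + θ ^ 2 / 16 :=
      hbU.eventually (gt_mem_nhds (by linarith [pow_pos hθ0 2]))
    refine ⟨u '' (P ∩ {k | b (u k) (u k) < c + θ ^ 2 / 16}),
      Filter.image_mem_map (Filter.inter_mem hP hev), ?_⟩
    rintro _ ⟨k, ⟨hkP, hk⟩, rfl⟩ _ ⟨l, ⟨hlP, hl⟩, rfl⟩
    have h1 := hPa k hkP l hlP
    have h2 : a (u k - u l) (u k - u l) ≤ ε ^ 2 := (Real.sqrt_le_left hε0.le).1 h1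
    have hpar : ∀ f : E →ₗ[ℝ] E →ₗ[ℝ] ℝ, f (u k + u l) (u k + u l) =
        2 * f (u k) (u k) + 2 * f (u l) (u l) - f (u k - u l) (u k - u l) := by
      intro f
      simp only [map_add, map_sub, LinearMap.add_apply, LinearMap.sub_apply]
      ring
    have h3 := hmin _ (W.add_mem (huW k).1 (huW l).1)
    rw [hpar a, hpar b, hu1, hu1] at h3
    have hk' : b (u k) (u k) < c + θ ^ 2 / 16 := hk
    have hl' : b (u l) (u l) < c + θ ^ 2 / 16 := hl
    have h4 : b (u k - u l) (u k - u l) ≤ θ ^ 2 := by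
      have h5 := mul_le_mul_of_nonneg_left h2 hc0
      nlinarith
    rw [dist_eq_norm]
    have h5 : √(b (u k - u l) (u k - u l)) ≤ θ := Real.sqrt_le_iff.2 ⟨hθ0.le, h4⟩
    linarith [hnorm (u k - u l)]
  obtain ⟨w, hw⟩ := CompleteSpace.complete hcauchy
  have hw' : Filter.Tendsto u 𝒰 (𝓝 w) := hw
  have ha1 : a w w = 1 :=
    tendsto_nhds_unique ((hac.tendsto w).comp hw') (tendsto_const_nhds.congr fun k => (hu1 k).symm)
  have hbw : b w w = c := tendsto_nhds_unique ((hbc.tendsto w).comp hw') hbU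
  refine ⟨w, hW.mem_of_tendsto hw' (Filter.Eventually.of_forall fun k => (huW k).1), ?_, c,
    by rw [ha1, hbw, mul_one], hmin⟩
  rintro rfl
  simp at ha1

/-- If `e` spans all eigenvectors with eigenvalue at most `c`, then the Rayleigh quotient is larger
than `c` on the orthogonal complement of `e`: a minimizer on the complement is an eigenvector,
because the Euler–Lagrange equation also holds when tested with the `e i`. -/
theorem lt_rayleigh_of_orthogonal {ι : Type*} [Fintype ι]
    (ha : ∀ u v, a u v = a v u) (hb : ∀ u v, b u v = b v u)
    (hapos : ∀ u, 0 ≤ a u u) (hbpos : ∀ u, 0 ≤ b u u) (hdef : ∀ u, a u u = 0 → u = 0)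
    (hac : Continuous fun u => a u u) (hbc : Continuous fun u => b u u)
    (hac' : ∀ v, Continuous fun u => a u v)
    (hnorm : ∀ u, ‖u‖ ≤ √(a u u) + √(b u u))
    (hcomp : ∀ ε : ℝ, 0 < ε → ∃ (κ : Type u) (_ : Fintype κ) (l : κ → E →L[ℝ] ℝ),
      ∀ v, √(a v v) ≤ ε * ‖v‖ + ∑ k, |l k v|)
    {e : ι → E} (hli : LinearIndependent ℝ e) {μ : ι → ℝ}
    (he : ∀ i v, b (e i) v = μ i * a (e i) v) {c : ℝ}
    (hspan : ∀ (w : E) (r : ℝ), w ≠ 0 → r ≤ c → (∀ v, b w v = r * a w v) →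
      w ∈ Submodule.span ℝ (range e))
    {u₀ : E} (hne : u₀ ≠ 0) (hu₀ : ∀ i, a u₀ (e i) = 0) : c * a u₀ u₀ < b u₀ u₀ := by
  by_contra! hle
  let W : Submodule ℝ E := ⨅ i, LinearMap.ker (a.flip (e i))
  have hW : ∀ v, v ∈ W ↔ ∀ i, a v (e i) = 0 := fun v => by
    simp [W, Submodule.mem_iInf, LinearMap.mem_ker]
  have hWc : IsClosed (W : Set E) := by
    have : (W : Set E) = ⋂ i, {v | a v (e i) = 0} := by
      ext v
      simp [hW]
    rw [this]
    exact isClosed_iInter fun i => isClosed_eq (hac' (e i)) continuous_const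
  obtain ⟨w, hw, hw0, r, hwr, hmin⟩ := exists_rayleigh_min hapos hbpos hdef hac hbc hnorm
    hcomp hWc ((hW u₀).2 hu₀) hne
  have hpos : 0 < a u₀ u₀ := lt_of_le_of_ne (hapos u₀) fun h => hne (hdef u₀ h.symm)
  have hrc : r ≤ c := le_of_mul_le_mul_right ((hmin u₀ ((hW u₀).2 hu₀)).trans hle) hpos
  have hwe : ∀ i, a w (e i) = 0 := (hW w).1 hw
  have heig : ∀ v, b w v = r * a w v := by
    intro v
    obtain ⟨x, hx⟩ := exists_orthogonal_decomposition hdef hli v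
    have h1 := eq_of_rayleigh_min ha hb hw hwr hmin ((hW _).2 hx)
    have h2 : ∀ j, b w (e j) = 0 := fun j => by rw [hb, he, ha, hwe, mul_zero]
    rw [map_sub, map_sub, map_sum, map_sum] at h1
    simpa [h2, hwe] using h1
  obtain ⟨x, hx⟩ := (Submodule.mem_span_range_iff_exists_fun ℝ).1 (hspan w r hw0 hrc heig)
  refine hw0 (hdef w ?_)
  nth_rw 2 [← hx]
  rw [map_sum]
  exact Finset.sum_eq_zero fun i _ => by rw [map_smul, hwe, smul_zero]

end Forms

/-! ### Riemannian manifolds -/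

section Riemannian

variable {𝓜 : CompactFMMM.{u}}

/-- The co-metric of a Riemannian metric is Euclidean. -/
theorem dual_parallelogram {g : 𝓜.RiemannianMetric} (hg : IsRiemannian 𝓜 g) (x : 𝓜.M)
    (η ζ : TangentSpace (𝓡∂ 𝓜.n) x →L[ℝ] ℝ) :
    𝓜.F.dual x (η + ζ) ^ 2 + 𝓜.F.dual x (η - ζ) ^ 2 =
      2 * 𝓜.F.dual x η ^ 2 + 2 * 𝓜.F.dual x ζ ^ 2 := by
  have : FiniteDimensional ℝ (TangentSpace (𝓡∂ 𝓜.n) x) :=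
    inferInstanceAs (FiniteDimensional ℝ (EuclideanSpace ℝ (Fin 𝓜.n)))
  let a : TangentSpace (𝓡∂ 𝓜.n) x →ₗ[ℝ] TangentSpace (𝓡∂ 𝓜.n) x →ₗ[ℝ] ℝ :=
    LinearMap.mk₂ ℝ (fun v w => g.inner x v w) (by simp) (by simp) (by simp) (by simp)
  have ha : ∀ v w, a v w = g.inner x v w := fun v w => rfl
  have hs : ∀ v w, a v w = a w v := g.symm x
  have hpos : ∀ v, v ≠ 0 → 0 < a v v := g.pos x
  have hdual : ∀ (θ : TangentSpace (𝓡∂ 𝓜.n) x →L[ℝ] ℝ) (w : TangentSpace (𝓡∂ 𝓜.n) x),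
      a w = θ.toLinearMap → 𝓜.F.dual x θ ^ 2 = a w w := by
    intro θ w h
    have h1 : ∀ y, θ y = a w y := fun y => (LinearMap.congr_fun h y).symm
    rw [← sq_iSup_div_sqrt hs hpos w, FinslerMetric.dual]
    congr 1
    refine iSup_congr fun y => ?_
    rw [h1, hg.metric_eq]
    rfl
  obtain ⟨v, hv⟩ := exists_represents hpos η.toLinearMap
  obtain ⟨w, hw⟩ := exists_represents hpos ζ.toLinearMap
  rw [hdual η v hv, hdual ζ w hw, hdual (η + ζ) (v + w) (by rw [map_add, hv, hw]; rfl),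
    hdual (η - ζ) (v - w) (by rw [map_sub, hv, hw]; rfl)]
  simp only [map_add, map_sub, LinearMap.add_apply, LinearMap.sub_apply]
  ring

theorem sq_testGrad (u : 𝓜.TestFunction) : 𝓜.testGrad u ^ 2 = ∫ x, 𝓜.gradAbs u x ^ 2 ∂𝓜.m :=
  Real.sq_sqrt (integral_nonneg fun _ => sq_nonneg _)

theorem testGrad_parallelogram {g : 𝓜.RiemannianMetric} (hg : IsRiemannian 𝓜 g)
    (u v : 𝓜.TestFunction) : 𝓜.testGrad (u + v) ^ 2 + 𝓜.testGrad (u - v) ^ 2 =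
      2 * 𝓜.testGrad u ^ 2 + 2 * 𝓜.testGrad v ^ 2 := by
  have hi : ∀ w : 𝓜.TestFunction, Integrable (fun x => 𝓜.gradAbs w x ^ 2) 𝓜.m := fun w =>
    (𝓜.memLp_gradAbs w).integrable_sq
  simp only [sq_testGrad]
  rw [← integral_const_mul, ← integral_const_mul, ← integral_add (hi _) (hi _),
    ← integral_add ((hi u).const_mul 2) ((hi v).const_mul 2)]
  refine integral_congr_ae (Filter.Eventually.of_forall fun x => ?_)
  have h1 : differential 𝓜.n (u + v : 𝓜.TestFunction) x =
      differential 𝓜.n u x + differential 𝓜.n v x :=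
    differential_add u.contMDiff v.contMDiff x
  have h2 : differential 𝓜.n (u - v : 𝓜.TestFunction) x =
      differential 𝓜.n u x - differential 𝓜.n v x := by
    have h3 := differential_add (u - v).contMDiff v.contMDiff x
    have h4 : (u - v).1 + v.1 = u.1 := congrArg Subtype.val (sub_add_cancel u v)
    rw [h4] at h3
    exact eq_sub_of_add_eq h3.symm
  have h3 := dual_parallelogram hg x (differential 𝓜.n u x) (differential 𝓜.n v x)
  rw [← h1, ← h2] at h3
  exact h3

theorem normGrad_parallelogram {g : 𝓜.RiemannianMetric} (hg : IsRiemannian 𝓜 g)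
    (u v : 𝓜.Sobolev) : 𝓜.normGrad (u + v) ^ 2 + 𝓜.normGrad (u - v) ^ 2 =
      2 * 𝓜.normGrad u ^ 2 + 2 * 𝓜.normGrad v ^ 2 := by
  have hc := continuous_normGrad (𝓜 := 𝓜)
  induction u, v using UniformSpace.Completion.induction_on₂ with
  | hp => exact isClosed_eq (by fun_prop) (by fun_prop)
  | ih u v =>
    rw [← UniformSpace.Completion.coe_add, ← UniformSpace.Completion.coe_sub]
    simp only [𝓜.normGrad_coe]
    exact testGrad_parallelogram hg u v

theorem normL2_parallelogram (u v : 𝓜.Sobolev) : 𝓜.normL2 (u + v) ^ 2 + 𝓜.normL2 (u - v) ^ 2 =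
    2 * 𝓜.normL2 u ^ 2 + 2 * 𝓜.normL2 v ^ 2 := by
  simp only [← norm_toL2, map_add, map_sub]
  rw [parallelogram_law_with_norm ℝ, mul_add]

theorem energy_le_iff {u : 𝓜.Sphere} {c : ℝ≥0∞} (hc : c ≠ ⊤) :
    ENNReal.ofReal (𝓜.energy u) ≤ c ↔ 𝓜.normGrad u ^ 2 ≤ c.toReal * 𝓜.normL2 u ^ 2 := by
  have h : 𝓜.normL2 u = 1 := u.2
  rw [CompactFMMM.energy, h, one_pow, div_one, mul_one, ENNReal.ofReal_le_iff_le_toReal hc]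

/-- The min-max principle for the Beltrami–Laplacian in terms of the genus. -/
theorem eigenvalue_dimK_eq {g : 𝓜.RiemannianMetric} (hg : IsRiemannian 𝓜 g) (α : FamilyIndex)
    {k : ℕ} (hk : 1 ≤ k) :
    eigenvalue 𝓜 (familyD 𝓜 α) (dimK 𝓜) k = laplaceEigenvalue 𝓜 k := by
  obtain ⟨a, haf, ha, haQ⟩ := exists_bilinear_of_parallelogram
    (Q := fun u => 𝓜.normL2 u ^ 2) (continuous_normL2.pow 2)
    (normL2_parallelogram (𝓜 := 𝓜))
  obtain ⟨b, hbf, hb, hbQ⟩ := exists_bilinear_of_parallelogram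
    (Q := fun u => 𝓜.normGrad u ^ 2) (continuous_normGrad.pow 2)
    (normGrad_parallelogram hg)
  have hapos : ∀ u, 0 ≤ a u u := fun u => by rw [haQ]; exact sq_nonneg _
  have hbpos : ∀ u, 0 ≤ b u u := fun u => by rw [hbQ]; exact sq_nonneg _
  have heig : ∀ (r : ℝ) (w : 𝓜.Sobolev), IsLaplaceEigenfunction 𝓜 r w ↔
      w ≠ 0 ∧ ∀ v, b w v = r * a w v := fun r w => by
    simp only [haf, hbf]
    rfl
  -- the conditions `ENNReal.ofReal r ≤ c` and `r ≤ c.toReal` agree for finite `c`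
  have hle : ∀ {c : ℝ≥0∞}, c ≠ ⊤ → ∀ r : ℝ, ENNReal.ofReal r ≤ c ↔ r ≤ c.toReal := fun hc r =>
    ENNReal.ofReal_le_iff_le_toReal hc
  refine le_antisymm (le_sInf ?_) (le_of_forall_lt_imp_le_of_dense fun c hc => le_sSup ?_)
  · rintro c ⟨e, μ, hli, he⟩
    refine sSup_le fun c' hc' => ?_
    by_contra! hlt
    have hctop : c ≠ ⊤ := (hlt.trans_le le_top).ne
    refine absurd (show sublevelDim 𝓜 (familyD 𝓜 α) (dimK 𝓜) c' < k from hc') (not_lt.2 ?_)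
    set V := Submodule.span ℝ (range e) with hV
    have hfin : FiniteDimensional ℝ V := FiniteDimensional.span_of_finite ℝ (finite_range e)
    have hrank : Module.finrank ℝ V = k := by
      rw [hV, finrank_span_eq_card hli, Fintype.card_fin]
    refine (le_dimK_subspaceSphere V hk hrank).trans
      (le_iSup₂_of_le _ ⟨subspaceSphere_mem_familyD α V, fun u hu => ?_⟩ le_rfl)
    refine le_trans ?_ hlt.le
    rw [energy_le_iff hctop, ← haQ, ← hbQ]
    exact rayleigh_le_of_eigenvectors ha hb hapos (fun i => ((heig _ _).1 (he i).1).2)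
      (fun i => (hle hctop _).1 (he i).2) hu
  · have hctop : c ≠ ⊤ := (hc.trans_le le_top).ne
    let P : ℕ → Prop := fun m => ∃ (e : Fin m → 𝓜.Sobolev) (μ : Fin m → ℝ), LinearIndependent ℝ e ∧
      ∀ i, IsLaplaceEigenfunction 𝓜 (μ i) (e i) ∧ ENNReal.ofReal (μ i) ≤ c
    have hPk : ¬ P k := fun h => absurd hc (not_lt.2 (sInf_le h))
    -- a maximal family of independent eigenfunctions
    obtain ⟨m, hmk, ⟨e, μ, hli, he⟩, hm⟩ : ∃ m < k, P m ∧ ¬ P (m + 1) := by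
      by_contra! h
      refine hPk (Nat.le_induction (m := 0) (P := fun m _ => m ≤ k → P m) (fun _ =>
        ⟨Fin.elim0, Fin.elim0, linearIndependent_empty_type, fun i => i.elim0⟩)
        (fun m _ ih hm => h m (by omega) (ih (by omega))) k (Nat.zero_le k) le_rfl)
    have hspan : ∀ (w : 𝓜.Sobolev) (r : ℝ), w ≠ 0 → r ≤ c.toReal → (∀ v, b w v = r * a w v) →
        w ∈ Submodule.span ℝ (range e) := by
      intro w r hw hr hwr
      by_contra hnot
      refine hm ⟨Fin.cons w e, Fin.cons r μ, hli.finCons hnot, fun i => ?_⟩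
      refine Fin.cases ?_ (fun j => ?_) i
      · simpa using And.intro ((heig r w).2 ⟨hw, hwr⟩) ((hle hctop r).2 hr)
      · simpa using he j
    have hac : ∀ v, Continuous fun u => a u v := fun v => by
      have := continuous_normL2 (𝓜 := 𝓜)
      simp only [haf]
      fun_prop
    have hgenus : ∀ A : Set 𝓜.Sphere, (∀ u ∈ A, ENNReal.ofReal (𝓜.energy u) ≤ c) →
        dimK 𝓜 A ≤ m := by
      intro A hA
      refine krasnoselskiiGenus_le
        (h := fun u => WithLp.toLp 2 fun i => a (u : 𝓜.Sobolev) (e i)) ?_ fun u hu => ⟨?_, ?_⟩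
      · refine ((PiLp.continuous_toLp 2 _).comp (continuous_pi fun i => ?_)).continuousOn
        exact (hac (e i)).comp continuous_subtype_val
      · intro h0
        have h1 : ∀ i, a (u : 𝓜.Sobolev) (e i) = 0 := fun i => congrArg (fun y => y.ofLp i) h0
        have h2 := lt_rayleigh_of_orthogonal ha hb hapos hbpos
          (fun u hu => eq_zero_of_normL2_eq_zero (by
            rw [haQ] at hu
            exact (pow_eq_zero_iff two_ne_zero).1 hu))
          (by simp only [haQ]; exact continuous_normL2.pow 2)
          (by simp only [hbQ]; exact continuous_normGrad.pow 2) hac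
          (fun u => by
            rw [haQ, hbQ, Real.sqrt_sq (normL2_nonneg u), Real.sqrt_sq (normGrad_nonneg u)]
            exact (norm_sobolev u).le)
          (fun ε hε => by
            simp only [haQ, Real.sqrt_sq (normL2_nonneg _)]
            exact exists_functionals 𝓜 hε)
          hli (fun i => ((heig _ _).1 (he i).1).2) hspan (Sphere.ne_zero u) h1
        rw [haQ, hbQ] at h2
        exact absurd ((energy_le_iff hctop).1 (hA u hu)) (not_le.2 h2)
      · ext i
        change a (-(u : 𝓜.Sobolev)) (e i) = -a (u : 𝓜.Sobolev) (e i)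
        rw [map_neg, LinearMap.neg_apply]
    refine lt_of_le_of_lt (iSup₂_le fun A hA => hgenus A hA.2) ?_
    exact Nat.cast_lt.2 hmk

end Riemannian

end FinslerSpectrum

end

theorem mainTheorem6 :
    (∀ (𝓜 : FinslerSpectrum.CompactFMMM.{u}) (α : FinslerSpectrum.FamilyIndex),
      (∀ A ∈ FinslerSpectrum.familyD 𝓜 α,
        FinslerSpectrum.dimLS 𝓜 A = FinslerSpectrum.dimK 𝓜 A) ∧
      ∀ k : ℕ, 1 ≤ k →
        FinslerSpectrum.eigenvalue 𝓜 (FinslerSpectrum.familyC 𝓜 α) (FinslerSpectrum.dimLS 𝓜) k =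
        FinslerSpectrum.eigenvalue 𝓜 (FinslerSpectrum.familyD 𝓜 α) (FinslerSpectrum.dimK 𝓜) k) ∧
    ∀ α : FinslerSpectrum.FamilyIndex,
      FinslerSpectrum.IsFaithful.{u} (fun 𝓜 => FinslerSpectrum.familyD 𝓜 α)
        (fun 𝓜 => FinslerSpectrum.dimK 𝓜) := by
  refine ⟨fun 𝓜 α => ⟨fun A hA => FinslerSpectrum.dimLS_eq_dimK hA, fun k _ => ?_⟩, fun α => ?_⟩
  · simp only [FinslerSpectrum.eigenvalue, FinslerSpectrum.sublevelDim_dimLS_eq]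
  · exact
      { dimensionPair := fun 𝓜 => FinslerSpectrum.isDimensionPair_dimK 𝓜 α
        eigenvalue_eq := fun 𝓜 g hg k hk => FinslerSpectrum.eigenvalue_dimK_eq hg α hk }
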